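/- **Setting.** Let $N\ge 3$ and let $\boldsymbol k=(k_n)$, $\boldsymbol\ell=(\ell_n)$ be sequences of positive integers indexed by $n\in\mathbb Z/N$. Let $X$ be the blow-up of $(\mathbb P^1)^N$, with coordinates $f_n$, along $C_n^i=\{f_{n-1}=0,\ f_n=-u_n^i,\ f_{n+1}=\infty\}$ $(1\le i\le k_n)$ and $C_n^{-j}=\{f_{n-1}=\infty,\ f_n=-1/v_n^{-j},\ f_{n+1}=0\}$ $(1\le j\le\ell_n)$, with nonzero parameters $u_n^i,v_n^{-j}$. Its Néron–Severi bilattice $N(X)$ is the pair of the free $\mathbb Z$-modules $H^2$ with basis $H_n,E_n^i$ and $H_2$ with basis $h_n,e_n^i$ ($n\in\mathbb Z/N$; $1\le i\le k_n$ or $-\ell_n\le i\le -1$), with the pairing $\langle H_m,h_n\rangle=\delta_{mn}$, $\langle E_m^i,e_n^j\rangle=-\delta_{mn}\delta_{ij}$, and $0$ otherwise. For $-\ell_n<i<k_n$ put $\alpha_n^0=H_n-E_n^1-E_n^{-1}$, $\check\alpha_n^0=h_{n-1}+h_{n+1}-e_n^1-e_n^{-1}$, and, for $i\ge1$ and $j\ge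 1$, $\alpha_n^{i}=E_n^{i}-E_n^{i+1}$, $\check\alpha_n^{i}=e_n^{i}-e_n^{i+1}$, $\alpha_n^{-j}=E_n^{-j}-E_n^{-j-1}$, $\check\alpha_n^{-j}=e_n^{-j}-e_n^{-j-1}$. Let $Q=\bigoplus\mathbb Z\alpha_n^i$, and write $\check\alpha=\sum c_n^i\check\alpha_n^i$ for $\alpha=\sum c_n^i\alpha_n^i\in Q$. The Weyl group $W=W(T^{\boldsymbol k}_{\boldsymbol\ell})\subset\mathrm{Aut}(N(X))$ is generated by the reflections $s_n^i$ acting by $\Lambda\mapsto\Lambda+\langle\Lambda,\check\alpha_n^i\rangle\alpha_n^i$ on $H^2$ and $\lambda\mapsto\lambda+\langle\alpha_n^i,\lambda\rangle\check\alpha_n^i$ on $H_2$. Put $\delta=-\tfrac12K_X=\sum_n\bigl(H_n-\sum_iE_n^i\bigr)$ and $\check\delta=-\tfrac12k_X=\sum_n\bigl(2h_n-\sum_ie_n^i\bigr)$, the inner sums being over all admissible $i$, positive and negative. Let $a_n^i$ be independent variables, one for each simple root, and let $\mathbb K=\mathbb C(a^{1/p})$, where $p\ge 1$ is a common multiple of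 the $k_n+\ell_n$. Put $$u_n=\frac{(a_n^0)^{\frac{\ell_n}{k_n+\ell_n}}\prod_{j=1}^{\ell_n-1}(a_n^{-j})^{\frac{\ell_n-j}{k_n+\ell_n}}}{\prod_{i=1}^{k_n-1}(a_n^i)^{\frac{k_n-i}{k_n+\ell_n}}},\qquad v_n=\frac{(a_n^0)^{\frac{k_n}{k_n+\ell_n}}\prod_{i=1}^{k_n-1}(a_n^{i})^{\frac{k_n-i}{k_n+\ell_n}}}{\prod_{j=1}^{\ell_n-1}(a_n^{-j})^{\frac{\ell_n-j}{k_n+\ell_n}}}.$$ **Theorem.** Assume that the Dynkin diagram $T^{\boldsymbol k}_{\boldsymbol\ell}$ of the simple roots $\alpha_n^i$ is of affine type (its generalized Cartan matrix is indecomposable, has corank one, and annihilates a vector with positive entries). Then: (i) Every $w\in W$ preserves $\langle\ ,\ \rangle$, $\delta$ and $\check\delta$; and $\delta=\sum d_n^i\alpha_n^i$, $\check\delta=\sum d_n^i\check\alpha_n^i$ with positive integers $d_n^i$. For every $\alpha\in Q$ the integer $\langle\alpha,\check\alpha\rangle$ is even, and there is $t_\alpha\in W$ given by $$t_\alpha(\Lambda)=\Lambda-\langle\Lambda,\check\delta\rangle\alpha+\Bigl(\langle\Lambda,\check\alpha\rangle-\tfrac12\langle\alpha,\check\alpha\rangle\langle\Lambda,\check\delta\rangle\Bigr)\delta,$$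 $$t_\alpha(\lambda)=\lambda-\langle\delta,\lambda\rangle\check\alpha+\Bigl(\langle\alpha,\lambda\rangle-\tfrac12\langle\alpha,\check\alpha\rangle\langle\delta,\lambda\rangle\Bigr)\check\delta$$ for $\Lambda\in H^2$, $\lambda\in H_2$. One has $t_\alpha t_\beta=t_\beta t_\alpha=t_{\alpha+\beta}$, and $\{t_\alpha\mid\alpha\in Q\}$ is the lattice part of $W$: a normal subgroup for which the subgroup generated by all simple reflections but a suitable one is a complement. There is an action of $W$ on $\mathbb K(f)=\mathbb K(f_1,\dots,f_N)$ by $\mathbb C$-automorphisms in which each $s_n^i$ acts on the root variables by $s_n^i(a_m^j)=a_m^j(a_n^i)^{\langle\alpha_m^j,\check\alpha_n^i\rangle}$ (likewise on their $p$-th roots), $s_n^0$ acts by $$s_n^0(f_{n-1})=(a_n^0)^{\frac{\ell_{n-1}}{k_{n-1}+\ell_{n-1}}}f_{n-1}\frac{f_n+1/v_n}{f_n+u_n},\qquad s_n^0(f_{n+1})=(a_n^0)^{-\frac{k_{n+1}}{k_{n+1}+\ell_{n+1}}}f_{n+1}\frac{f_n+u_n}{f_n+1/v_n},$$ and $s_n^i(f_m)=f_m$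 in all other cases. In this action the $t_\alpha$ $(\alpha\in Q)$ are commuting discrete time evolutions, $t_\alpha t_\beta=t_\beta t_\alpha=t_{\alpha+\beta}$ on $\mathbb K(f)$, of $q$-difference type: with $q=\prod(a_n^i)^{d_n^i}$ one has $t_\alpha(q)=q$ and $t_\alpha(a_n^i)=a_n^i\,q^{\langle\alpha_n^i,\check\alpha\rangle}$. (ii) For all $\alpha\in Q$, $n\ge 0$ and $i\in\mathbb Z/N$, $$(t_\alpha)^n(H_i)=t_{n\alpha}(H_i)=H_i-n\langle H_i,\check\delta\rangle\alpha+\Bigl(n\langle H_i,\check\alpha\rangle-\tfrac{n^2}{2}\langle\alpha,\check\alpha\rangle\langle H_i,\check\delta\rangle\Bigr)\delta .$$ The degree of the rational function $(t_\alpha)^n(f_i)\in\mathbb K(f)$ with respect to $f_j$ (the larger of the $f_j$-degrees of numerator and denominator in lowest terms) is at most $\langle (t_\alpha)^n(H_i),h_j\rangle$. Both are at most of order $n^2$: for every $\alpha\in Q$ there is a constant $C$ such that, for all $n\ge1$ and all $i,j$, $|\langle (t_\alpha)^n(H_i),h_j\rangle|\le Cn^2$ and the degree of $(t_\alpha)^n(f_i)$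 in $f_j$ is at most $Cn^2$. -/

import Mathlib

namespace TropicalWeyl

noncomputable section

instance neZeroOfThreeLe (N : ℕ) [h : Fact (3 ≤ N)] : NeZero N :=
  ⟨by have := h.out; omega⟩

section Lattice

variable {N : ℕ} (k ℓ : ZMod N → ℕ+)

/-- Indices `(n, i)` of the exceptional divisors `E_n^i`:
`1 ≤ i ≤ k_n` or `-ℓ_n ≤ i ≤ -1`. -/
abbrev Exc : Type :=
  Σ n : ZMod N, ↥((Finset.Icc (-((ℓ n : ℕ) : ℤ)) ((k n : ℕ) : ℤ)).erase 0)

/-- Vertices `(n, i)` of the Dynkin diagram: `-ℓ_n + 1 ≤ i ≤ k_n - 1`. -/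
abbrev Node : Type :=
  Σ n : ZMod N, ↥(Finset.Ioo (-((ℓ n : ℕ) : ℤ)) ((k n : ℕ) : ℤ))

/-- `H²(X, ℤ)`: the free module on the classes `H_n` (left) and `E_n^i` (right). -/
abbrev Coh : Type := ZMod N ⊕ Exc k ℓ → ℤ

/-- `H₂(X, ℤ)`: the free module on the classes `h_n` (left) and `e_n^i` (right). -/
abbrev Homol : Type := ZMod N ⊕ Exc k ℓ → ℤ

/-- The basis element with left index `n`, that is `H_n` in `H²` and `h_n` in `H₂`. -/
def hyp (n : ZMod N) : ZMod N ⊕ Exc k ℓ → ℤ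
  | Sum.inl m => if m = n then 1 else 0
  | Sum.inr _ => 0

/-- The basis element with right index `(n, i)`, that is `E_n^i` in `H²` and `e_n^i` in `H₂`.
(It is only used for `i` in the range of `Exc`.) -/
def exc (n : ZMod N) (i : ℤ) : ZMod N ⊕ Exc k ℓ → ℤ
  | Sum.inl _ => 0
  | Sum.inr x => if x.1 = n ∧ (x.2 : ℤ) = i then 1 else 0

/-- The simple root `α_n^i`. -/
def simpleRoot (ν : Node k ℓ) : Coh k ℓ :=
  if (ν.2 : ℤ) = 0 then hyp k ℓ ν.1 - exc k ℓ ν.1 1 - exc k ℓ ν.1 (-1)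
  else if 0 < (ν.2 : ℤ) then exc k ℓ ν.1 ν.2 - exc k ℓ ν.1 (ν.2 + 1)
  else exc k ℓ ν.1 ν.2 - exc k ℓ ν.1 (ν.2 - 1)

/-- The simple coroot `α̌_n^i`. -/
def simpleCoroot (ν : Node k ℓ) : Homol k ℓ :=
  if (ν.2 : ℤ) = 0 then
    hyp k ℓ (ν.1 - 1) + hyp k ℓ (ν.1 + 1) - exc k ℓ ν.1 1 - exc k ℓ ν.1 (-1)
  else if 0 < (ν.2 : ℤ) then exc k ℓ ν.1 ν.2 - exc k ℓ ν.1 (ν.2 + 1)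
  else exc k ℓ ν.1 ν.2 - exc k ℓ ν.1 (ν.2 - 1)

variable [Fact (3 ≤ N)]

/-- The intersection pairing `H² × H₂ → ℤ`: `⟨H_m, h_n⟩ = δ_{mn}`,
`⟨E_m^i, e_n^j⟩ = -δ_{mn} δ_{ij}`, and `0` on the other pairs of basis elements. -/
def pairing : Coh k ℓ →ₗ[ℤ] Homol k ℓ →ₗ[ℤ] ℤ :=
  LinearMap.mk₂ ℤ
    (fun Λ l => ∑ n : ZMod N, Λ (Sum.inl n) * l (Sum.inl n)
      - ∑ x : Exc k ℓ, Λ (Sum.inr x) * l (Sum.inr x))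
    (fun a b c => by
      simp only [Pi.add_apply, add_mul, Finset.sum_add_distrib]; ring)
    (fun r a c => by
      simp only [Pi.smul_apply, smul_eq_mul, mul_assoc, ← Finset.mul_sum]; ring)
    (fun a b c => by
      simp only [Pi.add_apply, mul_add, Finset.sum_add_distrib]; ring)
    (fun r a c => by
      simp only [Pi.smul_apply, smul_eq_mul, mul_left_comm _ r, ← Finset.mul_sum]; ring)

theorem pairing_hyp (Λ : Coh k ℓ) (n : ZMod N) :
    pairing k ℓ Λ (hyp k ℓ n) = Λ (Sum.inl n) := by
  simp [pairing, hyp]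

theorem pairing_exc (Λ : Coh k ℓ) (n : ZMod N) (i : ℤ)
    (hi : i ∈ (Finset.Icc (-((ℓ n : ℕ) : ℤ)) ((k n : ℕ) : ℤ)).erase 0) :
    pairing k ℓ Λ (exc k ℓ n i) = -Λ (Sum.inr ⟨n, ⟨i, hi⟩⟩) := by
  have h : ∀ x : Exc k ℓ, (x.1 = n ∧ (x.2 : ℤ) = i) ↔ x = ⟨n, ⟨i, hi⟩⟩ := by
    rintro ⟨m, ⟨j, hj⟩⟩
    constructor
    · rintro ⟨h1, h2⟩
      simp only at h1 h2
      subst h1; subst h2; rfl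
    · intro hx
      cases hx
      exact ⟨rfl, rfl⟩
  simp [pairing, exc, h]

theorem pairing_simpleRoot_self (ν : Node k ℓ) :
    pairing k ℓ (simpleRoot k ℓ ν) (simpleCoroot k ℓ ν) = -2 := by
  obtain ⟨n, ⟨i, hi⟩⟩ := ν
  have hN : 3 ≤ N := Fact.out
  have : Fact (1 < N) := ⟨by omega⟩
  have hk : 0 < (k n : ℕ) := (k n).pos
  have hl : 0 < (ℓ n : ℕ) := (ℓ n).pos
  have hi' := Finset.mem_Ioo.mp hi
  unfold simpleRoot simpleCoroot
  by_cases h0 : i = 0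
  · subst h0
    simp only [if_true]
    generalize hΛ : hyp k ℓ n - exc k ℓ n 1 - exc k ℓ n (-1) = Λ
    rw [map_sub, map_sub, map_add, pairing_hyp, pairing_hyp,
      pairing_exc k ℓ Λ n 1 (by simp; omega), pairing_exc k ℓ Λ n (-1) (by simp; omega), ← hΛ]
    simp [hyp, exc]
  · by_cases hp : 0 < i
    · simp only [h0, hp, if_true, if_false]
      rw [LinearMap.map_sub (pairing k ℓ (exc k ℓ n i - exc k ℓ n (i + 1))),
        pairing_exc k ℓ _ n i (by simp; omega),
        pairing_exc k ℓ _ n (i + 1) (by simp; omega)]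
      simp [exc]
    · simp only [h0, hp, if_false]
      rw [LinearMap.map_sub (pairing k ℓ (exc k ℓ n i - exc k ℓ n (i - 1))),
        pairing_exc k ℓ _ n i (by simp; omega),
        pairing_exc k ℓ _ n (i - 1) (by simp; omega)]
      have hne : i ≠ i - 1 := by omega
      simp [exc, hne]

/-- The group of pairs of automorphisms of `H²` and `H₂`. -/
abbrev BiAut : Type := (Coh k ℓ ≃ₗ[ℤ] Coh k ℓ) × (Homol k ℓ ≃ₗ[ℤ] Homol k ℓ)

/-- The simple reflection: `Λ ↦ Λ + ⟨Λ, α̌⟩ α` on `H²` and `l ↦ l + ⟨α, l⟩ α̌` on `H₂`. -/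
def simpleReflection (ν : Node k ℓ) : BiAut k ℓ :=
  (LinearEquiv.ofInvolutive
      (LinearMap.id + ((pairing k ℓ).flip (simpleCoroot k ℓ ν)).smulRight (simpleRoot k ℓ ν))
      (fun Λ => by
        simp only [LinearMap.add_apply, LinearMap.id_apply, LinearMap.smulRight_apply,
          LinearMap.flip_apply, map_add, map_smul,
          pairing_simpleRoot_self]
        module),
    LinearEquiv.ofInvolutive
      (LinearMap.id + (pairing k ℓ (simpleRoot k ℓ ν)).smulRight (simpleCoroot k ℓ ν))
      (fun l => by
        simp only [LinearMap.add_apply, LinearMap.id_apply, LinearMap.smulRight_apply,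
          map_add, map_smul, pairing_simpleRoot_self]
        module))

theorem simpleReflection_fst (ν : Node k ℓ) (Λ : Coh k ℓ) :
    (simpleReflection k ℓ ν).1 Λ
      = Λ + pairing k ℓ Λ (simpleCoroot k ℓ ν) • simpleRoot k ℓ ν := rfl

theorem simpleReflection_snd (ν : Node k ℓ) (l : Homol k ℓ) :
    (simpleReflection k ℓ ν).2 l
      = l + pairing k ℓ (simpleRoot k ℓ ν) l • simpleCoroot k ℓ ν := rfl

/-- The Weyl group `W(T^k_ℓ)`, generated by the simple reflections inside `Aut N(X)`. -/
def weylGroup : Subgroup (BiAut k ℓ) := Subgroup.closure (Set.range (simpleReflection k ℓ))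

/-- A simple reflection as an element of the Weyl group. -/
def simpleRefl (ν : Node k ℓ) : weylGroup k ℓ :=
  ⟨simpleReflection k ℓ ν, Subgroup.subset_closure (Set.mem_range_self ν)⟩

/-- The action of the Weyl group on `H²`. -/
def actCoh (w : weylGroup k ℓ) (Λ : Coh k ℓ) : Coh k ℓ := w.1.1 Λ

/-- The action of the Weyl group on `H₂`. -/
def actHom (w : weylGroup k ℓ) (l : Homol k ℓ) : Homol k ℓ := w.1.2 l

/-- The generalized Cartan matrix of the simple roots, whose diagram is `T^k_ℓ`. -/
def cartanMatrix : Matrix (Node k ℓ) (Node k ℓ) ℤ :=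
  Matrix.of fun μ ν => -pairing k ℓ (simpleRoot k ℓ ν) (simpleCoroot k ℓ μ)

/-- The element `∑ c_ν α_ν` of the root lattice `Q`, given by its coordinates. -/
def root (c : Node k ℓ → ℤ) : Coh k ℓ := ∑ ν, c ν • simpleRoot k ℓ ν

/-- The element `∑ c_ν α̌_ν` of the coroot lattice, which corresponds to `∑ c_ν α_ν`. -/
def coroot (c : Node k ℓ → ℤ) : Homol k ℓ := ∑ ν, c ν • simpleCoroot k ℓ ν

/-- `δ = -K_X/2 = ∑_n (H_n - ∑_i E_n^i)`. -/
def delta : Coh k ℓ := ∑ n : ZMod N, hyp k ℓ n - ∑ x : Exc k ℓ, exc k ℓ x.1 x.2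

/-- `δ̌ = -k_X/2 = ∑_n (2 h_n - ∑_i e_n^i)`. -/
def deltaCheck : Homol k ℓ :=
  (2 : ℤ) • ∑ n : ZMod N, hyp k ℓ n - ∑ x : Exc k ℓ, exc k ℓ x.1 x.2

/-- The number `⟨α, α̌⟩ / 2` (an integer, as `⟨α, α̌⟩` is always even). -/
def halfNorm (c : Node k ℓ → ℤ) : ℤ := pairing k ℓ (root k ℓ c) (coroot k ℓ c) / 2

/-- Kac's translation formula on `H²` for `α = ∑ c_ν α_ν`. -/
def kacCoh (c : Node k ℓ → ℤ) (Λ : Coh k ℓ) : Coh k ℓ :=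
  Λ - pairing k ℓ Λ (deltaCheck k ℓ) • root k ℓ c
    + (pairing k ℓ Λ (coroot k ℓ c)
        - halfNorm k ℓ c * pairing k ℓ Λ (deltaCheck k ℓ)) • delta k ℓ

/-- Kac's translation formula on `H₂` for `α = ∑ c_ν α_ν`. -/
def kacHom (c : Node k ℓ → ℤ) (l : Homol k ℓ) : Homol k ℓ :=
  l - pairing k ℓ (delta k ℓ) l • coroot k ℓ c
    + (pairing k ℓ (root k ℓ c) l
        - halfNorm k ℓ c * pairing k ℓ (delta k ℓ) l) • deltaCheck k ℓ

end Lattice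

/-- A generalized Cartan matrix is of affine type: it is indecomposable, of corank one, and
annihilates a vector with positive entries. -/
def IsAffineType {ι : Type*} [Fintype ι] (A : Matrix ι ι ℤ) : Prop :=
  (∀ S : Set ι, S.Nonempty → Sᶜ.Nonempty → ∃ i ∈ S, ∃ j ∈ Sᶜ, A i j ≠ 0) ∧
  (A.map (Int.cast : ℤ → ℝ)).rank + 1 = Fintype.card ι ∧
  ∃ u : ι → ℝ, (∀ i, 0 < u i) ∧ (A.map (Int.cast : ℤ → ℝ)).mulVec u = 0

section FunctionField

variable {N : ℕ} (k ℓ : ZMod N → ℕ+)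

/-- The coefficient field `𝕂 = ℂ(a^{1/p})`: rational functions in the independent variables
`a_ν^{1/p}`. -/
abbrev CoefField : Type := FractionRing (MvPolynomial (Node k ℓ) ℂ)

/-- The field `𝕂(f)` of rational functions in `f_n`, `n ∈ ℤ/N`. -/
abbrev FunField : Type := FractionRing (MvPolynomial (ZMod N) (CoefField k ℓ))

/-- The variable `a_ν^{1/p}` of the coefficient field. -/
def aRootK (ν : Node k ℓ) : CoefField k ℓ :=
  algebraMap (MvPolynomial (Node k ℓ) ℂ) (CoefField k ℓ) (MvPolynomial.X ν)

/-- The variable `a_ν^{1/p}`, as an element of `𝕂(f)`. -/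
def aRoot (ν : Node k ℓ) : FunField k ℓ :=
  algebraMap (MvPolynomial (ZMod N) (CoefField k ℓ)) (FunField k ℓ) (MvPolynomial.C (aRootK k ℓ ν))

/-- The coordinate `f_n`. -/
def fVar (n : ZMod N) : FunField k ℓ :=
  algebraMap (MvPolynomial (ZMod N) (CoefField k ℓ)) (FunField k ℓ) (MvPolynomial.X n)

/-- The root variable `a_ν = (a_ν^{1/p})^p`. -/
def aVar (p : ℕ) (ν : Node k ℓ) : FunField k ℓ := aRoot k ℓ ν ^ p

/-- The node `(n, 0)`. -/
def centre (n : ZMod N) : Node k ℓ := ⟨n, ⟨0, by simp⟩⟩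

/-- `∏_{i=1}^{k_n-1} (a_n^i)^{(k_n-i)/(k_n+ℓ_n)}`, with `p` a multiple of `k_n + ℓ_n`. -/
def armPos (p : ℕ) (n : ZMod N) : FunField k ℓ :=
  ∏ i : ↥(Finset.Ioo (-((ℓ n : ℕ) : ℤ)) ((k n : ℕ) : ℤ)),
    if 0 < (i : ℤ) then
      aRoot k ℓ ⟨n, i⟩ ^ (((p / (k n + ℓ n : ℕ) : ℕ) : ℤ) * (((k n : ℕ) : ℤ) - i)) else 1

/-- `∏_{j=1}^{ℓ_n-1} (a_n^{-j})^{(ℓ_n-j)/(k_n+ℓ_n)}`, with `p` a multiple of `k_n + ℓ_n`. -/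
def armNeg (p : ℕ) (n : ZMod N) : FunField k ℓ :=
  ∏ i : ↥(Finset.Ioo (-((ℓ n : ℕ) : ℤ)) ((k n : ℕ) : ℤ)),
    if (i : ℤ) < 0 then
      aRoot k ℓ ⟨n, i⟩ ^ (((p / (k n + ℓ n : ℕ) : ℕ) : ℤ) * (((ℓ n : ℕ) : ℤ) + i)) else 1

/-- `(a_n^0)^{k_m/(k_m+ℓ_m)}`, with `p` a multiple of `k_m + ℓ_m`. -/
def powK (p : ℕ) (n m : ZMod N) : FunField k ℓ :=
  aRoot k ℓ (centre k ℓ n) ^ (p / (k m + ℓ m : ℕ) * k m)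

/-- `(a_n^0)^{ℓ_m/(k_m+ℓ_m)}`, with `p` a multiple of `k_m + ℓ_m`. -/
def powL (p : ℕ) (n m : ZMod N) : FunField k ℓ :=
  aRoot k ℓ (centre k ℓ n) ^ (p / (k m + ℓ m : ℕ) * ℓ m)

/-- The parameter `u_n`. -/
def uPar (p : ℕ) (n : ZMod N) : FunField k ℓ :=
  powL k ℓ p n n * armNeg k ℓ p n / armPos k ℓ p n

/-- The parameter `v_n`. -/
def vPar (p : ℕ) (n : ZMod N) : FunField k ℓ :=
  powK k ℓ p n n * armPos k ℓ p n / armNeg k ℓ p n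

/-- The degree in `f_j` of an element of `𝕂(f)`: the larger of the degrees in `f_j` of the
numerator and the denominator in lowest terms. -/
def degIn (j : ZMod N) (R : FunField k ℓ) : ℕ :=
  max ((IsFractionRing.num (MvPolynomial (ZMod N) (CoefField k ℓ)) R).degreeOf j)
    ((IsFractionRing.den (MvPolynomial (ZMod N) (CoefField k ℓ)) R :
      MvPolynomial (ZMod N) (CoefField k ℓ)).degreeOf j)

variable [Fact (3 ≤ N)]

/-- `σ` is the birational transformation attached to the simple reflection `s_ν`:
`a_μ ↦ a_μ a_ν^{⟨α_μ, α̌_ν⟩}` (also for the `p`-th roots); if `ν = (n, 0)`,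
`f_{n-1} ↦ (a_n^0)^{ℓ_{n-1}/(k_{n-1}+ℓ_{n-1})} f_{n-1} (f_n + 1/v_n)/(f_n + u_n)` and
`f_{n+1} ↦ (a_n^0)^{-k_{n+1}/(k_{n+1}+ℓ_{n+1})} f_{n+1} (f_n + u_n)/(f_n + 1/v_n)`;
all the other `f_m` are fixed. -/
def IsBirationalReflection (p : ℕ) (ν : Node k ℓ) (σ : FunField k ℓ ≃ₐ[ℂ] FunField k ℓ) : Prop :=
  (∀ μ, σ (aRoot k ℓ μ) = aRoot k ℓ μ *
      aRoot k ℓ ν ^ pairing k ℓ (simpleRoot k ℓ μ) (simpleCoroot k ℓ ν)) ∧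
  ((ν.2 : ℤ) = 0 →
    σ (fVar k ℓ (ν.1 - 1)) = powL k ℓ p ν.1 (ν.1 - 1) * fVar k ℓ (ν.1 - 1) *
        ((fVar k ℓ ν.1 + 1 / vPar k ℓ p ν.1) / (fVar k ℓ ν.1 + uPar k ℓ p ν.1)) ∧
    σ (fVar k ℓ (ν.1 + 1)) = (powK k ℓ p ν.1 (ν.1 + 1))⁻¹ * fVar k ℓ (ν.1 + 1) *
        ((fVar k ℓ ν.1 + uPar k ℓ p ν.1) / (fVar k ℓ ν.1 + 1 / vPar k ℓ p ν.1)) ∧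
    ∀ m, m ≠ ν.1 - 1 → m ≠ ν.1 + 1 → σ (fVar k ℓ m) = fVar k ℓ m) ∧
  ((ν.2 : ℤ) ≠ 0 → ∀ m, σ (fVar k ℓ m) = fVar k ℓ m)

end FunctionField

end

end TropicalWeyl

/-! ### Simply laced Coxeter groups: faithfulness of the geometric representation. -/

namespace CoxeterSystem

variable {B W V : Type*} [Group W] {M : CoxeterMatrix B} (cs : CoxeterSystem M W)

/-! Everything rests on the shape of the diagram. The central nodes `(n, 0)` form a cycle. The sum
of the rows of the Cartan matrix at these nodes is `0` in every central column, `-1` at the first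
node of each arm and `0` further out. A positive null vector therefore excludes arms
(`eq_one_of_isAffineType`): all `k_n` and `ℓ_n` are `1`, the diagram is the affine cycle of type A,
the marks of `δ` are all `1`, `p` is even, and `u_n = v_n = b_n` with `b_n` the square root of
`a_n^0`.

Lattice part. Since `δ` and `δ̌` are orthogonal to all coroots and roots, Kac's formula is additive
in `α`. One has `t_{α_n} = s_{δ - α_n} s_{α_n}`. Here `δ - α_n` is the sum of the other simple roots
along a path, so its reflection arises by successive conjugation (`exists_reflection_pathSum`).
Normality is `w t_α w⁻¹ = t_{wα}`. The reflections `s_m`, `m ≠ n`, fix `h_n`, whereas only the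
trivial translation does; this gives the complement.

Action on `𝕂(f)`. By faithfulness of the geometric representation, `W` is the Coxeter group of the
cycle (`coxeterEquiv`), so only the Coxeter relations have to be verified for the birational
reflections. They reduce to two cocycle identities for the factors `F_n = (b_n f_n + 1)/(f_n + b_n)`
(`braid_factor`). Monomials in the root variables transform like the roots themselves, which gives
the `q`-difference formulas.

Degrees. To a class `Λ` are attached the nonzero polynomials whose degree in `f_j` is at most `⟨Λ,
h_j⟩` and which become polynomials again when any `s_n^0` is applied and the result is multiplied by
powers of `f_n + u_n` and `f_n + 1/v_n` prescribed by `Λ` (`Admissible`). They play the role of the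
sections of `Λ` on the blow-up. The main point, `Admissible.twistedRefl`, is that the twisted
`s_n^0` carries them to those of `s_n^0 Λ`; the hard case is that of adjacent nodes, settled by the
braid relation and a study of poles (`braid_multiplier`). Both `1` and `f_i` are admissible for
`H_i`, so `w(f_i)` is a quotient of two polynomials admissible for `w(H_i)`. This bounds its degree
by `⟨w(H_i), h_j⟩`, and for `w = t_α^n` Kac's formula is quadratic in `n`. -/

theorem simple_comm_of_eq_two {i j : B} (h : M i j = 2) :
    cs.simple i * cs.simple j = cs.simple j * cs.simple i := by
  have h1 := cs.simple_mul_simple_pow i j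
  rw [h, pow_two] at h1
  have h2 := eq_inv_of_mul_eq_one_left h1
  simpa using h2

theorem simple_braid_of_eq_three {i j : B} (h : M i j = 3) :
    cs.simple i * cs.simple j * cs.simple i = cs.simple j * cs.simple i * cs.simple j := by
  have h1 := cs.simple_mul_simple_pow i j
  rw [h, pow_succ, pow_two] at h1
  have h2 : (cs.simple i * cs.simple j * cs.simple i) *
      (cs.simple j * (cs.simple i * cs.simple j)) = 1 := by simpa [mul_assoc] using h1
  have h3 := eq_inv_of_mul_eq_one_left h2
  simpa [mul_assoc] using h3

variable [AddCommGroup V] (φ : W →* (V ≃ₗ[ℤ] V)) (α : B → V) (pos : V → Prop)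

/-- In a simply laced root system, an element of the Coxeter group that is lengthened by a simple
reflection on the right sends the corresponding simple root to a positive root. -/
theorem pos_of_not_isRightDescent
    (hM : ∀ i j, i ≠ j → M i j = 2 ∨ M i j = 3)
    (hadd : ∀ x y, pos x → pos y → pos (x + y)) (hpos : ∀ i, pos (α i))
    (h2 : ∀ i j, i ≠ j → M i j = 2 → φ (cs.simple i) (α j) = α j)
    (h3 : ∀ i j, i ≠ j → M i j = 3 → φ (cs.simple i) (α j) = α j + α i)
    (hself : ∀ i, φ (cs.simple i) (α i) = -α i) (n : ℕ) :
    ∀ (w : W) (s : B), cs.length w = n → ¬ cs.IsRightDescent w s → pos (φ w (α s)) := by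
  induction n using Nat.strong_induction_on with
  | _ n ih =>
    intro w s hw hs
    by_cases hw1 : w = 1
    · subst hw1; simpa using hpos s
    obtain ⟨t, ht⟩ := cs.exists_rightDescent_of_ne_one hw1
    have hst : t ≠ s := by rintro rfl; exact hs ht
    have hlt := cs.isRightDescent_iff.mp ht
    have hls := cs.not_isRightDescent_iff.mp hs
    set v := w * cs.simple t with hv
    have hwv : w = v * cs.simple t := by simp [hv]
    have hvt : ¬ cs.IsRightDescent v t := by
      rw [cs.not_isRightDescent_iff, ← hwv, hlt]
    rcases hM t s hst with hm | hm
    -- Here `s` and `t` commute. If `s` shortened `v`, then `w s = v s t` would have length at most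
    -- that of `v`, although it exceeds that of `w`. As `t` fixes `α_s`, induction applies to `v`.
    · have hvs : ¬ cs.IsRightDescent v s := by
        intro hd
        have h5 := cs.isRightDescent_iff.mp hd
        have h6 : w * cs.simple s = v * cs.simple s * cs.simple t := by
          rw [mul_assoc, ← cs.simple_comm_of_eq_two hm, ← mul_assoc, ← hwv]
        have h7 := cs.length_mul_le (v * cs.simple s) (cs.simple t)
        rw [← h6, cs.length_simple] at h7
        omega
      have := ih _ (by omega) v s rfl hvs
      rw [hwv, map_mul, LinearEquiv.mul_apply, h2 t s hst hm]
      exact this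
    -- Now `t α_s = α_s + α_t`. If `s` shortens `v = v' s`, then `w α_s = v' s (α_s + α_t) = v'
    -- α_t`, and `v' t` is longer than `v'` because `w s = v' s t s = v' t s t`. Otherwise `w α_s =
    -- v α_s + v α_t` is a sum of two positive elements.
    · by_cases hvs : cs.IsRightDescent v s
      · have h5 := cs.isRightDescent_iff.mp hvs
        set v' := v * cs.simple s with hv'
        have hvv : v = v' * cs.simple s := by simp [hv']
        have hvt' : ¬ cs.IsRightDescent v' t := by
          intro hd
          have h6 := cs.isRightDescent_iff.mp hd
          have h7 : w * cs.simple s = v' * cs.simple t * (cs.simple s * cs.simple t) := by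
            rw [hwv, hvv]
            have := cs.simple_braid_of_eq_three hm
            simp only [mul_assoc] at this ⊢
            rw [this]
          have h8 := cs.length_mul_le (v' * cs.simple t) (cs.simple s * cs.simple t)
          have h9 := cs.length_mul_le (cs.simple s) (cs.simple t)
          rw [cs.length_simple, cs.length_simple] at h9
          rw [← h7] at h8
          omega
        have h10 := ih _ (by omega) v' t rfl hvt'
        have hms : M s t = 3 := by rw [M.symmetric]; exact hm
        rw [hwv, hvv, map_mul, map_mul, LinearEquiv.mul_apply, LinearEquiv.mul_apply,
          h3 t s hst hm, map_add, hself, h3 s t hst.symm hms]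
        simpa using h10
      · have h5 := ih _ (by omega) v s rfl hvs
        have h6 := ih _ (by omega) v t rfl hvt
        rw [hwv, map_mul, LinearEquiv.mul_apply, h3 t s hst hm, map_add]
        exact hadd _ _ h5 h6

/-- The geometric representation of a simply laced Coxeter group is faithful. -/
theorem injective_of_geometric
    (hM : ∀ i j, i ≠ j → M i j = 2 ∨ M i j = 3)
    (hadd : ∀ x y, pos x → pos y → pos (x + y)) (hpos : ∀ i, pos (α i))
    (hneg : ∀ i, ¬ pos (-α i))
    (h2 : ∀ i j, i ≠ j → M i j = 2 → φ (cs.simple i) (α j) = α j)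
    (h3 : ∀ i j, i ≠ j → M i j = 3 → φ (cs.simple i) (α j) = α j + α i)
    (hself : ∀ i, φ (cs.simple i) (α i) = -α i) : Function.Injective φ := by
  rw [injective_iff_map_eq_one]
  intro w hw
  by_contra hw1
  obtain ⟨s, hs⟩ := cs.exists_rightDescent_of_ne_one hw1
  -- The element `w s` is lengthened by `s`, hence maps `α_s` to something positive; if `w` acts
  -- trivially, this image is `-α_s`.
  have h := cs.pos_of_not_isRightDescent φ α pos hM hadd hpos h2 h3 hself _ (w * cs.simple s) s rfl
    (by rw [← cs.isRightDescent_iff_not_isRightDescent_mul]; exact hs)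
  rw [map_mul, hw, one_mul, hself] at h
  exact hneg s h

end CoxeterSystem

namespace TropicalWeyl

noncomputable section

/-! ### Neighbouring indices in `ℤ/N` are distinct for `N ≥ 3`. -/

section ZModIndices

variable {N : ℕ} [hN : Fact (3 ≤ N)] (n : ZMod N)

theorem zmod_one_ne_zero : (1 : ZMod N) ≠ 0 := by
  have : Fact (1 < N) := ⟨by have := hN.out; omega⟩
  exact one_ne_zero

theorem zmod_two_ne_zero : (2 : ZMod N) ≠ 0 := by
  have h := hN.out
  intro h2
  have h3 : ((2 : ℕ) : ZMod N) = 0 := by exact_mod_cast h2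
  rw [ZMod.natCast_eq_zero_iff] at h3
  have := Nat.le_of_dvd (by norm_num) h3
  omega

theorem zmod_add_one_ne : n + 1 ≠ n := by
  simpa using zmod_one_ne_zero (N := N)

theorem zmod_sub_one_ne : n - 1 ≠ n := by
  simpa using zmod_one_ne_zero (N := N)

theorem zmod_sub_one_ne_add_one : n - 1 ≠ n + 1 := by
  intro h
  apply zmod_two_ne_zero (N := N)
  linear_combination -h

end ZModIndices

/-! ### A diagram of affine type has no arms. -/

section Affine

variable {N : ℕ} (k ℓ : ZMod N → ℕ+)

/-- The index `(n, 1)` of an exceptional divisor. -/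
def excPos (n : ZMod N) : Exc k ℓ :=
  ⟨n, ⟨1, by have := (k n).pos; have := (ℓ n).pos; simp; omega⟩⟩

/-- The index `(n, -1)` of an exceptional divisor. -/
def excNeg (n : ZMod N) : Exc k ℓ :=
  ⟨n, ⟨-1, by have := (k n).pos; have := (ℓ n).pos; simp; omega⟩⟩

theorem simpleRoot_centre (n : ZMod N) :
    simpleRoot k ℓ (centre k ℓ n) = hyp k ℓ n - exc k ℓ n 1 - exc k ℓ n (-1) := by
  simp [simpleRoot, centre]

theorem simpleCoroot_centre (n : ZMod N) :
    simpleCoroot k ℓ (centre k ℓ n)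
      = hyp k ℓ (n - 1) + hyp k ℓ (n + 1) - exc k ℓ n 1 - exc k ℓ n (-1) := by
  simp [simpleCoroot, centre]

variable [Fact (3 ≤ N)]

theorem pairing_simpleCoroot_centre (Λ : Coh k ℓ) (n : ZMod N) :
    pairing k ℓ Λ (simpleCoroot k ℓ (centre k ℓ n)) =
      Λ (Sum.inl (n - 1)) + Λ (Sum.inl (n + 1)) + Λ (Sum.inr (excPos k ℓ n))
        + Λ (Sum.inr (excNeg k ℓ n)) := by
  rw [simpleCoroot_centre, map_sub, map_sub, map_add, pairing_hyp, pairing_hyp,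
    pairing_exc k ℓ Λ n 1 (excPos k ℓ n).2.2, pairing_exc k ℓ Λ n (-1) (excNeg k ℓ n).2.2]
  simp only [excPos, excNeg]
  ring

/-- For a central root the contributions of its two neighbours cancel against its self-pairing `-2`.
A node on an arm meets a central coroot only if it is the first of its arm. -/
theorem sum_pairing_simpleCoroot_centre (ν : Node k ℓ) :
    ∑ n, pairing k ℓ (simpleRoot k ℓ ν) (simpleCoroot k ℓ (centre k ℓ n)) =
      if (ν.2 : ℤ) = 1 ∨ (ν.2 : ℤ) = -1 then 1 else 0 := by
  obtain ⟨m, ⟨i, hi⟩⟩ := ν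
  simp only [pairing_simpleCoroot_centre, Finset.sum_add_distrib]
  have e1 : ∀ g : ZMod N → ℤ, ∑ n, g (n - 1) = ∑ n, g n := fun g =>
    Equiv.sum_comp (Equiv.subRight (1 : ZMod N)) g
  have e2 : ∀ g : ZMod N → ℤ, ∑ n, g (n + 1) = ∑ n, g n := fun g =>
    Equiv.sum_comp (Equiv.addRight (1 : ZMod N)) g
  rw [e1 (fun n => simpleRoot k ℓ ⟨m, ⟨i, hi⟩⟩ (Sum.inl n)),
    e2 (fun n => simpleRoot k ℓ ⟨m, ⟨i, hi⟩⟩ (Sum.inl n))]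
  unfold simpleRoot
  rcases lt_trichotomy i 0 with h | h | h
  · have h1 : i ≠ 0 := by omega
    have h2 : ¬ 0 < i := by omega
    have h3 : (1 : ℤ) ≠ i := by omega
    have h4 : i ≠ 1 := by omega
    have h5 : (1 : ℤ) ≠ i - 1 := by omega
    have h6 : (-1 : ℤ) ≠ i - 1 := by omega
    by_cases h7 : i = -1 <;>
      simp [h1, h2, h4, h3, exc, excPos, excNeg, h5, h6, h7, eq_comm]
  · subst h
    simp [hyp, exc, excPos, excNeg]
  · have h1 : i ≠ 0 := by omega
    have h3 : (-1 : ℤ) ≠ i := by omega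
    have h4 : i ≠ -1 := by omega
    have h5 : (-1 : ℤ) ≠ i + 1 := by omega
    have h6 : (1 : ℤ) ≠ i + 1 := by omega
    by_cases h7 : i = 1 <;>
      simp [h, h4, h3, exc, excPos, excNeg, h5, h1, h7, eq_comm]

/-- The centres form a cycle, so that a diagram of affine type has no arms. -/
theorem eq_one_of_isAffineType (haff : IsAffineType (cartanMatrix k ℓ)) (n : ZMod N) :
    k n = 1 ∧ ℓ n = 1 := by
  obtain ⟨u, hu, hA⟩ := haff.2.2
  have h1 : ∑ m, ((cartanMatrix k ℓ).map (Int.cast : ℤ → ℝ)).mulVec u (centre k ℓ m) = 0 := by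
    simp [hA]
  -- Summing the central entries of `A u = 0` leaves minus the sum of `u` over the first nodes of
  -- the arms. All these values are positive, so there are no such nodes.
  have h2 : ∑ ν, (if (ν.2 : ℤ) = 1 ∨ (ν.2 : ℤ) = -1 then 1 else 0 : ℝ) * u ν = 0 := by
    simp only [Matrix.mulVec, dotProduct] at h1
    rw [Finset.sum_comm] at h1
    refine neg_eq_zero.mp (Eq.trans ?_ h1)
    rw [← Finset.sum_neg_distrib]
    refine Finset.sum_congr rfl fun ν _ => ?_
    rw [← Finset.sum_mul, ← neg_mul]
    congr 1
    have h3 := congrArg (Int.cast : ℤ → ℝ) (sum_pairing_simpleCoroot_centre k ℓ ν)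
    push_cast at h3
    simp only [cartanMatrix, Matrix.map_apply, Matrix.of_apply, Int.cast_neg,
      Finset.sum_neg_distrib, h3]
  have h4 : ∀ ν : Node k ℓ, ¬ ((ν.2 : ℤ) = 1 ∨ (ν.2 : ℤ) = -1) := by
    intro ν hν
    rw [Finset.sum_eq_zero_iff_of_nonneg (fun ν _ => mul_nonneg (by split_ifs <;> norm_num)
      (hu ν).le)] at h2
    have := h2 ν (Finset.mem_univ ν)
    rw [if_pos hν, one_mul] at this
    exact (hu ν).ne' this
  have hk := (k n).pos
  have hl := (ℓ n).pos
  constructor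
  · by_contra h
    have h5 : (k n : ℕ) ≠ 1 := fun h' => h (PNat.coe_eq_one_iff.mp h')
    exact h4 ⟨n, ⟨1, by simp; omega⟩⟩ (Or.inl rfl)
  · by_contra h
    have h5 : (ℓ n : ℕ) ≠ 1 := fun h' => h (PNat.coe_eq_one_iff.mp h')
    exact h4 ⟨n, ⟨-1, by simp; omega⟩⟩ (Or.inr rfl)

end Affine

/-! ### The symmetric Cartan matrix of the cycle and the invariance of the pairing. -/

section Reflections

variable {N : ℕ} [Fact (3 ≤ N)] (k ℓ : ZMod N → ℕ+)

theorem pairing_simpleRoot_simpleCoroot_centre (m n : ZMod N) :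
    pairing k ℓ (simpleRoot k ℓ (centre k ℓ m)) (simpleCoroot k ℓ (centre k ℓ n)) =
      (if m = n - 1 then 1 else 0) + (if m = n + 1 then 1 else 0) - (if m = n then 2 else 0) := by
  rw [pairing_simpleCoroot_centre, simpleRoot_centre]
  simp only [hyp, exc, excPos, excNeg, Pi.sub_apply]
  by_cases h : m = n
  · subst h
    rw [if_neg (zmod_sub_one_ne m), if_neg (zmod_add_one_ne m), if_neg (zmod_sub_one_ne m).symm,
      if_neg (zmod_add_one_ne m).symm]
    simp
  · simp [h, Ne.symm h, eq_comm]

/-- This symmetry lets `W` act in the same way on the coordinates of a root and of its coroot, and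
makes `⟨α, β̌⟩` a symmetric form on `Q`. -/
theorem pairing_centre_comm (m n : ZMod N) :
    pairing k ℓ (simpleRoot k ℓ (centre k ℓ m)) (simpleCoroot k ℓ (centre k ℓ n)) =
      pairing k ℓ (simpleRoot k ℓ (centre k ℓ n)) (simpleCoroot k ℓ (centre k ℓ m)) := by
  simp only [pairing_simpleRoot_simpleCoroot_centre]
  have h1 : m = n - 1 ↔ n = m + 1 := by constructor <;> intro h <;> rw [h] <;> ring
  have h2 : m = n + 1 ↔ n = m - 1 := by constructor <;> intro h <;> rw [h] <;> ring
  simp only [h1, h2, eq_comm (a := m) (b := n)]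
  ring

/-- Every element of the Weyl group leaves the pairing invariant. -/
theorem pairing_weylGroup {w : BiAut k ℓ} (hw : w ∈ weylGroup k ℓ) :
    ∀ Λ l, pairing k ℓ (w.1 Λ) (w.2 l) = pairing k ℓ Λ l := by
  induction hw using Subgroup.closure_induction with
  | mem w hw =>
    obtain ⟨ν, rfl⟩ := hw
    intro Λ l
    rw [simpleReflection_fst, simpleReflection_snd]
    simp only [map_add, map_smul, LinearMap.add_apply, LinearMap.smul_apply, smul_eq_mul,
      pairing_simpleRoot_self]
    ring
  | one => intro Λ l; rfl
  | mul x y _ _ hx hy => intro Λ l; exact (hx _ _).trans (hy _ _)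
  | inv x _ hx =>
    intro Λ l
    rw [← hx]
    simp

end Reflections

/-! ### The null root, evenness of the form, and additivity of Kac's formula. -/

section NullRoot

variable {N : ℕ} [Fact (3 ≤ N)] (k ℓ : ZMod N → ℕ+)

theorem delta_inl (n : ZMod N) : delta k ℓ (Sum.inl n) = 1 := by
  simp [delta, hyp, exc, Finset.sum_apply]

theorem delta_inr (y : Exc k ℓ) : delta k ℓ (Sum.inr y) = -1 := by
  have h : ∀ x : Exc k ℓ, (y.1 = x.1 ∧ (y.2 : ℤ) = x.2) ↔ y = x := by
    rintro ⟨m, j⟩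
    obtain ⟨n, i⟩ := y
    constructor
    · rintro ⟨h1, h2⟩
      simp only at h1 h2
      subst h1
      rw [Subtype.ext h2]
    · intro hx; cases hx; exact ⟨rfl, rfl⟩
  simp [delta, hyp, exc, Finset.sum_apply, h]

theorem deltaCheck_inl (n : ZMod N) : deltaCheck k ℓ (Sum.inl n) = 2 := by
  simp [deltaCheck, hyp, exc, Finset.sum_apply]

theorem deltaCheck_inr (y : Exc k ℓ) : deltaCheck k ℓ (Sum.inr y) = -1 := by
  have h := delta_inr k ℓ y
  simp only [delta, deltaCheck, hyp, Pi.sub_apply, Finset.sum_apply, Pi.smul_apply,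
    Finset.sum_const_zero, smul_zero] at h ⊢
  exact h

theorem pairing_delta_simpleCoroot_centre (n : ZMod N) :
    pairing k ℓ (delta k ℓ) (simpleCoroot k ℓ (centre k ℓ n)) = 0 := by
  simp [pairing_simpleCoroot_centre, delta_inl, delta_inr]

variable {k ℓ} (h1 : ∀ n, k n = 1 ∧ ℓ n = 1)
include h1

omit [Fact (3 ≤ N)] in
theorem node_eq_centre (ν : Node k ℓ) : centre k ℓ ν.1 = ν := by
  obtain ⟨n, ⟨i, hi⟩⟩ := ν
  have h2 := Finset.mem_Ioo.mp hi
  rw [(h1 n).1, (h1 n).2] at h2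
  obtain rfl : i = 0 := by simp at h2; omega
  rfl

omit [Fact (3 ≤ N)] in
theorem exc_cases (x : Exc k ℓ) : x = excPos k ℓ x.1 ∨ x = excNeg k ℓ x.1 := by
  obtain ⟨n, ⟨i, hi⟩⟩ := x
  have h2 := Finset.mem_Icc.mp (Finset.mem_of_mem_erase hi)
  have h3 := Finset.ne_of_mem_erase hi
  rw [(h1 n).1, (h1 n).2] at h2
  have h4 : i = 1 ∨ i = -1 := by simp at h2; omega
  rcases h4 with rfl | rfl
  · exact Or.inl rfl
  · exact Or.inr rfl

/-- Without arms, the vertices of the diagram are the centres. -/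
def centreEquiv : ZMod N ≃ Node k ℓ where
  toFun := centre k ℓ
  invFun := Sigma.fst
  left_inv _ := rfl
  right_inv := node_eq_centre h1

theorem sum_node {G : Type*} [AddCommMonoid G] (g : Node k ℓ → G) :
    ∑ ν, g ν = ∑ n, g (centre k ℓ n) :=
  (Equiv.sum_comp (centreEquiv h1) g).symm

omit [Fact (3 ≤ N)] in
theorem simpleRoot_centre_inr (n : ZMod N) (x : Exc k ℓ) :
    simpleRoot k ℓ (centre k ℓ n) (Sum.inr x) = if x.1 = n then -1 else 0 := by
  rcases exc_cases h1 x with h | h <;> rw [h, simpleRoot_centre] <;>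
    by_cases h2 : x.1 = n <;> simp [hyp, exc, excPos, excNeg, h2]

omit [Fact (3 ≤ N)] in
theorem simpleCoroot_centre_inr (n : ZMod N) (x : Exc k ℓ) :
    simpleCoroot k ℓ (centre k ℓ n) (Sum.inr x) = if x.1 = n then -1 else 0 := by
  rcases exc_cases h1 x with h | h <;> rw [h, simpleCoroot_centre] <;>
    by_cases h2 : x.1 = n <;> simp [hyp, exc, excPos, excNeg, h2]

theorem root_inl (c : Node k ℓ → ℤ) (n : ZMod N) :
    root k ℓ c (Sum.inl n) = c (centre k ℓ n) := by
  rw [root, sum_node h1]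
  simp [simpleRoot_centre, hyp, exc, Finset.sum_apply]

theorem root_inr (c : Node k ℓ → ℤ) (x : Exc k ℓ) :
    root k ℓ c (Sum.inr x) = -c (centre k ℓ x.1) := by
  rw [root, sum_node h1]
  simp [simpleRoot_centre_inr h1, Finset.sum_apply]

theorem coroot_inr (c : Node k ℓ → ℤ) (x : Exc k ℓ) :
    coroot k ℓ c (Sum.inr x) = -c (centre k ℓ x.1) := by
  rw [coroot, sum_node h1]
  simp [simpleCoroot_centre_inr h1, Finset.sum_apply]

theorem root_one : root k ℓ (fun _ => 1) = delta k ℓ := by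
  ext (n | x)
  · rw [root_inl h1, delta_inl]
  · rw [root_inr h1, delta_inr]

theorem coroot_one : coroot k ℓ (fun _ => 1) = deltaCheck k ℓ := by
  ext (n | x)
  · rw [deltaCheck_inl, coroot, sum_node h1]
    have e1 : ∀ m : ZMod N, n = m - 1 ↔ n + 1 = m := fun m => by
      constructor <;> intro h <;> [rw [h]; rw [← h]] <;> ring
    have e2 : ∀ m : ZMod N, n = m + 1 ↔ n - 1 = m := fun m => by
      constructor <;> intro h <;> [rw [h]; rw [← h]] <;> ring
    simp [simpleCoroot_centre, hyp, exc, Finset.sum_apply, Finset.sum_add_distrib, e1, e2]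
  · rw [coroot_inr h1, deltaCheck_inr]

theorem pairing_delta_coroot (c : Node k ℓ → ℤ) :
    pairing k ℓ (delta k ℓ) (coroot k ℓ c) = 0 := by
  rw [coroot, sum_node h1]
  simp [pairing_delta_simpleCoroot_centre, -zsmul_eq_mul]

theorem pairing_root_coroot_comm (c c' : Node k ℓ → ℤ) :
    pairing k ℓ (root k ℓ c) (coroot k ℓ c') = pairing k ℓ (root k ℓ c') (coroot k ℓ c) := by
  simp only [root, coroot, sum_node h1, map_sum, map_smul, LinearMap.sum_apply,
    LinearMap.smul_apply, smul_eq_mul]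
  simp only [Finset.mul_sum]
  rw [Finset.sum_comm]
  refine Finset.sum_congr rfl fun m _ => Finset.sum_congr rfl fun n _ => ?_
  rw [pairing_centre_comm]
  ring

theorem pairing_root_deltaCheck (c : Node k ℓ → ℤ) :
    pairing k ℓ (root k ℓ c) (deltaCheck k ℓ) = 0 := by
  rw [← coroot_one h1, pairing_root_coroot_comm h1, root_one h1, pairing_delta_coroot h1]

theorem pairing_delta_deltaCheck : pairing k ℓ (delta k ℓ) (deltaCheck k ℓ) = 0 := by
  rw [← root_one h1, pairing_root_deltaCheck h1]

/-- The diagonal contributes `-2 c_n²`, and each edge of the cycle contributes its product `c_n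
c_{n+1}` twice, once from each end. -/
theorem two_dvd_pairing_root_coroot (c : Node k ℓ → ℤ) :
    2 ∣ pairing k ℓ (root k ℓ c) (coroot k ℓ c) := by
  rw [coroot, sum_node h1]
  simp only [map_sum, map_smul, pairing_simpleCoroot_centre, root_inl h1, root_inr h1, excPos,
    excNeg, smul_eq_mul]
  have e : ∑ n, c (centre k ℓ n) * c (centre k ℓ (n - 1)) =
      ∑ n, c (centre k ℓ (n + 1)) * c (centre k ℓ n) := by
    rw [← Equiv.sum_comp (Equiv.addRight (1 : ZMod N))]
    simp
  refine ⟨∑ n, c (centre k ℓ (n + 1)) * c (centre k ℓ n)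
    - ∑ n, c (centre k ℓ n) * c (centre k ℓ n), ?_⟩
  rw [mul_sub, two_mul]
  nth_rw 1 [← e]
  rw [← Finset.sum_add_distrib, Finset.mul_sum, ← Finset.sum_sub_distrib]
  refine Finset.sum_congr rfl fun n _ => ?_
  ring

theorem two_mul_halfNorm (c : Node k ℓ → ℤ) :
    2 * halfNorm k ℓ c = pairing k ℓ (root k ℓ c) (coroot k ℓ c) :=
  Int.mul_ediv_cancel' (two_dvd_pairing_root_coroot h1 c)

omit h1 in
theorem root_add (c c' : Node k ℓ → ℤ) : root k ℓ (c + c') = root k ℓ c + root k ℓ c' := by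
  simp [root, add_smul, Finset.sum_add_distrib]

omit h1 in
theorem coroot_add (c c' : Node k ℓ → ℤ) :
    coroot k ℓ (c + c') = coroot k ℓ c + coroot k ℓ c' := by
  simp [coroot, add_smul, Finset.sum_add_distrib]

omit h1 in
theorem root_zsmul (a : ℤ) (c : Node k ℓ → ℤ) : root k ℓ (a • c) = a • root k ℓ c := by
  simp [root, Finset.smul_sum, mul_smul]

omit h1 in
theorem coroot_zsmul (a : ℤ) (c : Node k ℓ → ℤ) : coroot k ℓ (a • c) = a • coroot k ℓ c := by
  simp [coroot, Finset.smul_sum, mul_smul]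

omit h1 in
theorem root_single (ν : Node k ℓ) : root k ℓ (Pi.single ν 1) = simpleRoot k ℓ ν := by
  simp [root, Pi.single_apply]

omit h1 in
theorem coroot_single (ν : Node k ℓ) : coroot k ℓ (Pi.single ν 1) = simpleCoroot k ℓ ν := by
  simp [coroot, Pi.single_apply]

/-- Polarization of the quadratic form; `omega` divides by two using the evenness of all three
norms. -/
theorem halfNorm_add (c c' : Node k ℓ → ℤ) :
    halfNorm k ℓ (c + c') =
      halfNorm k ℓ c + halfNorm k ℓ c' + pairing k ℓ (root k ℓ c) (coroot k ℓ c') := by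
  have e := two_mul_halfNorm h1 (c + c')
  have e1 := two_mul_halfNorm h1 c
  have e2 := two_mul_halfNorm h1 c'
  rw [root_add, coroot_add] at e
  simp only [map_add, LinearMap.add_apply] at e
  rw [pairing_root_coroot_comm h1 c' c] at e
  omega

theorem halfNorm_zsmul (a : ℤ) (c : Node k ℓ → ℤ) :
    halfNorm k ℓ (a • c) = a ^ 2 * halfNorm k ℓ c := by
  have e := two_mul_halfNorm h1 (a • c)
  have e1 := two_mul_halfNorm h1 c
  rw [root_zsmul, coroot_zsmul] at e
  simp only [map_smul, LinearMap.smul_apply, smul_eq_mul, ← e1] at e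
  linarith

/-- As `α` and `δ` pair to zero with `δ̌`, the inner translation does not change `⟨Λ, δ̌⟩`. The only
cross term in the coefficient of `δ` is `-⟨α, α̌'⟩⟨Λ, δ̌⟩`, which is exactly the polarization term
of `halfNorm_add`. -/
theorem kacCoh_kacCoh (c c' : Node k ℓ → ℤ) (Λ : Coh k ℓ) :
    kacCoh k ℓ c (kacCoh k ℓ c' Λ) = kacCoh k ℓ (c + c') Λ := by
  simp only [kacCoh, halfNorm_add h1, root_add, coroot_add, map_add, map_sub, map_smul,
    LinearMap.add_apply, LinearMap.sub_apply, LinearMap.smul_apply, smul_eq_mul,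
    pairing_root_deltaCheck h1, pairing_delta_deltaCheck h1, pairing_delta_coroot h1,
    pairing_root_coroot_comm h1 c' c]
  module

theorem kacHom_kacHom (c c' : Node k ℓ → ℤ) (l : Homol k ℓ) :
    kacHom k ℓ c (kacHom k ℓ c' l) = kacHom k ℓ (c + c') l := by
  simp only [kacHom, halfNorm_add h1, root_add, coroot_add, map_add, map_sub, map_smul,
    LinearMap.add_apply, smul_eq_mul,
    pairing_root_deltaCheck h1, pairing_delta_deltaCheck h1, pairing_delta_coroot h1]
  module

omit h1 in
theorem kacCoh_zero (Λ : Coh k ℓ) : kacCoh k ℓ 0 Λ = Λ := by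
  simp [kacCoh, root, coroot, halfNorm]

omit h1 in
theorem kacHom_zero (l : Homol k ℓ) : kacHom k ℓ 0 l = l := by
  simp [kacHom, root, coroot, halfNorm]

end NullRoot

/-! ### Translations in the Weyl group and the semidirect decomposition. -/

section Translations

variable {N : ℕ} [Fact (3 ≤ N)] {k ℓ : ZMod N → ℕ+}

/-- An element of the Weyl group sends a root and its coroot to a root and its coroot. -/
theorem exists_root_weylGroup (h1 : ∀ n, k n = 1 ∧ ℓ n = 1) {w : BiAut k ℓ}
    (hw : w ∈ weylGroup k ℓ) (c : Node k ℓ → ℤ) :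
    ∃ c', w.1 (root k ℓ c) = root k ℓ c' ∧ w.2 (coroot k ℓ c) = coroot k ℓ c' := by
  induction hw using Subgroup.closure_induction_left generalizing c with
  | one => exact ⟨c, rfl, rfl⟩
  | mul_left s hs w _ ih =>
    obtain ⟨ν, rfl⟩ := hs
    obtain ⟨c', hc, hc'⟩ := ih c
    refine ⟨c' + pairing k ℓ (root k ℓ c') (simpleCoroot k ℓ ν) • Pi.single ν 1, ?_, ?_⟩
    · rw [root_add, root_zsmul, root_single, ← simpleReflection_fst, ← hc]
      rfl
    -- The coefficient produced on the coroot side is `⟨α_ν, α̌'⟩`; by symmetry it equals the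
    -- coefficient `⟨α', α̌_ν⟩` of the root side, so the same coordinates serve both.
    · rw [coroot_add, coroot_zsmul, coroot_single, ← coroot_single, pairing_root_coroot_comm h1,
        coroot_single, root_single, ← simpleReflection_snd, ← hc']
      rfl
  | inv_mul_cancel s hs w _ ih =>
    obtain ⟨ν, rfl⟩ := hs
    obtain ⟨c', hc, hc'⟩ := ih c
    refine ⟨c' + pairing k ℓ (root k ℓ c') (simpleCoroot k ℓ ν) • Pi.single ν 1, ?_, ?_⟩
    · rw [root_add, root_zsmul, root_single, ← simpleReflection_fst, ← hc]
      rfl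
    · rw [coroot_add, coroot_zsmul, coroot_single, ← coroot_single, pairing_root_coroot_comm h1,
        coroot_single, root_single, ← simpleReflection_snd, ← hc']
      rfl

theorem weylGroup_delta (h1 : ∀ n, k n = 1 ∧ ℓ n = 1) {w : BiAut k ℓ} (hw : w ∈ weylGroup k ℓ) :
    w.1 (delta k ℓ) = delta k ℓ ∧ w.2 (deltaCheck k ℓ) = deltaCheck k ℓ := by
  induction hw using Subgroup.closure_induction with
  | mem w hw =>
    obtain ⟨ν, rfl⟩ := hw
    rw [simpleReflection_fst, simpleReflection_snd, ← coroot_single, ← root_single,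
      pairing_delta_coroot h1, pairing_root_deltaCheck h1]
    simp
  | one => exact ⟨rfl, rfl⟩
  | mul x y _ _ hx hy =>
    constructor
    · change x.1 (y.1 _) = _
      rw [hy.1, hx.1]
    · change x.2 (y.2 _) = _
      rw [hy.2, hx.2]
  | inv x _ hx =>
    constructor
    · change x.1.symm _ = _
      rw [LinearEquiv.symm_apply_eq, hx.1]
    · change x.2.symm _ = _
      rw [LinearEquiv.symm_apply_eq, hx.2]

/-- The translation `t_α` as a pair of automorphisms. -/
def translation (h1 : ∀ n, k n = 1 ∧ ℓ n = 1) (c : Node k ℓ → ℤ) : BiAut k ℓ :=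
  (LinearEquiv.ofLinearMap
      { toFun := kacCoh k ℓ c
        map_add' := fun x y => by
          simp only [kacCoh, map_add, LinearMap.add_apply]; module
        map_smul' := fun a x => by
          simp only [kacCoh, map_smul, LinearMap.smul_apply, smul_eq_mul, RingHom.id_apply]
          module }
      { toFun := kacCoh k ℓ (-c)
        map_add' := fun x y => by
          simp only [kacCoh, map_add, LinearMap.add_apply]; module
        map_smul' := fun a x => by
          simp only [kacCoh, map_smul, LinearMap.smul_apply, smul_eq_mul, RingHom.id_apply]
          module }
      (LinearMap.ext fun x => by
        simpa [kacCoh_zero] using kacCoh_kacCoh h1 c (-c) x)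
      (LinearMap.ext fun x => by
        simpa [kacCoh_zero] using kacCoh_kacCoh h1 (-c) c x),
    LinearEquiv.ofLinearMap
      { toFun := kacHom k ℓ c
        map_add' := fun x y => by
          simp only [kacHom, map_add]; module
        map_smul' := fun a x => by
          simp only [kacHom, map_smul, smul_eq_mul, RingHom.id_apply]
          module }
      { toFun := kacHom k ℓ (-c)
        map_add' := fun x y => by
          simp only [kacHom, map_add]; module
        map_smul' := fun a x => by
          simp only [kacHom, map_smul, smul_eq_mul, RingHom.id_apply]
          module }
      (LinearMap.ext fun x => by
        simpa [kacHom_zero] using kacHom_kacHom h1 c (-c) x)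
      (LinearMap.ext fun x => by
        simpa [kacHom_zero] using kacHom_kacHom h1 (-c) c x))

omit [Fact (3 ≤ N)] in
theorem biAut_ext {w w' : BiAut k ℓ} (h : ∀ Λ, w.1 Λ = w'.1 Λ) (h' : ∀ l, w.2 l = w'.2 l) :
    w = w' :=
  Prod.ext (LinearEquiv.ext h) (LinearEquiv.ext h')

theorem translation_mul (h1 : ∀ n, k n = 1 ∧ ℓ n = 1) (c c' : Node k ℓ → ℤ) :
    translation h1 c * translation h1 c' = translation h1 (c + c') :=
  biAut_ext (kacCoh_kacCoh h1 c c') (kacHom_kacHom h1 c c')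

theorem translation_zero (h1 : ∀ n, k n = 1 ∧ ℓ n = 1) : translation h1 0 = 1 :=
  biAut_ext kacCoh_zero kacHom_zero

/-- The sum `α_{n+1} + ⋯ + α_{n+j}`, in coordinates. -/
def pathSum (k ℓ : ZMod N → ℕ+) (n : ZMod N) (j : ℕ) : Node k ℓ → ℤ :=
  ∑ i ∈ Finset.range j, Pi.single (centre k ℓ (n + (i + 1 : ℕ))) 1

omit [Fact (3 ≤ N)] in
theorem pathSum_succ (n : ZMod N) (j : ℕ) :
    pathSum k ℓ n (j + 1) = pathSum k ℓ n j + Pi.single (centre k ℓ (n + (j + 1 : ℕ))) 1 := by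
  rw [pathSum, Finset.sum_range_succ, pathSum]

omit [Fact (3 ≤ N)] in
theorem centre_injective : Function.Injective (centre k ℓ) :=
  fun _ _ h => congrArg Sigma.fst h

omit [Fact (3 ≤ N)] in
theorem natCast_zmod_inj {a b : ℕ} (ha : a < N) (hb : b < N) (h : (a : ZMod N) = b) : a = b := by
  rw [ZMod.natCast_eq_natCast_iff'] at h
  rwa [Nat.mod_eq_of_lt ha, Nat.mod_eq_of_lt hb] at h

/-- Of the roots `α_{n+1}, …, α_{n+j}` only the last one is adjacent to `α_{n+j+1}`: since `j + 1 <
N`, the path has not yet closed up to the cycle. -/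
theorem pairing_root_pathSum (n : ZMod N) (j : ℕ) (hj : 1 ≤ j) (hjN : j + 1 < N) :
    pairing k ℓ (root k ℓ (pathSum k ℓ n j)) (simpleCoroot k ℓ (centre k ℓ (n + (j + 1 : ℕ)))) =
      1 := by
  have h2 : ∀ s : Finset ℕ, ∀ g : ℕ → Node k ℓ → ℤ,
      root k ℓ (∑ i ∈ s, g i) = ∑ i ∈ s, root k ℓ (g i) := fun s g => by
    induction s using Finset.cons_induction with
    | empty => simp [root]
    | cons a s ha ih => rw [Finset.sum_cons, Finset.sum_cons, root_add, ih]
  rw [pathSum, h2, map_sum, LinearMap.sum_apply, Finset.sum_eq_single (j - 1)]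
  · rw [root_single, pairing_simpleRoot_simpleCoroot_centre, if_pos, if_neg, if_neg]
    · simp
    · intro h
      have := natCast_zmod_inj (by omega) (by omega) (add_left_cancel h)
      omega
    · intro h
      rw [add_assoc, add_right_inj] at h
      -- Since `j + 2 ≤ N`, the truncated difference `j + 2 - N` is `0`; it represents the class of
      -- `j + 2` exactly when `j + 2 = N`, the case in which the other neighbour is `n` itself.
      have := natCast_zmod_inj (N := N) (a := j - 1 + 1) (b := j + 1 + 1 - N)
        (by omega) (by omega) (by
          rw [h]
          rcases Nat.lt_or_ge (j + 1 + 1) N with h3 | h3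
          · exfalso
            have := natCast_zmod_inj (N := N) (a := j - 1 + 1) (b := j + 1 + 1) (by omega) h3
              (by rw [h]; push_cast; ring)
            omega
          · rw [Nat.cast_sub h3]; simp)
      have h5 : 3 ≤ N := Fact.out
      omega
    · rw [Nat.sub_add_cancel hj]
      push_cast; ring
  · intro i hi hij
    have hi := Finset.mem_range.mp hi
    rw [root_single, pairing_simpleRoot_simpleCoroot_centre, if_neg, if_neg, if_neg]
    · simp
    · intro h
      have := natCast_zmod_inj (by omega) (by omega) (add_left_cancel h)
      omega
    · intro h
      rw [add_assoc, add_right_inj] at h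
      rcases Nat.lt_or_ge (j + 1 + 1) N with h3 | h3
      · have := natCast_zmod_inj (N := N) (a := i + 1) (b := j + 1 + 1) (by omega) h3
            (by rw [h]; push_cast; ring)
        omega
      · have := natCast_zmod_inj (N := N) (a := i + 1) (b := j + 1 + 1 - N) (by omega) (by omega)
            (by rw [h, Nat.cast_sub h3]; simp)
        omega
    · intro h
      rw [add_sub_assoc, add_right_inj] at h
      have := natCast_zmod_inj (N := N) (a := i + 1) (b := j) (by omega) (by omega)
        (by rw [h]; push_cast; ring)
      omega
  · intro h
    simp at h
    omega

/-- The reflections in the positive roots supported on a proper path are in the Weyl group. -/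
theorem exists_reflection_pathSum (h1 : ∀ n, k n = 1 ∧ ℓ n = 1) (n : ZMod N) (j : ℕ) (hj : 1 ≤ j)
    (hjN : j < N) :
    ∃ w ∈ Subgroup.closure (simpleReflection k ℓ '' {ν | ν ≠ centre k ℓ n}),
      (∀ Λ, w.1 Λ = Λ + pairing k ℓ Λ (coroot k ℓ (pathSum k ℓ n j)) •
        root k ℓ (pathSum k ℓ n j)) ∧
      ∀ l, w.2 l = l + pairing k ℓ (root k ℓ (pathSum k ℓ n j)) l •
        coroot k ℓ (pathSum k ℓ n j) := by
  have hmem : ∀ j : ℕ, j + 1 < N → simpleReflection k ℓ (centre k ℓ (n + (j + 1 : ℕ))) ∈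
      Subgroup.closure (simpleReflection k ℓ '' {ν | ν ≠ centre k ℓ n}) := fun j hj => by
    refine Subgroup.subset_closure ⟨_, fun h => ?_, rfl⟩
    have h2 := centre_injective h
    rw [add_eq_left] at h2
    have := natCast_zmod_inj (N := N) (a := j + 1) (b := 0) hj (by omega) (by rw [h2]; simp)
    omega
  induction j, hj using Nat.le_induction with
  | base =>
    refine ⟨_, hmem 0 hjN, fun Λ => ?_, fun l => ?_⟩
    · rw [simpleReflection_fst, pathSum, Finset.sum_range_one, root_single, coroot_single]
    · rw [simpleReflection_snd, pathSum, Finset.sum_range_one, root_single, coroot_single]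
  | succ j hj ih =>
    obtain ⟨w, hw, hw1, hw2⟩ := ih (by omega)
    set s := simpleReflection k ℓ (centre k ℓ (n + (j + 1 : ℕ))) with hs
    -- With `β` the sum so far and `α` the next simple root, `⟨β, α̌⟩ = 1` gives `s_α β = β + α`,
    -- hence `s_α s_β s_α = s_{β+α}`.
    refine ⟨s * w * s, mul_mem (mul_mem (hmem j hjN) hw) (hmem j hjN), fun Λ => ?_, fun l => ?_⟩
    all_goals
      have e1 := pairing_root_pathSum (k := k) (ℓ := ℓ) n j hj hjN
      have e2 := e1
      rw [← coroot_single, pairing_root_coroot_comm h1, root_single] at e2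
    · change s.1 (w.1 (s.1 Λ)) = _
      rw [hw1, hs]
      simp only [simpleReflection_fst, pathSum_succ, root_add, coroot_add, root_single,
        coroot_single, map_add, map_smul, LinearMap.add_apply, LinearMap.smul_apply, smul_eq_mul,
        pairing_simpleRoot_self, e1, e2]
      module
    · change s.2 (w.2 (s.2 l)) = _
      rw [hw2, hs]
      simp only [simpleReflection_snd, pathSum_succ, root_add, coroot_add, root_single,
        coroot_single, map_add, map_smul, LinearMap.add_apply, smul_eq_mul,
        pairing_simpleRoot_self, e1, e2]
      module

theorem pathSum_add_single (h1 : ∀ n, k n = 1 ∧ ℓ n = 1) (n : ZMod N) :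
    pathSum k ℓ n (N - 1) + Pi.single (centre k ℓ n) 1 = fun _ => 1 := by
  have h5 : 3 ≤ N := Fact.out
  -- The root `α_n` is the missing term at offset `0`; the offsets `0, …, N - 1` then meet every
  -- vertex exactly once.
  have h2 : pathSum k ℓ n (N - 1) + Pi.single (centre k ℓ n) 1 =
      ∑ i ∈ Finset.range N, Pi.single (centre k ℓ (n + (i : ℕ))) 1 := by
    obtain ⟨M, rfl⟩ : ∃ M, N = M + 1 := ⟨N - 1, by omega⟩
    rw [Finset.sum_range_succ']
    simp [pathSum]
  rw [h2]
  ext ν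
  rw [← node_eq_centre h1 ν, Finset.sum_apply, Finset.sum_eq_single (ν.1 - n).val]
  · simp
  · intro i hi hne
    rw [Pi.single_apply, if_neg]
    intro h
    apply hne
    rw [centre_injective h]
    simp [ZMod.val_natCast, Nat.mod_eq_of_lt (Finset.mem_range.mp hi)]
  · intro h
    exact absurd (Finset.mem_range.mpr (ZMod.val_lt _)) h

/-- `t_{α_n} = s_{δ - α_n} s_{α_n}`, where the first reflection is a product of other simple
reflections. -/
theorem translation_single (h1 : ∀ n, k n = 1 ∧ ℓ n = 1) (n : ZMod N) :
    ∃ w ∈ Subgroup.closure (simpleReflection k ℓ '' {ν | ν ≠ centre k ℓ n}),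
      translation h1 (Pi.single (centre k ℓ n) 1) = w * simpleReflection k ℓ (centre k ℓ n) := by
  have h5 : 3 ≤ N := Fact.out
  obtain ⟨w, hw, hw1, hw2⟩ := exists_reflection_pathSum (k := k) (ℓ := ℓ) h1 n (N - 1)
    (by omega) (by omega)
  have h2 := pathSum_add_single h1 n
  have e1 : root k ℓ (pathSum k ℓ n (N - 1)) = delta k ℓ - simpleRoot k ℓ (centre k ℓ n) := by
    rw [← root_one h1, ← h2, root_add, root_single]; abel
  have e2 : coroot k ℓ (pathSum k ℓ n (N - 1)) =
      deltaCheck k ℓ - simpleCoroot k ℓ (centre k ℓ n) := by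
    rw [← coroot_one h1, ← h2, coroot_add, coroot_single]; abel
  have e3 : halfNorm k ℓ (Pi.single (centre k ℓ n) 1) = -1 := by
    rw [halfNorm, root_single, coroot_single, pairing_simpleRoot_self]; rfl
  have e4 := pairing_root_deltaCheck h1 (Pi.single (centre k ℓ n) 1)
  have e5 := pairing_delta_simpleCoroot_centre k ℓ n
  rw [root_single] at e4
  refine ⟨w, hw, biAut_ext (fun Λ => ?_) (fun l => ?_)⟩
  · change kacCoh k ℓ _ Λ = w.1 ((simpleReflection k ℓ (centre k ℓ n)).1 Λ)
    rw [hw1, e1, e2]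
    simp only [kacCoh, simpleReflection_fst, root_single, coroot_single, e3, map_add, map_smul,
      map_sub, LinearMap.add_apply, LinearMap.smul_apply, smul_eq_mul, pairing_simpleRoot_self, e4]
    module
  · change kacHom k ℓ _ l = w.2 ((simpleReflection k ℓ (centre k ℓ n)).2 l)
    rw [hw2, e1, e2]
    simp only [kacHom, simpleReflection_snd, root_single, coroot_single, e3, map_add, map_smul,
      map_sub, LinearMap.sub_apply, smul_eq_mul, pairing_simpleRoot_self, e5]
    module

/-- The coordinates whose translation lies in `W` form a subgroup by additivity, and by
`translation_single` this subgroup contains a basis. -/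
theorem translation_mem (h1 : ∀ n, k n = 1 ∧ ℓ n = 1) (c : Node k ℓ → ℤ) :
    translation h1 c ∈ weylGroup k ℓ := by
  let S : AddSubgroup (Node k ℓ → ℤ) :=
    { carrier := {c | translation h1 c ∈ weylGroup k ℓ}
      add_mem' := fun {a b} ha hb => by
        rw [Set.mem_ofPred_eq, ← translation_mul]
        exact mul_mem ha hb
      zero_mem' := by
        rw [Set.mem_ofPred_eq, translation_zero]
        exact one_mem _
      neg_mem' := fun {a} ha => by
        have h : translation h1 (-a) = (translation h1 a)⁻¹ := by
          rw [eq_inv_iff_mul_eq_one, translation_mul, neg_add_cancel, translation_zero]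
        rw [Set.mem_ofPred_eq, h]
        exact inv_mem ha }
  have hS : ∀ ν, Pi.single ν 1 ∈ S := fun ν => by
    obtain ⟨w, hw, h⟩ := translation_single h1 ν.1
    rw [node_eq_centre h1] at h
    change translation h1 _ ∈ weylGroup k ℓ
    rw [h]
    refine mul_mem (Subgroup.closure_mono ?_ hw) (Subgroup.subset_closure ⟨ν, rfl⟩)
    rintro _ ⟨μ, _, rfl⟩
    exact ⟨μ, rfl⟩
  have hc : c = ∑ ν, c ν • Pi.single ν (1 : ℤ) := by
    ext μ
    simp [Finset.sum_apply, Pi.single_apply]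
  change c ∈ S
  rw [hc]
  exact sum_mem fun ν _ => zsmul_mem (hS ν) _

/-- The translation `t_α` as an element of the Weyl group. -/
def weylTranslation (h1 : ∀ n, k n = 1 ∧ ℓ n = 1) (c : Node k ℓ → ℤ) : weylGroup k ℓ :=
  ⟨translation h1 c, translation_mem h1 c⟩

theorem weylTranslation_mul (h1 : ∀ n, k n = 1 ∧ ℓ n = 1) (c c' : Node k ℓ → ℤ) :
    weylTranslation h1 c * weylTranslation h1 c' = weylTranslation h1 (c + c') :=
  Subtype.ext (translation_mul h1 c c')

theorem weylTranslation_zero (h1 : ∀ n, k n = 1 ∧ ℓ n = 1) : weylTranslation h1 0 = 1 :=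
  Subtype.ext (translation_zero h1)

theorem weylTranslation_neg (h1 : ∀ n, k n = 1 ∧ ℓ n = 1) (c : Node k ℓ → ℤ) :
    weylTranslation h1 (-c) = (weylTranslation h1 c)⁻¹ := by
  rw [eq_inv_iff_mul_eq_one, weylTranslation_mul, neg_add_cancel, weylTranslation_zero]

theorem weylTranslation_pow (h1 : ∀ n, k n = 1 ∧ ℓ n = 1) (c : Node k ℓ → ℤ) (n : ℕ) :
    weylTranslation h1 c ^ n = weylTranslation h1 (n • c) := by
  induction n with
  | zero => rw [pow_zero, zero_smul, weylTranslation_zero]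
  | succ n ih => rw [pow_succ, ih, weylTranslation_mul, succ_nsmul]

/-- The lattice part of the Weyl group. -/
def latticePart (h1 : ∀ n, k n = 1 ∧ ℓ n = 1) : Subgroup (weylGroup k ℓ) where
  carrier := Set.range (weylTranslation h1)
  mul_mem' := by
    rintro _ _ ⟨c, rfl⟩ ⟨c', rfl⟩
    exact ⟨c + c', (weylTranslation_mul h1 c c').symm⟩
  one_mem' := ⟨0, weylTranslation_zero h1⟩
  inv_mem' := by
    rintro _ ⟨c, rfl⟩
    exact ⟨-c, weylTranslation_neg h1 c⟩

/-- An element `w` of `W` preserves the pairing, `δ` and `δ̌`, so it carries each term of Kac's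
formula for `α` to the corresponding term for `wα`: `w t_α w⁻¹ = t_{wα}`. -/
theorem latticePart_normal (h1 : ∀ n, k n = 1 ∧ ℓ n = 1) : (latticePart h1).Normal := by
  constructor
  rintro _ ⟨c, rfl⟩ w
  obtain ⟨c', hc, hc'⟩ := exists_root_weylGroup h1 w.2 c
  refine ⟨c', ?_⟩
  rw [eq_mul_inv_iff_mul_eq]
  have hp := pairing_weylGroup k ℓ w.2
  have hd := weylGroup_delta h1 w.2
  have hh : halfNorm k ℓ c' = halfNorm k ℓ c := by
    rw [halfNorm, ← hc, ← hc', hp, halfNorm]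
  refine Subtype.ext (biAut_ext (fun Λ => ?_) (fun l => ?_))
  · change kacCoh k ℓ c' (w.1.1 Λ) = w.1.1 (kacCoh k ℓ c Λ)
    have e1 := hp Λ (deltaCheck k ℓ)
    rw [hd.2] at e1
    simp only [kacCoh, map_add, map_sub, map_smul, hh, ← hc, ← hc', hp, hd.1, e1]
  · change kacHom k ℓ c' (w.1.2 l) = w.1.2 (kacHom k ℓ c l)
    have e1 := hp (delta k ℓ) l
    rw [hd.1] at e1
    simp only [kacHom, map_add, map_sub, map_smul, hh, ← hc, ← hc', hp, hd.2, e1]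

/-- The simple reflections other than `s_n^0` generate a complement of the lattice part. -/
theorem latticePart_isComplement' (h1 : ∀ n, k n = 1 ∧ ℓ n = 1) (n : ZMod N) :
    Subgroup.IsComplement' (latticePart h1)
      (Subgroup.closure (simpleRefl k ℓ '' {ν | ν ≠ centre k ℓ n})) := by
  have hnormal := latticePart_normal h1
  apply Subgroup.isComplement'_of_disjoint_and_mul_eq_univ
  · rw [Subgroup.disjoint_def]
    rintro _ ⟨c, rfl⟩ hc
    -- The class `h_n` separates the two subgroups: `⟨α_m, h_n⟩ = 0` for `m ≠ n`, so the other
    -- reflections fix it.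
    have hfix : ∀ w ∈ Subgroup.closure (simpleRefl k ℓ '' {ν | ν ≠ centre k ℓ n}),
        w.1.2 (hyp k ℓ n) = hyp k ℓ n := fun w hw => by
      induction hw using Subgroup.closure_induction with
      | mem w hw =>
        obtain ⟨ν, hν, rfl⟩ := hw
        change (simpleReflection k ℓ ν).2 _ = _
        have h2 : ν.1 ≠ n := fun h => hν (by rw [← node_eq_centre h1 ν, h])
        rw [simpleReflection_snd, pairing_hyp, ← node_eq_centre h1 ν, simpleRoot_centre]
        simp [hyp, exc, h2.symm]
      | one => rfl
      | mul x y _ _ hx hy => exact (congrArg _ hy).trans hx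
      | inv x _ hx =>
        change x.1.2.symm _ = _
        rw [LinearEquiv.symm_apply_eq, hx]
    have h2 : kacHom k ℓ c (hyp k ℓ n) = hyp k ℓ n := hfix _ hc
    set z := pairing k ℓ (root k ℓ c) (hyp k ℓ n) - halfNorm k ℓ c with hz
    have h3 : coroot k ℓ c = z • deltaCheck k ℓ := by
      have h4 : kacHom k ℓ c (hyp k ℓ n) = hyp k ℓ n - coroot k ℓ c + z • deltaCheck k ℓ := by
        simp only [kacHom, pairing_hyp k ℓ (delta k ℓ), delta_inl, one_smul, mul_one, hz]
      rw [h4] at h2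
      have h6 : hyp k ℓ n - coroot k ℓ c + z • deltaCheck k ℓ - hyp k ℓ n = 0 := by
        rw [h2, sub_self]
      have h7 : z • deltaCheck k ℓ - coroot k ℓ c = 0 := by rw [← h6]; abel
      exact (sub_eq_zero.mp h7).symm
    -- A translation fixing `h_n` has `α̌ = z δ̌`. Comparing the coefficients of `e_m^1` yields `α =
    -- z δ`, and `t_{zδ}` is the identity, although `z` need not vanish: `c ↦ t_c` is not injective.
    have h4 : c = z • fun _ => 1 := by
      ext ν
      have h5 := congrFun h3 (Sum.inr (excPos k ℓ ν.1))
      rw [coroot_inr h1, Pi.smul_apply, deltaCheck_inr] at h5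
      simp only [excPos, node_eq_centre h1, smul_eq_mul] at h5
      simp only [Pi.smul_apply, smul_eq_mul]
      linarith
    have h5 : halfNorm k ℓ c = 0 := by
      have := two_mul_halfNorm h1 c
      rw [h3, map_smul, pairing_root_deltaCheck h1] at this
      simpa using this
    have h6 : root k ℓ c = z • delta k ℓ := by rw [h4, root_zsmul, root_one h1]
    refine Subtype.ext (biAut_ext (fun Λ => ?_) (fun l => ?_))
    · change kacCoh k ℓ c Λ = Λ
      simp only [kacCoh, h5, h3, h6, map_smul, smul_eq_mul]
      module
    · change kacHom k ℓ c l = l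
      simp only [kacHom, h5, h3, h6, map_smul, LinearMap.smul_apply, smul_eq_mul]
      module
  · rw [← Subgroup.normal_mul]
    have htop : latticePart h1 ⊔
        Subgroup.closure (simpleRefl k ℓ '' {ν | ν ≠ centre k ℓ n}) = ⊤ := by
      set P := latticePart h1 ⊔ Subgroup.closure (simpleRefl k ℓ '' {ν | ν ≠ centre k ℓ n}) with hP
      have hother : ∀ ν, ν ≠ centre k ℓ n → simpleRefl k ℓ ν ∈ P := fun ν hν =>
        le_sup_right (a := latticePart h1) (Subgroup.subset_closure ⟨ν, hν, rfl⟩)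
      have hmap : Subgroup.closure (simpleReflection k ℓ '' {ν | ν ≠ centre k ℓ n}) ≤
          P.map (weylGroup k ℓ).subtype := by
        rw [Subgroup.closure_le]
        rintro _ ⟨ν, hν, rfl⟩
        exact ⟨simpleRefl k ℓ ν, hother ν hν, rfl⟩
      -- The omitted reflection is recovered by solving `t_{α_n} = w' s_n` for `s_n`.
      have hcent : simpleRefl k ℓ (centre k ℓ n) ∈ P := by
        obtain ⟨w, hw, h⟩ := translation_single h1 n
        obtain ⟨w', hw', rfl⟩ := hmap hw
        have h2 : simpleRefl k ℓ (centre k ℓ n) =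
            w'⁻¹ * weylTranslation h1 (Pi.single (centre k ℓ n) 1) := by
          rw [eq_inv_mul_iff_mul_eq]
          exact Subtype.ext h.symm
        rw [h2]
        exact mul_mem (inv_mem hw') (le_sup_left (a := latticePart h1) ⟨_, rfl⟩)
      have hall : weylGroup k ℓ ≤ P.map (weylGroup k ℓ).subtype := by
        unfold weylGroup
        rw [Subgroup.closure_le]
        rintro _ ⟨ν, rfl⟩
        refine ⟨simpleRefl k ℓ ν, ?_, rfl⟩
        by_cases hν : ν = centre k ℓ n
        · rw [hν]; exact hcent
        · exact hother ν hν
      rw [eq_top_iff]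
      intro w _
      obtain ⟨w', hw', h⟩ := hall w.2
      rwa [← Subtype.ext h]
    rw [htop]
    rfl

end Translations

end

end TropicalWeyl

/-- A substitution in a rational function field is well defined once the substituted elements are
algebraically independent. That is automatic when they generate the field and are as many as the
variables, by transcendence degree. -/
theorem IsFractionRing.exists_algHom_of_mem_adjoin {F ι L : Type*} [Field F] [Finite ι] [Field L]
    [Algebra F L] [Algebra (MvPolynomial ι F) L] [IsScalarTower F (MvPolynomial ι F) L]
    [IsFractionRing (MvPolynomial ι F) L] (y : ι → L)
    (hy : ∀ i, algebraMap (MvPolynomial ι F) L (MvPolynomial.X i) ∈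
      IntermediateField.adjoin F (Set.range y)) :
    ∃ φ : L →ₐ[F] L, ∀ i, φ (algebraMap (MvPolynomial ι F) L (MvPolynomial.X i)) = y i := by
  have hpoly : ∀ P : MvPolynomial ι F, algebraMap (MvPolynomial ι F) L P ∈
      IntermediateField.adjoin F (Set.range y) := fun P => by
    induction P using MvPolynomial.induction_on with
    | C a =>
      rw [← MvPolynomial.algebraMap_eq, ← IsScalarTower.algebraMap_apply]
      exact algebraMap_mem _ a
    | add p q hp hq => rw [map_add]; exact add_mem hp hq
    | mul_X p i hp => rw [map_mul]; exact mul_mem hp (hy i)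
  have htop : ∀ z : L, z ∈ IntermediateField.adjoin F (Set.range y) := fun z => by
    obtain ⟨P, Q, _, rfl⟩ := IsFractionRing.div_surjective (MvPolynomial ι F) z
    exact div_mem (hpoly P) (hpoly Q)
  have halg : Algebra.IsAlgebraic (Algebra.adjoin F (Set.range y)) L := ⟨fun z => by
    obtain ⟨r, hr, s, hs, rfl⟩ := IntermediateField.mem_adjoin_iff_div.mp (htop z)
    rw [div_eq_mul_inv]
    exact (isAlgebraic_algebraMap (⟨r, hr⟩ : Algebra.adjoin F (Set.range y))).mul
      (isAlgebraic_algebraMap (⟨s, hs⟩ : Algebra.adjoin F (Set.range y))).inv⟩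
  have hX : AlgebraicIndependent F
      (fun i => algebraMap (MvPolynomial ι F) L (MvPolynomial.X i)) :=
    (MvPolynomial.algebraicIndependent_X ι F).map'
      (f := IsScalarTower.toAlgHom F (MvPolynomial ι F) L)
      (IsFractionRing.injective (MvPolynomial ι F) L)
  -- The variables bound the transcendence degree from below by the size of `ι`. Thus `y`, over
  -- which the field is algebraic, is a transcendence basis.
  have hind : AlgebraicIndependent F y :=
    (Algebra.IsAlgebraic.isTranscendenceBasis_of_lift_le_trdeg_of_finite F y
      hX.lift_cardinalMk_le_trdeg).1
  have hinj : Function.Injective (MvPolynomial.aeval (R := F) y) := hind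
  refine ⟨IsFractionRing.liftAlgHom hinj, fun i => ?_⟩
  rw [IsFractionRing.liftAlgHom_apply]
  exact (IsFractionRing.lift_algebraMap _ _).trans (MvPolynomial.aeval_X _ _)

namespace TropicalWeyl

noncomputable section

/-! ### Birational reflections as involutive automorphisms of `𝕂(f)`. -/

section Automorphisms

variable {N : ℕ} {k ℓ : ZMod N → ℕ+}

theorem funField_ringHom_ext {L : Type*} [Field L] {φ ψ : FunField k ℓ →+* L}
    (hC : ∀ z : ℂ, φ (algebraMap ℂ _ z) = ψ (algebraMap ℂ _ z))
    (ha : ∀ ν, φ (aRoot k ℓ ν) = ψ (aRoot k ℓ ν))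
    (hf : ∀ n, φ (fVar k ℓ n) = ψ (fVar k ℓ n)) : φ = ψ := by
  have hK : (φ.comp (algebraMap (MvPolynomial (ZMod N) (CoefField k ℓ)) _)).comp
      MvPolynomial.C = (ψ.comp (algebraMap (MvPolynomial (ZMod N) (CoefField k ℓ)) _)).comp
      MvPolynomial.C := by
    apply IsLocalization.ringHom_ext (nonZeroDivisors (MvPolynomial (Node k ℓ) ℂ))
    apply MvPolynomial.ringHom_ext
    · intro z
      exact hC z
    · intro ν
      exact ha ν
  apply IsLocalization.ringHom_ext (nonZeroDivisors (MvPolynomial (ZMod N) (CoefField k ℓ)))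
  apply MvPolynomial.ringHom_ext
  · intro x
    exact RingHom.congr_fun hK x
  · intro n
    exact hf n

theorem funField_algHom_ext {φ ψ : FunField k ℓ →ₐ[ℂ] FunField k ℓ}
    (ha : ∀ ν, φ (aRoot k ℓ ν) = ψ (aRoot k ℓ ν))
    (hf : ∀ n, φ (fVar k ℓ n) = ψ (fVar k ℓ n)) : φ = ψ := by
  have h : (φ : FunField k ℓ →+* FunField k ℓ) = ψ :=
    funField_ringHom_ext (fun z => (φ.commutes z).trans (ψ.commutes z).symm) ha hf
  exact AlgHom.ext fun x => RingHom.congr_fun h x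

theorem fVar_add_ne_zero (n : ZMod N) (x y : CoefField k ℓ) (h : x ≠ 0 ∨ y ≠ 0) :
    algebraMap (MvPolynomial (ZMod N) (CoefField k ℓ)) (FunField k ℓ)
      (MvPolynomial.C x * MvPolynomial.X n + MvPolynomial.C y) ≠ 0 := by
  rw [Ne, FaithfulSMul.algebraMap_eq_zero_iff]
  intro h0
  have h1 := congrArg (MvPolynomial.eval (0 : ZMod N → CoefField k ℓ)) h0
  have h2 := congrArg (MvPolynomial.eval (1 : ZMod N → CoefField k ℓ)) h0
  simp at h1 h2
  rw [h1] at h2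
  rcases h with h | h
  · exact h (by simpa using h2)
  · exact h h1

/-- The half power `(a_n^0)^{1/2}` in the coefficient field. -/
def bCoef (k ℓ : ZMod N → ℕ+) (p : ℕ) (n : ZMod N) : CoefField k ℓ :=
  aRootK k ℓ (centre k ℓ n) ^ (p / 2)

/-- The half power `(a_n^0)^{1/2}`. -/
def bVar (k ℓ : ZMod N → ℕ+) (p : ℕ) (n : ZMod N) : FunField k ℓ :=
  aRoot k ℓ (centre k ℓ n) ^ (p / 2)

/-- The factor by which `s_n^0` multiplies `f_{n-1}`. -/
def mobFactor (k ℓ : ZMod N → ℕ+) (p : ℕ) (n : ZMod N) : FunField k ℓ :=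
  (bVar k ℓ p n * fVar k ℓ n + 1) / (fVar k ℓ n + bVar k ℓ p n)

/-- The exponent of the factor by which `s_n^0` multiplies `f_m`. -/
def mobExp (n m : ZMod N) : ℤ := (if m = n - 1 then 1 else 0) - (if m = n + 1 then 1 else 0)

theorem aRootK_ne_zero (ν : Node k ℓ) : aRootK k ℓ ν ≠ 0 := by
  rw [aRootK, Ne, FaithfulSMul.algebraMap_eq_zero_iff]
  exact MvPolynomial.X_ne_zero ν

theorem algebraMap_coef (x : CoefField k ℓ) :
    algebraMap (CoefField k ℓ) (FunField k ℓ) x =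
      algebraMap (MvPolynomial (ZMod N) (CoefField k ℓ)) (FunField k ℓ) (MvPolynomial.C x) := rfl

theorem aRoot_ne_zero (ν : Node k ℓ) : aRoot k ℓ ν ≠ 0 := by
  rw [aRoot, ← algebraMap_coef, Ne, FaithfulSMul.algebraMap_eq_zero_iff]
  exact aRootK_ne_zero ν

theorem bCoef_ne_zero (p : ℕ) (n : ZMod N) : bCoef k ℓ p n ≠ 0 :=
  pow_ne_zero _ (aRootK_ne_zero _)

theorem bVar_ne_zero (p : ℕ) (n : ZMod N) : bVar k ℓ p n ≠ 0 :=
  pow_ne_zero _ (aRoot_ne_zero _)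

theorem bVar_eq (p : ℕ) (n : ZMod N) :
    bVar k ℓ p n = algebraMap (CoefField k ℓ) (FunField k ℓ) (bCoef k ℓ p n) := by
  rw [bCoef, map_pow]; rfl

/-- It says `u_n ≠ 1/v_n`, that is, `F_n` is not constant in `f_n`; the nonvanishing of the bilinear
forms in the analysis of poles depends on it. -/
theorem bCoef_sq_ne_one {p : ℕ} (hp : 0 < p) (h2 : 2 ∣ p) (n : ZMod N) :
    bCoef k ℓ p n ^ 2 ≠ 1 := by
  rw [bCoef, ← pow_mul, Nat.div_mul_cancel h2, aRootK, ← map_pow]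
  intro h
  rw [← map_one (algebraMap (MvPolynomial (Node k ℓ) ℂ) (CoefField k ℓ))] at h
  have h1 := congrArg (MvPolynomial.eval (0 : Node k ℓ → ℂ))
    (FaithfulSMul.algebraMap_injective _ _ h)
  simp [hp.ne'] at h1

theorem fVar_add_bVar_ne_zero (p : ℕ) (n : ZMod N) : fVar k ℓ n + bVar k ℓ p n ≠ 0 := by
  have h := fVar_add_ne_zero n (1 : CoefField k ℓ) (bCoef k ℓ p n) (Or.inl one_ne_zero)
  rw [map_add, map_mul, map_one, map_one, one_mul, ← algebraMap_coef, ← bVar_eq] at h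
  exact h

theorem bVar_mul_fVar_add_one_ne_zero (p : ℕ) (n : ZMod N) :
    bVar k ℓ p n * fVar k ℓ n + 1 ≠ 0 := by
  have h := fVar_add_ne_zero n (bCoef k ℓ p n) 1 (Or.inr one_ne_zero)
  rw [map_add, map_mul, map_one, map_one, ← algebraMap_coef, ← bVar_eq] at h
  exact h

theorem mobFactor_ne_zero (p : ℕ) (n : ZMod N) : mobFactor k ℓ p n ≠ 0 :=
  div_ne_zero (bVar_mul_fVar_add_one_ne_zero p n) (fVar_add_bVar_ne_zero p n)

variable [Fact (3 ≤ N)]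

theorem mobExp_self (n : ZMod N) : mobExp n n = 0 := by
  rw [mobExp, if_neg (zmod_sub_one_ne n).symm, if_neg (zmod_add_one_ne n).symm, sub_zero]

/-- The action of a simple reflection on the coefficient field. -/
theorem exists_coefField_reflection (ν : Node k ℓ) :
    ∃ τ : CoefField k ℓ ≃ₐ[ℂ] CoefField k ℓ, ∀ μ, τ (aRootK k ℓ μ) = aRootK k ℓ μ *
      aRootK k ℓ ν ^ pairing k ℓ (simpleRoot k ℓ μ) (simpleCoroot k ℓ ν) := by
  set y : Node k ℓ → CoefField k ℓ := fun μ => aRootK k ℓ μ *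
      aRootK k ℓ ν ^ pairing k ℓ (simpleRoot k ℓ μ) (simpleCoroot k ℓ ν) with hy
  have h0 := aRootK_ne_zero ν
  have hyν : y ν = (aRootK k ℓ ν)⁻¹ := by
    simp only [hy, pairing_simpleRoot_self]
    field_simp
  have hν : aRootK k ℓ ν ∈ IntermediateField.adjoin ℂ (Set.range y) := by
    have h := inv_mem (IntermediateField.subset_adjoin ℂ (Set.range y) ⟨ν, rfl⟩)
    rwa [hyν, inv_inv] at h
  obtain ⟨φ, hφ⟩ := IsFractionRing.exists_algHom_of_mem_adjoin y (fun μ => by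
    have h : aRootK k ℓ μ = y μ *
        (aRootK k ℓ ν ^ pairing k ℓ (simpleRoot k ℓ μ) (simpleCoroot k ℓ ν))⁻¹ := by
      rw [hy, mul_assoc, mul_inv_cancel₀ (zpow_ne_zero _ h0), mul_one]
    change aRootK k ℓ μ ∈ _
    rw [h]
    exact mul_mem (IntermediateField.subset_adjoin ℂ _ ⟨μ, rfl⟩) (inv_mem (zpow_mem hν _)))
  have hφ' : ∀ μ, φ (aRootK k ℓ μ) = y μ := hφ
  -- The map inverts `a_ν`, so the power of `a_ν` acquired by `a_μ` in the first application is
  -- cancelled in the second.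
  have hinv : φ.comp φ = AlgHom.id ℂ _ := by
    have h : ((φ.comp φ : CoefField k ℓ →ₐ[ℂ] CoefField k ℓ) : CoefField k ℓ →+* CoefField k ℓ) =
        RingHom.id _ := by
      apply IsLocalization.ringHom_ext (nonZeroDivisors (MvPolynomial (Node k ℓ) ℂ))
      apply MvPolynomial.ringHom_ext
      · intro z
        exact (φ.comp φ).commutes z
      · intro μ
        change φ (φ (aRootK k ℓ μ)) = aRootK k ℓ μ
        rw [hφ', hy, map_mul, map_zpow₀, hφ', hφ', hyν, hy, inv_zpow, mul_assoc,
          mul_inv_cancel₀ (zpow_ne_zero _ h0), mul_one]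
    exact AlgHom.ext fun x => RingHom.congr_fun h x
  exact ⟨AlgEquiv.ofAlgHom φ φ hinv hinv, hφ'⟩

/-- An automorphism of the coefficient field, extended to fix all the coordinates. -/
def extendCoef (τ : CoefField k ℓ ≃ₐ[ℂ] CoefField k ℓ) : FunField k ℓ ≃ₐ[ℂ] FunField k ℓ :=
  IsFractionRing.algEquivOfAlgEquiv (MvPolynomial.mapAlgEquiv (ZMod N) τ)

omit [Fact (3 ≤ N)] in
theorem extendCoef_fVar (τ : CoefField k ℓ ≃ₐ[ℂ] CoefField k ℓ) (n : ZMod N) :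
    extendCoef τ (fVar k ℓ n) = fVar k ℓ n := by
  rw [extendCoef, fVar, IsFractionRing.algEquivOfAlgEquiv_algebraMap]
  simp

omit [Fact (3 ≤ N)] in
theorem extendCoef_algebraMap (τ : CoefField k ℓ ≃ₐ[ℂ] CoefField k ℓ) (x : CoefField k ℓ) :
    extendCoef τ (algebraMap (CoefField k ℓ) (FunField k ℓ) x) =
      algebraMap (CoefField k ℓ) (FunField k ℓ) (τ x) := by
  rw [extendCoef, algebraMap_coef, IsFractionRing.algEquivOfAlgEquiv_algebraMap]
  simp [algebraMap_coef]

/-- The birational transformation attached to the vertex `(n, 0)`, for `k = ℓ = 1`. -/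
theorem exists_birational_reflection (p : ℕ) (n : ZMod N) :
    ∃ σ : FunField k ℓ ≃ₐ[ℂ] FunField k ℓ,
      (∃ τ : CoefField k ℓ ≃ₐ[ℂ] CoefField k ℓ, ∀ x, σ (algebraMap _ _ x) = algebraMap _ _ (τ x)) ∧
      (∀ μ, σ (aRoot k ℓ μ) = aRoot k ℓ μ * aRoot k ℓ (centre k ℓ n) ^
        pairing k ℓ (simpleRoot k ℓ μ) (simpleCoroot k ℓ (centre k ℓ n))) ∧
      (∀ m, σ (fVar k ℓ m) = fVar k ℓ m * mobFactor k ℓ p n ^ mobExp n m) ∧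
      ∀ R, σ (σ R) = R := by
  obtain ⟨τ, hτ⟩ := exists_coefField_reflection (centre k ℓ n)
  set y : ZMod N → FunField k ℓ := fun m => fVar k ℓ m * mobFactor k ℓ p n ^ mobExp n m with hy
  have hyn : y n = fVar k ℓ n := by simp [hy, mobExp_self]
  have hF : mobFactor k ℓ p n ∈ IntermediateField.adjoin (CoefField k ℓ) (Set.range y) := by
    have hf : fVar k ℓ n ∈ IntermediateField.adjoin (CoefField k ℓ) (Set.range y) :=
      IntermediateField.subset_adjoin _ _ ⟨n, hyn⟩
    have hb : bVar k ℓ p n ∈ IntermediateField.adjoin (CoefField k ℓ) (Set.range y) := by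
      rw [bVar_eq]; exact algebraMap_mem _ _
    exact div_mem (add_mem (mul_mem hb hf) (one_mem _)) (add_mem hf hb)
  have hF0 := mobFactor_ne_zero (k := k) (ℓ := ℓ) p n
  obtain ⟨φ, hφ⟩ := IsFractionRing.exists_algHom_of_mem_adjoin y (fun m => by
    have h : fVar k ℓ m = y m * (mobFactor k ℓ p n ^ mobExp n m)⁻¹ := by
      rw [hy, mul_assoc, mul_inv_cancel₀ (zpow_ne_zero _ hF0), mul_one]
    change fVar k ℓ m ∈ _
    rw [h]
    exact mul_mem (IntermediateField.subset_adjoin _ _ ⟨m, rfl⟩) (inv_mem (zpow_mem hF _)))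
  -- The reflection moves both coefficients and coordinates: first the coefficients are transformed
  -- with the `f_m` fixed, then the coordinates are substituted `𝕂`-linearly.
  let ψ : FunField k ℓ →ₐ[ℂ] FunField k ℓ := (φ.restrictScalars ℂ).comp (extendCoef τ)
  have hψK : ∀ x, ψ (algebraMap (CoefField k ℓ) _ x) = algebraMap (CoefField k ℓ) _ (τ x) :=
    fun x => by
      change φ (extendCoef τ _) = _
      rw [extendCoef_algebraMap, φ.commutes]
  have hψa : ∀ μ, ψ (aRoot k ℓ μ) = aRoot k ℓ μ * aRoot k ℓ (centre k ℓ n) ^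
        pairing k ℓ (simpleRoot k ℓ μ) (simpleCoroot k ℓ (centre k ℓ n)) := fun μ => by
    have h := hψK (aRootK k ℓ μ)
    rw [hτ, map_mul, map_zpow₀] at h
    exact h
  have hψf : ∀ m, ψ (fVar k ℓ m) = fVar k ℓ m * mobFactor k ℓ p n ^ mobExp n m := fun m => by
    change φ (extendCoef τ _) = _
    rw [extendCoef_fVar]
    exact hφ m
  have ha0 := aRoot_ne_zero (centre k ℓ n)
  have hψan : ψ (aRoot k ℓ (centre k ℓ n)) = (aRoot k ℓ (centre k ℓ n))⁻¹ := by
    rw [hψa, pairing_simpleRoot_self]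
    field_simp
  -- As `f_n` is fixed and `b_n` is inverted, the numerator and the denominator of `F_n` are
  -- exchanged up to a common factor. This makes the transformation an involution.
  have hψF : ψ (mobFactor k ℓ p n) = (mobFactor k ℓ p n)⁻¹ := by
    have hb : ψ (bVar k ℓ p n) = (bVar k ℓ p n)⁻¹ := by
      rw [bVar, map_pow, hψan, inv_pow]
    have hf : ψ (fVar k ℓ n) = fVar k ℓ n := by
      rw [hψf, mobExp_self, zpow_zero, mul_one]
    have h3 := bVar_ne_zero (k := k) (ℓ := ℓ) p n
    have h4 := bVar_mul_fVar_add_one_ne_zero (k := k) (ℓ := ℓ) p n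
    have h5 := fVar_add_bVar_ne_zero (k := k) (ℓ := ℓ) p n
    have h6 : fVar k ℓ n + (bVar k ℓ p n)⁻¹ ≠ 0 := by
      intro h
      apply h4
      have : bVar k ℓ p n * (fVar k ℓ n + (bVar k ℓ p n)⁻¹) = 0 := by rw [h, mul_zero]
      rwa [mul_add, mul_inv_cancel₀ h3] at this
    rw [mobFactor, map_div₀, map_add, map_add, map_mul, map_one, hb, hf, inv_div,
      div_eq_div_iff h6 h4]
    field_simp
  have hinv : ψ.comp ψ = AlgHom.id ℂ _ := by
    apply funField_algHom_ext
    · intro μ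
      change ψ (ψ _) = aRoot k ℓ μ
      rw [hψa, map_mul, map_zpow₀, hψan, hψa, inv_zpow, mul_assoc,
        mul_inv_cancel₀ (zpow_ne_zero _ ha0), mul_one]
    · intro m
      change ψ (ψ _) = fVar k ℓ m
      rw [hψf, map_mul, map_zpow₀, hψF, hψf, inv_zpow, mul_assoc,
        mul_inv_cancel₀ (zpow_ne_zero _ hF0), mul_one]
  exact ⟨AlgEquiv.ofAlgHom ψ ψ hinv hinv, ⟨τ, hψK⟩, hψa, hψf, fun R => AlgHom.congr_fun hinv R⟩

end Automorphisms

/-! ### The Coxeter matrix of the cycle. -/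

section Cycle

variable (N : ℕ) [Fact (3 ≤ N)]

/-- The Coxeter matrix of the cycle of length `N`. -/
def cycleMatrix : CoxeterMatrix (ZMod N) where
  M := Matrix.of fun i j => if i = j then 1 else if j = i + 1 ∨ i = j + 1 then 3 else 2
  isSymm := by
    ext i j
    simp only [Matrix.transpose_apply, Matrix.of_apply, eq_comm (a := i) (b := j),
      or_comm (a := i = j + 1)]
  diagonal i := by simp
  off_diagonal i j h := by
    simp only [Matrix.of_apply, if_neg h]
    split_ifs <;> norm_num

variable {N}

omit [Fact (3 ≤ N)] in
theorem cycleMatrix_apply (i j : ZMod N) :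
    cycleMatrix N i j = if i = j then 1 else if j = i + 1 ∨ i = j + 1 then 3 else 2 := rfl

omit [Fact (3 ≤ N)] in
theorem isLiftable_cycleMatrix {G : Type*} [Group G] (f : ZMod N → G) (h1 : ∀ i, f i * f i = 1)
    (h2 : ∀ i j, i ≠ j → j ≠ i + 1 → i ≠ j + 1 → f i * f j = f j * f i)
    (h3 : ∀ i, f i * f (i + 1) * f i = f (i + 1) * f i * f (i + 1)) :
    (cycleMatrix N).IsLiftable f := by
  intro i j
  have key : ∀ a b : G, a * a = 1 → b * b = 1 → a * b * a = b * a * b → (a * b) ^ 3 = 1 :=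
    fun a b ha hb hab => by
      have : (a * b) ^ 3 = (a * b * a) * (b * a * b) := by simp [pow_succ, mul_assoc]
      rw [this, ← hab]
      calc a * b * a * (a * b * a) = a * b * (a * a) * b * a := by simp only [mul_assoc]
        _ = 1 := by rw [ha, mul_one, mul_assoc a, hb, mul_one, ha]
  rw [cycleMatrix_apply]
  split_ifs with h h'
  · rw [h, pow_one, h1]
  · rcases h' with rfl | rfl
    · exact key _ _ (h1 _) (h1 _) (h3 _)
    · exact key _ _ (h1 _) (h1 _) (h3 _).symm
  · rw [not_or] at h'
    rw [pow_two]
    nth_rw 2 [h2 i j h h'.1 h'.2]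
    rw [mul_assoc, ← mul_assoc (f j), h1, one_mul, h1]

end Cycle

/-! ### Identification of the Weyl group with an abstract Coxeter group. -/

section WeylIso

variable {N : ℕ} [Fact (3 ≤ N)] (k ℓ : ZMod N → ℕ+)

theorem isLiftable_simpleRefl :
    (cycleMatrix N).IsLiftable (fun n => simpleRefl k ℓ (centre k ℓ n)) := by
  apply isLiftable_cycleMatrix
  · intro i
    refine Subtype.ext (biAut_ext (fun Λ => ?_) (fun l => ?_))
    · exact LinearEquiv.symm_apply_apply (simpleReflection k ℓ (centre k ℓ i)).1 Λ
    · exact LinearEquiv.symm_apply_apply (simpleReflection k ℓ (centre k ℓ i)).2 l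
  · intro i j hij h1 h2
    have h3 : i ≠ j - 1 := fun h => h1 (by rw [h]; ring)
    have h4 : j ≠ i - 1 := fun h => h2 (by rw [h]; ring)
    have e1 := pairing_simpleRoot_simpleCoroot_centre k ℓ i j
    have e2 := pairing_simpleRoot_simpleCoroot_centre k ℓ j i
    simp only [if_neg h1, if_neg h2, if_neg h3, if_neg h4, if_neg hij, if_neg hij.symm] at e1 e2
    refine Subtype.ext (biAut_ext (fun Λ => ?_) (fun l => ?_))
    · change (simpleReflection k ℓ _).1 ((simpleReflection k ℓ _).1 Λ) =
        (simpleReflection k ℓ _).1 ((simpleReflection k ℓ _).1 Λ)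
      simp only [simpleReflection_fst, map_add, map_smul, e1, e2]
      module
    · change (simpleReflection k ℓ _).2 ((simpleReflection k ℓ _).2 l) =
        (simpleReflection k ℓ _).2 ((simpleReflection k ℓ _).2 l)
      simp only [simpleReflection_snd, map_add, map_smul, e1, e2]
      module
  · intro i
    have h0 : i ≠ i + 1 := (zmod_add_one_ne i).symm
    have h1 : i + 1 ≠ i - 1 := (zmod_sub_one_ne_add_one i).symm
    have h2 : i ≠ i + 1 + 1 := fun h => h1 (by linear_combination -h)
    have e1 := pairing_simpleRoot_simpleCoroot_centre k ℓ i (i + 1)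
    have e2 := pairing_simpleRoot_simpleCoroot_centre k ℓ (i + 1) i
    simp only [if_neg h1, if_neg h0, if_neg h2, if_neg h0.symm, add_sub_cancel_right,
      if_true] at e1 e2
    refine Subtype.ext (biAut_ext (fun Λ => ?_) (fun l => ?_))
    · change (simpleReflection k ℓ _).1 ((simpleReflection k ℓ _).1
          ((simpleReflection k ℓ _).1 Λ)) = (simpleReflection k ℓ _).1
          ((simpleReflection k ℓ _).1 ((simpleReflection k ℓ _).1 Λ))
      simp only [simpleReflection_fst, map_add, map_smul, e1, e2, pairing_simpleRoot_self]
      module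
    · change (simpleReflection k ℓ _).2 ((simpleReflection k ℓ _).2
          ((simpleReflection k ℓ _).2 l)) = (simpleReflection k ℓ _).2
          ((simpleReflection k ℓ _).2 ((simpleReflection k ℓ _).2 l))
      simp only [simpleReflection_snd, map_add, map_smul, e1, e2, pairing_simpleRoot_self]
      module

/-- The homomorphism from the abstract Coxeter group of the cycle to the Weyl group. -/
def coxeterHom : (cycleMatrix N).Group →* weylGroup k ℓ :=
  (cycleMatrix N).toCoxeterSystem.lift ⟨_, isLiftable_simpleRefl k ℓ⟩

theorem coxeterHom_simple (n : ZMod N) :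
    coxeterHom k ℓ ((cycleMatrix N).toCoxeterSystem.simple n) =
      simpleRefl k ℓ (centre k ℓ n) :=
  (cycleMatrix N).toCoxeterSystem.lift_apply_simple (isLiftable_simpleRefl k ℓ) n

/-- Positivity is read off from the `H`-coordinates, in which the central simple roots are the
standard basis vectors; the action on `H²` alone is already faithful. -/
theorem coxeterHom_injective : Function.Injective (coxeterHom k ℓ) := by
  have hinl : ∀ n m, simpleRoot k ℓ (centre k ℓ n) (Sum.inl m) = if m = n then 1 else 0 := by
    intro n m
    simp [simpleRoot_centre, hyp, exc]
  let φ : (cycleMatrix N).Group →* (Coh k ℓ ≃ₗ[ℤ] Coh k ℓ) :=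
    ((MonoidHom.fst _ _).comp (weylGroup k ℓ).subtype).comp (coxeterHom k ℓ)
  have hφ : ∀ n Λ, φ ((cycleMatrix N).toCoxeterSystem.simple n) Λ =
      Λ + pairing k ℓ Λ (simpleCoroot k ℓ (centre k ℓ n)) • simpleRoot k ℓ (centre k ℓ n) := by
    intro n Λ
    rw [show φ ((cycleMatrix N).toCoxeterSystem.simple n) = (coxeterHom k ℓ
      ((cycleMatrix N).toCoxeterSystem.simple n)).1.1 from rfl, coxeterHom_simple]
    rfl
  have hinj : Function.Injective φ := by
    apply (cycleMatrix N).toCoxeterSystem.injective_of_geometric φ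
      (fun n => simpleRoot k ℓ (centre k ℓ n))
      (fun Λ => (∀ n, 0 ≤ Λ (Sum.inl n)) ∧ ∃ n, 0 < Λ (Sum.inl n))
    · intro i j hij
      rw [cycleMatrix_apply, if_neg hij]
      split_ifs <;> simp
    · rintro x y ⟨hx, n, hn⟩ ⟨hy, _⟩
      exact ⟨fun m => add_nonneg (hx m) (hy m), n, add_pos_of_pos_of_nonneg hn (hy n)⟩
    · intro i
      refine ⟨fun n => ?_, i, ?_⟩
      · rw [hinl]; split_ifs <;> norm_num
      · rw [hinl, if_pos rfl]; norm_num
    · rintro i ⟨h, _⟩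
      have := h i
      rw [Pi.neg_apply, hinl, if_pos rfl] at this
      norm_num at this
    · intro i j hij hM
      rw [hφ, pairing_simpleRoot_simpleCoroot_centre, if_neg, if_neg, if_neg (Ne.symm hij)]
      · simp
      all_goals
        rintro rfl
        rw [cycleMatrix_apply, if_neg hij, if_pos (by simp)] at hM
        norm_num at hM
    · intro i j hij hM
      have h1 := zmod_sub_one_ne_add_one i
      rw [cycleMatrix_apply, if_neg hij] at hM
      have h : j = i + 1 ∨ i = j + 1 := by
        by_contra h
        rw [if_neg h] at hM
        norm_num at hM
      have h2 : j = i - 1 ∨ j = i + 1 := by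
        rcases h with h | h
        · exact Or.inr h
        · exact Or.inl (by rw [h]; ring)
      rw [hφ, pairing_simpleRoot_simpleCoroot_centre, if_neg (Ne.symm hij)]
      rcases h2 with rfl | rfl
      · rw [if_pos rfl, if_neg h1]; simp
      · rw [if_neg h1.symm, if_pos rfl]; simp
    · intro i
      rw [hφ, pairing_simpleRoot_self]
      module
  exact Function.Injective.of_comp (f := (fun w : weylGroup k ℓ => w.1.1)) hinj

variable {k ℓ}

theorem coxeterHom_surjective (h1 : ∀ n, k n = 1 ∧ ℓ n = 1) :
    Function.Surjective (coxeterHom k ℓ) := by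
  have h : weylGroup k ℓ ≤ (coxeterHom k ℓ).range.map (weylGroup k ℓ).subtype := by
    refine (Subgroup.closure_le _).mpr ?_
    rintro _ ⟨ν, rfl⟩
    refine ⟨simpleRefl k ℓ ν, ⟨(cycleMatrix N).toCoxeterSystem.simple ν.1, ?_⟩, rfl⟩
    rw [coxeterHom_simple, node_eq_centre h1]
  intro w
  obtain ⟨_, ⟨g, rfl⟩, hw⟩ := h w.2
  exact ⟨g, Subtype.ext hw⟩

/-- The Weyl group is the Coxeter group of the cycle. -/
def coxeterEquiv (h1 : ∀ n, k n = 1 ∧ ℓ n = 1) : (cycleMatrix N).Group ≃* weylGroup k ℓ :=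
  MulEquiv.ofBijective (coxeterHom k ℓ) ⟨coxeterHom_injective k ℓ, coxeterHom_surjective h1⟩

end WeylIso

/-! ### The cocycle identities behind the braid relation. -/

section Braid

variable {L : Type*} [Field L]

/-- The rational identities behind the braid relation. -/
theorem braid_factor (s t : L →+* L) {x y a b : L} (ha : a ≠ 0) (hb : b ≠ 0)
    (hx : x + a ≠ 0) (hx' : a * x + 1 ≠ 0) (hy : y + b ≠ 0) (hy' : b * y + 1 ≠ 0)
    (sx : s x = x) (sa : s a = a⁻¹) (sb : s b = a * b)
    (sy : s y = y * ((a * x + 1) / (x + a))⁻¹)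
    (ty : t y = y) (tb : t b = b⁻¹) (ta : t a = a * b)
    (tx : t x = x * ((b * y + 1) / (y + b))) :
    (a * x + 1) / (x + a) * s (t ((a * x + 1) / (x + a))) = t ((a * x + 1) / (x + a)) ∧
    (b * y + 1) / (y + b) * t (s ((b * y + 1) / (y + b))) = s ((b * y + 1) / (y + b)) := by
  have e1 : t ((a * x + 1) / (x + a)) =
      (a * b * x * (b * y + 1) + (y + b)) / (x * (b * y + 1) + a * b * (y + b)) := by
    rw [map_div₀, map_add, map_add, map_mul, map_one, ta, tx]
    field_simp
  have e2 : s ((b * y + 1) / (y + b)) =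
      (a * b * y * (x + a) + (a * x + 1)) / (y * (x + a) + a * b * (a * x + 1)) := by
    rw [map_div₀, map_add, map_add, map_mul, map_one, sb, sy]
    field_simp
  have hw : (x + a) / (a * x + 1) * (a * x + 1) = x + a := div_mul_cancel₀ _ hx'
  have hz : (b * y + 1) / (y + b) * (y + b) = b * y + 1 := div_mul_cancel₀ _ hy
  have haa := inv_mul_cancel₀ ha
  have hbb := inv_mul_cancel₀ hb
  rw [inv_div] at sy
  -- With `F = (a x + 1)/(x + a)`, the map `s` multiplies the numerator of `t F` by `F⁻¹` and fixes
  -- the denominator, whence `F · s(t F) = t F`. In the second identity `t` fixes the numerator and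
  -- multiplies the denominator instead.
  have e3 : s (a * b * x * (b * y + 1) + (y + b)) =
      (a * b * x * (b * y + 1) + (y + b)) * ((x + a) / (a * x + 1)) := by
    simp only [map_add, map_mul, map_one, sa, sb, sx, sy]
    generalize (x + a) / (a * x + 1) = w at *
    linear_combination (b * x * (a * b * (y * w) + 1)) * haa - b * hw
  have e4 : s (x * (b * y + 1) + a * b * (y + b)) = x * (b * y + 1) + a * b * (y + b) := by
    simp only [map_add, map_mul, map_one, sa, sb, sx, sy]
    generalize (x + a) / (a * x + 1) = w at *
    linear_combination (b * (y * w + a * b)) * haa + b * y * hw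
  have e5 : t (a * b * y * (x + a) + (a * x + 1)) = a * b * y * (x + a) + (a * x + 1) := by
    simp only [map_add, map_mul, map_one, ta, tb, tx, ty]
    generalize (b * y + 1) / (y + b) = z at *
    linear_combination (a * y * (x * z + a * b)) * hbb + a * x * hz
  have e6 : t (y * (x + a) + a * b * (a * x + 1)) =
      (y * (x + a) + a * b * (a * x + 1)) * ((b * y + 1) / (y + b)) := by
    simp only [map_add, map_mul, map_one, ta, tb, tx, ty]
    generalize (b * y + 1) / (y + b) = z at *
    linear_combination (a * (a * b * (x * z) + 1)) * hbb - a * hz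
  constructor
  · rw [e1, map_div₀, e3, e4]
    field_simp
  · rw [e2, map_div₀, e5, e6]
    field_simp

end Braid

/-! ### The action of the Weyl group on `𝕂(f)` and on the root variables. -/

section Representation

variable {N : ℕ} [Fact (3 ≤ N)] (k ℓ : ZMod N → ℕ+) (p : ℕ)

/-- The birational transformation attached to the vertex `(n, 0)`, for `k = ℓ = 1`. -/
def birRefl (n : ZMod N) : FunField k ℓ ≃ₐ[ℂ] FunField k ℓ :=
  (exists_birational_reflection (k := k) (ℓ := ℓ) p n).choose

variable {k ℓ}

theorem birRefl_coef (n : ZMod N) : ∃ τ : CoefField k ℓ ≃ₐ[ℂ] CoefField k ℓ,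
    ∀ x, birRefl k ℓ p n (algebraMap _ _ x) = algebraMap _ _ (τ x) :=
  (exists_birational_reflection (k := k) (ℓ := ℓ) p n).choose_spec.1

theorem birRefl_aRoot (n : ZMod N) (μ : Node k ℓ) :
    birRefl k ℓ p n (aRoot k ℓ μ) = aRoot k ℓ μ * aRoot k ℓ (centre k ℓ n) ^
        pairing k ℓ (simpleRoot k ℓ μ) (simpleCoroot k ℓ (centre k ℓ n)) :=
  (exists_birational_reflection (k := k) (ℓ := ℓ) p n).choose_spec.2.1 μ

theorem birRefl_fVar (n m : ZMod N) :
    birRefl k ℓ p n (fVar k ℓ m) = fVar k ℓ m * mobFactor k ℓ p n ^ mobExp n m :=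
  (exists_birational_reflection (k := k) (ℓ := ℓ) p n).choose_spec.2.2.1 m

theorem birRefl_birRefl (n : ZMod N) (R : FunField k ℓ) :
    birRefl k ℓ p n (birRefl k ℓ p n R) = R :=
  (exists_birational_reflection (k := k) (ℓ := ℓ) p n).choose_spec.2.2.2 R

theorem birRefl_bVar (n m : ZMod N) :
    birRefl k ℓ p n (bVar k ℓ p m) = bVar k ℓ p m * bVar k ℓ p n ^
        pairing k ℓ (simpleRoot k ℓ (centre k ℓ m)) (simpleCoroot k ℓ (centre k ℓ n)) := by
  rw [bVar, map_pow, birRefl_aRoot, mul_pow, bVar, ← zpow_natCast, ← zpow_natCast, ← zpow_natCast,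
    ← zpow_mul, ← zpow_mul]
  congr 2
  exact mul_comm _ _

theorem birRefl_bVar_self (n : ZMod N) :
    birRefl k ℓ p n (bVar k ℓ p n) = (bVar k ℓ p n)⁻¹ := by
  have := bVar_ne_zero (k := k) (ℓ := ℓ) p n
  rw [birRefl_bVar, pairing_simpleRoot_self]
  field_simp

theorem birRefl_bVar_add_one (n : ZMod N) :
    birRefl k ℓ p n (bVar k ℓ p (n + 1)) = bVar k ℓ p n * bVar k ℓ p (n + 1) := by
  rw [birRefl_bVar, pairing_simpleRoot_simpleCoroot_centre,
    if_neg (zmod_sub_one_ne_add_one n).symm, if_pos rfl, if_neg (zmod_add_one_ne n)]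
  simp [mul_comm]

theorem birRefl_bVar_sub_one (n : ZMod N) :
    birRefl k ℓ p n (bVar k ℓ p (n - 1)) = bVar k ℓ p n * bVar k ℓ p (n - 1) := by
  rw [birRefl_bVar, pairing_simpleRoot_simpleCoroot_centre,
    if_neg (zmod_sub_one_ne_add_one n), if_pos rfl, if_neg (zmod_sub_one_ne n)]
  simp [mul_comm]

theorem birRefl_bVar_of_ne (n m : ZMod N) (h : m ≠ n) (h1 : m ≠ n + 1) (h2 : m ≠ n - 1) :
    birRefl k ℓ p n (bVar k ℓ p m) = bVar k ℓ p m := by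
  rw [birRefl_bVar, pairing_simpleRoot_simpleCoroot_centre, if_neg h, if_neg h1, if_neg h2]
  simp

theorem birRefl_fVar_self (n : ZMod N) : birRefl k ℓ p n (fVar k ℓ n) = fVar k ℓ n := by
  rw [birRefl_fVar, mobExp_self, zpow_zero, mul_one]

theorem birRefl_fVar_add_one (n : ZMod N) :
    birRefl k ℓ p n (fVar k ℓ (n + 1)) = fVar k ℓ (n + 1) * (mobFactor k ℓ p n)⁻¹ := by
  rw [birRefl_fVar, mobExp, if_neg (zmod_sub_one_ne_add_one n).symm, if_pos rfl]
  simp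

theorem birRefl_fVar_sub_one (n : ZMod N) :
    birRefl k ℓ p n (fVar k ℓ (n - 1)) = fVar k ℓ (n - 1) * mobFactor k ℓ p n := by
  rw [birRefl_fVar, mobExp, if_pos rfl, if_neg (zmod_sub_one_ne_add_one n)]
  simp

theorem birRefl_fVar_of_ne (n m : ZMod N) (h1 : m ≠ n + 1) (h2 : m ≠ n - 1) :
    birRefl k ℓ p n (fVar k ℓ m) = fVar k ℓ m := by
  rw [birRefl_fVar, mobExp, if_neg h1, if_neg h2]
  simp

theorem birRefl_mobFactor_of_ne (n m : ZMod N) (h : m ≠ n) (h1 : m ≠ n + 1) (h2 : m ≠ n - 1) :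
    birRefl k ℓ p n (mobFactor k ℓ p m) = mobFactor k ℓ p m := by
  rw [mobFactor, map_div₀, map_add, map_add, map_mul, map_one, birRefl_bVar_of_ne p n m h h1 h2,
    birRefl_fVar_of_ne p n m h1 h2]

/-- These identities remove the inner factor from each of the two length three words in `s_n`,
`s_{n+1}`, which makes their effects on the coordinates agree. -/
theorem birRefl_mobFactor_braid (n : ZMod N) :
    mobFactor k ℓ p n * birRefl k ℓ p n (birRefl k ℓ p (n + 1) (mobFactor k ℓ p n)) =
      birRefl k ℓ p (n + 1) (mobFactor k ℓ p n) ∧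
    mobFactor k ℓ p (n + 1) * birRefl k ℓ p (n + 1) (birRefl k ℓ p n (mobFactor k ℓ p (n + 1))) =
      birRefl k ℓ p n (mobFactor k ℓ p (n + 1)) := by
  have h1 := birRefl_bVar_sub_one (k := k) (ℓ := ℓ) p (n + 1)
  have h2 := birRefl_fVar_sub_one (k := k) (ℓ := ℓ) p (n + 1)
  rw [add_sub_cancel_right] at h1 h2
  exact braid_factor (birRefl k ℓ p n).toAlgHom.toRingHom
    (birRefl k ℓ p (n + 1)).toAlgHom.toRingHom
    (bVar_ne_zero p n) (bVar_ne_zero p (n + 1)) (fVar_add_bVar_ne_zero p n)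
    (bVar_mul_fVar_add_one_ne_zero p n) (fVar_add_bVar_ne_zero p (n + 1))
    (bVar_mul_fVar_add_one_ne_zero p (n + 1)) (birRefl_fVar_self p n) (birRefl_bVar_self p n)
    (birRefl_bVar_add_one p n) (birRefl_fVar_add_one p n) (birRefl_fVar_self p (n + 1))
    (birRefl_bVar_self p (n + 1)) (h1.trans (mul_comm _ _)) h2

omit [Fact (3 ≤ N)] in
theorem algEquiv_ext_gens {φ ψ : FunField k ℓ ≃ₐ[ℂ] FunField k ℓ}
    (ha : ∀ ν, φ (aRoot k ℓ ν) = ψ (aRoot k ℓ ν))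
    (hf : ∀ n, φ (fVar k ℓ n) = ψ (fVar k ℓ n)) : φ = ψ := by
  have h : φ.toAlgHom = ψ.toAlgHom := funField_algHom_ext ha hf
  exact AlgEquiv.ext fun x => AlgHom.congr_fun h x

theorem isLiftable_birRefl : (cycleMatrix N).IsLiftable (birRefl k ℓ p) := by
  apply isLiftable_cycleMatrix
  · intro n
    exact AlgEquiv.ext fun R => birRefl_birRefl p n R
  · intro n m hnm h1 h2
    have h3 : n ≠ m - 1 := fun h => h1 (by rw [h]; ring)
    have h4 : m ≠ n - 1 := fun h => h2 (by rw [h]; ring)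
    have e1 := pairing_simpleRoot_simpleCoroot_centre k ℓ n m
    have e2 := pairing_simpleRoot_simpleCoroot_centre k ℓ m n
    simp only [if_neg h1, if_neg h2, if_neg h3, if_neg h4, if_neg hnm, if_neg hnm.symm] at e1 e2
    apply algEquiv_ext_gens
    · intro ν
      simp only [AlgEquiv.mul_apply, birRefl_aRoot, map_mul, map_zpow₀, e1, e2]
      simp only [add_zero, sub_zero, zpow_zero, mul_one]
      ring
    · intro j
      simp only [AlgEquiv.mul_apply, birRefl_fVar, map_mul, map_zpow₀,
        birRefl_mobFactor_of_ne p n m hnm.symm h1 h4, birRefl_mobFactor_of_ne p m n hnm h2 h3]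
      ring
  · intro n
    have h0 : n ≠ n + 1 := (zmod_add_one_ne n).symm
    have h1 : n + 1 ≠ n - 1 := (zmod_sub_one_ne_add_one n).symm
    have h2 : n ≠ n + 1 + 1 := fun h => h1 (by linear_combination -h)
    have e1 := pairing_simpleRoot_simpleCoroot_centre k ℓ n (n + 1)
    have e2 := pairing_simpleRoot_simpleCoroot_centre k ℓ (n + 1) n
    simp only [if_neg h1, if_neg h0, if_neg h2, if_neg h0.symm, add_sub_cancel_right,
      if_true] at e1 e2
    have ha := aRoot_ne_zero (centre k ℓ n)
    have ha' := aRoot_ne_zero (centre k ℓ (n + 1))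
    apply algEquiv_ext_gens
    · intro ν
      simp only [AlgEquiv.mul_apply, birRefl_aRoot, map_mul, map_zpow₀, e1, e2,
        pairing_simpleRoot_self]
      generalize pairing k ℓ (simpleRoot k ℓ ν) (simpleCoroot k ℓ (centre k ℓ n)) = i
      generalize pairing k ℓ (simpleRoot k ℓ ν) (simpleCoroot k ℓ (centre k ℓ (n + 1))) = j
      generalize aRoot k ℓ (centre k ℓ n) = z at *
      generalize aRoot k ℓ (centre k ℓ (n + 1)) = z' at *
      simp only [zero_add, sub_zero, zpow_one, mul_zpow, ← zpow_mul]
      have e : z ^ (-2 * i) = (z ^ i)⁻¹ * (z ^ i)⁻¹ := by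
        rw [← zpow_neg, ← zpow_add₀ ha]; congr 1; ring
      have e' : z' ^ (-2 * j) = (z' ^ j)⁻¹ * (z' ^ j)⁻¹ := by
        rw [← zpow_neg, ← zpow_add₀ ha']; congr 1; ring
      have := zpow_ne_zero i ha
      have := zpow_ne_zero j ha'
      rw [e, e']
      field_simp
    · intro j
      obtain ⟨b1, b2⟩ := birRefl_mobFactor_braid (k := k) (ℓ := ℓ) p n
      simp only [AlgEquiv.mul_apply, birRefl_fVar, map_mul, map_zpow₀]
      -- With `s = s_n` and `t = s_{n+1}`, both words multiply `f_j` by `s(F_{n+1})` to the power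
      -- `mobExp (n + 1) j` times `t(F_n)` to the power `mobExp n j`.
      have c1 := congrArg (· ^ mobExp n j) b1
      have c2 := congrArg (· ^ mobExp (n + 1) j) b2
      simp only [mul_zpow] at c1 c2
      linear_combination fVar k ℓ j * birRefl k ℓ p n (mobFactor k ℓ p (n + 1)) ^
          mobExp (n + 1) j * c1 -
        fVar k ℓ j * birRefl k ℓ p (n + 1) (mobFactor k ℓ p n) ^ mobExp n j * c2

variable (h1 : ∀ n, k n = 1 ∧ ℓ n = 1)

/-- The birational representation of the Weyl group. -/
def birRep : weylGroup k ℓ →* (FunField k ℓ ≃ₐ[ℂ] FunField k ℓ) :=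
  ((cycleMatrix N).toCoxeterSystem.lift ⟨_, isLiftable_birRefl p⟩).comp
    (coxeterEquiv h1).symm.toMonoidHom

theorem birRep_simpleRefl (n : ZMod N) :
    birRep p h1 (simpleRefl k ℓ (centre k ℓ n)) = birRefl k ℓ p n := by
  have h : (coxeterEquiv h1).symm (simpleRefl k ℓ (centre k ℓ n)) =
      (cycleMatrix N).toCoxeterSystem.simple n := by
    rw [MulEquiv.symm_apply_eq]
    exact (coxeterHom_simple k ℓ n).symm
  change (cycleMatrix N).toCoxeterSystem.lift _ ((coxeterEquiv h1).symm _) = _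
  rw [h]
  exact (cycleMatrix N).toCoxeterSystem.lift_apply_simple (isLiftable_birRefl p) n

include h1 in
-- The generators are involutions, so inverses need no separate case.
theorem weylGroup_induction {P : weylGroup k ℓ → Prop} (one : P 1)
    (mul : ∀ n w, P w → P (simpleRefl k ℓ (centre k ℓ n) * w)) (w : weylGroup k ℓ) : P w := by
  obtain ⟨g, rfl⟩ := coxeterHom_surjective h1 w
  induction g using (cycleMatrix N).toCoxeterSystem.simple_induction_left with
  | one => rw [map_one]; exact one
  | mul_simple_left w i hw => rw [map_mul, coxeterHom_simple]; exact mul _ _ hw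

include h1 in
-- Without arms every factor of `armPos` and `armNeg` is `1` and all exponents equal `p / 2`, so
-- `u_n = v_n = b_n`. The prescribed multiplier is then `F_n`, because `b (f + 1/b) = b f + 1`.
theorem isBirationalReflection_birRefl (n : ZMod N) :
    IsBirationalReflection k ℓ p (centre k ℓ n) (birRefl k ℓ p n) := by
  have hmid : ∀ i : ↥(Finset.Ioo (-((ℓ n : ℕ) : ℤ)) ((k n : ℕ) : ℤ)), (i : ℤ) = 0 := by
    rintro ⟨i, hi⟩
    have h2 := Finset.mem_Ioo.mp hi
    change i = 0
    rw [(h1 n).1, (h1 n).2] at h2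
    simp only [PNat.one_coe, Nat.cast_one] at h2
    omega
  have hpos : armPos k ℓ p n = 1 := Finset.prod_eq_one fun i _ => if_neg (by rw [hmid i]; omega)
  have hneg : armNeg k ℓ p n = 1 := Finset.prod_eq_one fun i _ => if_neg (by rw [hmid i]; omega)
  have hK : ∀ m, powK k ℓ p n m = bVar k ℓ p n := fun m => by
    simp [powK, bVar, (h1 m).1, (h1 m).2]
  have hL : ∀ m, powL k ℓ p n m = bVar k ℓ p n := fun m => by
    simp [powL, bVar, (h1 m).1, (h1 m).2]
  have hb := bVar_ne_zero (k := k) (ℓ := ℓ) p n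
  have hx := fVar_add_bVar_ne_zero (k := k) (ℓ := ℓ) p n
  have hx' := bVar_mul_fVar_add_one_ne_zero (k := k) (ℓ := ℓ) p n
  have hF : mobFactor k ℓ p n = bVar k ℓ p n * ((fVar k ℓ n + 1 / vPar k ℓ p n) /
      (fVar k ℓ n + uPar k ℓ p n)) := by
    rw [vPar, uPar, hpos, hneg, hK, hL, mobFactor]
    field_simp
  refine ⟨birRefl_aRoot p n, fun _ => ⟨?_, ?_, fun m hm hm' => ?_⟩, fun h => absurd rfl h⟩
  · change birRefl k ℓ p n (fVar k ℓ (n - 1)) = powL k ℓ p n (n - 1) * fVar k ℓ (n - 1) * _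
    rw [birRefl_fVar_sub_one, hF, hL]
    change _ = _ * ((fVar k ℓ n + 1 / vPar k ℓ p n) / (fVar k ℓ n + uPar k ℓ p n))
    ring
  · change birRefl k ℓ p n (fVar k ℓ (n + 1)) = (powK k ℓ p n (n + 1))⁻¹ * fVar k ℓ (n + 1) *
      ((fVar k ℓ n + uPar k ℓ p n) / (fVar k ℓ n + 1 / vPar k ℓ p n))
    rw [birRefl_fVar_add_one, hF, hK, mul_inv, inv_div]
    ring
  · exact birRefl_fVar_of_ne p n m hm' hm

/-- The monomial in the root variables attached to an element of the root lattice. -/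
def rootMonomial (Λ : Coh k ℓ) : FunField k ℓ :=
  ∏ n : ZMod N, aRoot k ℓ (centre k ℓ n) ^ Λ (Sum.inl n)

theorem rootMonomial_add (Λ Λ' : Coh k ℓ) :
    rootMonomial (Λ + Λ') = rootMonomial Λ * rootMonomial Λ' := by
  simp only [rootMonomial, Pi.add_apply, zpow_add₀ (aRoot_ne_zero _), Finset.prod_mul_distrib]

theorem rootMonomial_zsmul (x : ℤ) (Λ : Coh k ℓ) :
    rootMonomial (x • Λ) = rootMonomial Λ ^ x := by
  simp only [rootMonomial, Pi.smul_apply, smul_eq_mul, mul_comm x, zpow_mul, Finset.prod_zpow]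

theorem rootMonomial_simpleRoot (n : ZMod N) :
    rootMonomial (simpleRoot k ℓ (centre k ℓ n)) = aRoot k ℓ (centre k ℓ n) := by
  rw [rootMonomial, Finset.prod_eq_single n]
  · simp [simpleRoot_centre, hyp, exc]
  · intro m _ hm
    simp [simpleRoot_centre, hyp, exc, hm]
  · simp

include h1 in
theorem birRefl_rootMonomial (n : ZMod N) (c : Node k ℓ → ℤ) :
    birRefl k ℓ p n (rootMonomial (root k ℓ c)) =
      rootMonomial ((simpleReflection k ℓ (centre k ℓ n)).1 (root k ℓ c)) := by
  rw [simpleReflection_fst, rootMonomial_add, rootMonomial_zsmul, rootMonomial_simpleRoot]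
  have e : pairing k ℓ (root k ℓ c) (simpleCoroot k ℓ (centre k ℓ n)) =
      ∑ m, pairing k ℓ (simpleRoot k ℓ (centre k ℓ m)) (simpleCoroot k ℓ (centre k ℓ n)) *
        c (centre k ℓ m) := by
    rw [root, sum_node h1, map_sum, LinearMap.sum_apply]
    refine Finset.sum_congr rfl fun m _ => ?_
    rw [map_smul, LinearMap.smul_apply, smul_eq_mul, mul_comm]
  have e2 : ∀ s : Finset (ZMod N), ∀ g : ZMod N → ℤ,
      aRoot k ℓ (centre k ℓ n) ^ ∑ m ∈ s, g m = ∏ m ∈ s, aRoot k ℓ (centre k ℓ n) ^ g m :=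
    fun s g => by
      induction s using Finset.cons_induction with
      | empty => simp
      | cons a s ha ih =>
        rw [Finset.sum_cons, Finset.prod_cons, zpow_add₀ (aRoot_ne_zero _), ih]
  rw [e, e2, rootMonomial, ← Finset.prod_mul_distrib, map_prod]
  refine Finset.prod_congr rfl fun m _ => ?_
  rw [map_zpow₀, birRefl_aRoot, mul_zpow, ← zpow_mul, root_inl h1]

/-- The monomial sees only the `H`-coordinates, which determine an element of the root lattice. The
induction therefore needs that `W` maps roots to roots. -/
theorem birRep_rootMonomial (w : weylGroup k ℓ) (c : Node k ℓ → ℤ) :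
    birRep p h1 w (rootMonomial (root k ℓ c)) = rootMonomial (actCoh k ℓ w (root k ℓ c)) := by
  induction w using weylGroup_induction h1 with
  | one => rw [map_one]; rfl
  | mul n w ih =>
    obtain ⟨c', hc, _⟩ := exists_root_weylGroup h1 w.2 c
    rw [map_mul, AlgEquiv.mul_apply, ih, birRep_simpleRefl, actCoh, hc, birRefl_rootMonomial p h1,
      ← hc]
    rfl

/-- On a simple root the terms of Kac's formula containing `⟨α_ν, δ̌⟩ = 0` disappear, so `t_α` adds
the multiple `⟨α_ν, α̌⟩` of `δ`; the monomial of `δ`, raised to the power `p`, is `q`. -/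
theorem birRep_weylTranslation_aVar (c : Node k ℓ → ℤ) (ν : Node k ℓ) :
    birRep p h1 (weylTranslation h1 c) (aVar k ℓ p ν) = aVar k ℓ p ν *
      (∏ μ, aVar k ℓ p μ) ^ pairing k ℓ (simpleRoot k ℓ ν) (coroot k ℓ c) := by
  have h := birRep_rootMonomial p h1 (weylTranslation h1 c) (Pi.single ν 1)
  have e1 : actCoh k ℓ (weylTranslation h1 c) (root k ℓ (Pi.single ν 1)) = simpleRoot k ℓ ν +
      pairing k ℓ (simpleRoot k ℓ ν) (coroot k ℓ c) • delta k ℓ := by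
    change kacCoh k ℓ c _ = _
    rw [kacCoh, pairing_root_deltaCheck h1, root_single]
    module
  rw [e1, rootMonomial_add, rootMonomial_zsmul, root_single, ← node_eq_centre h1 ν,
    rootMonomial_simpleRoot] at h
  have e2 : ∏ μ, aVar k ℓ p μ = rootMonomial (delta k ℓ) ^ p := by
    rw [rootMonomial, ← Finset.prod_pow, ← Equiv.prod_comp (centreEquiv h1)]
    refine Finset.prod_congr rfl fun m _ => ?_
    rw [delta_inl, zpow_one]
    rfl
  rw [← node_eq_centre h1 ν, aVar, map_pow, h, e2, mul_pow, ← zpow_natCast, ← zpow_natCast,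
    ← zpow_natCast, ← zpow_mul, ← zpow_mul]
  congr 2
  exact mul_comm _ _

theorem birRep_weylTranslation_prod_aVar (c : Node k ℓ → ℤ) :
    birRep p h1 (weylTranslation h1 c) (∏ μ, aVar k ℓ p μ) = ∏ μ, aVar k ℓ p μ := by
  have e2 : ∏ μ, aVar k ℓ p μ = rootMonomial (delta k ℓ) ^ p := by
    rw [rootMonomial, ← Finset.prod_pow, ← Equiv.prod_comp (centreEquiv h1)]
    refine Finset.prod_congr rfl fun m _ => ?_
    rw [delta_inl, zpow_one]
    rfl
  rw [e2, map_pow, ← root_one h1, birRep_rootMonomial, actCoh, root_one h1,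
    (weylGroup_delta h1 (weylTranslation h1 c).2).1]

end Representation

/-! ### Units of a subring of a field. -/

section UnitsOfSubring

variable {L : Type*} [Field L]

/-- A unit of a subring of a field. -/
def IsUnitIn (S : Subring L) (r : L) : Prop := r ≠ 0 ∧ r ∈ S ∧ r⁻¹ ∈ S

variable {S : Subring L} {r r' : L}

theorem IsUnitIn.mul (h : IsUnitIn S r) (h' : IsUnitIn S r') : IsUnitIn S (r * r') :=
  ⟨mul_ne_zero h.1 h'.1, mul_mem h.2.1 h'.2.1, by
    rw [mul_inv]; exact mul_mem h.2.2 h'.2.2⟩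

theorem IsUnitIn.inv (h : IsUnitIn S r) : IsUnitIn S r⁻¹ :=
  ⟨inv_ne_zero h.1, h.2.2, by rw [inv_inv]; exact h.2.1⟩

theorem IsUnitIn.div (h : IsUnitIn S r) (h' : IsUnitIn S r') : IsUnitIn S (r / r') := by
  rw [div_eq_mul_inv]; exact h.mul h'.inv

theorem IsUnitIn.one : IsUnitIn S (1 : L) := ⟨one_ne_zero, one_mem S, by simp [one_mem]⟩

theorem IsUnitIn.pow (h : IsUnitIn S r) (n : ℕ) : IsUnitIn S (r ^ n) := by
  induction n with
  | zero => rw [pow_zero]; exact IsUnitIn.one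
  | succ n ih => rw [pow_succ]; exact ih.mul h

theorem IsUnitIn.zpow (h : IsUnitIn S r) (n : ℤ) : IsUnitIn S (r ^ n) := by
  cases n with
  | ofNat n => rw [Int.ofNat_eq_natCast, zpow_natCast]; exact h.pow n
  | negSucc n => rw [zpow_negSucc]; exact (h.pow _).inv

end UnitsOfSubring

/-! ### The multipliers of two successive reflections at adjacent nodes. -/

section BraidUnits

variable {L : Type*} [Field L]

/-- The multiplier of two successive reflections in adjacent vertices, compared with the
transform under the longest element of the rank two group. -/
theorem braid_multiplier (S : Subring L) (s t : L →+* L) {x y a b R : L} (ha : IsUnitIn S a)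
    (hb : IsUnitIn S b) (hx' : a * x + 1 ≠ 0) (hy : y + b ≠ 0)
    (sb : s b = a * b) (sy : s y = y * ((a * x + 1) / (x + a))⁻¹)
    (ty : t y = y) (tb : t b = b⁻¹) (ta : t a = a * b)
    (tx : t x = x * ((b * y + 1) / (y + b)))
    (hbraid : ∀ z, s (t (s z)) = t (s (t z))) (htt : ∀ z, t (t z) = z)
    (h1 : IsUnitIn S (x * (y + b⁻¹) + a * (y + b)))
    (h2 : IsUnitIn S (x * (y + b⁻¹) + (a * b ^ 2)⁻¹ * (y + b)))
    (h3 : IsUnitIn S (x * (y + a ^ 2 * b) + a * (y + b)))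
    (h4 : IsUnitIn S (x * (y + b⁻¹) + a * (y + (a ^ 2 * b)⁻¹))) :
    (IsUnitIn S (t ((a * x + 1) / (x + a))) ∧ IsUnitIn S (s ((b * y + 1) / (y + b)))) ∧
    ∀ A B A' B' : ℤ, s (t (s ((y + b) ^ A * (y + b⁻¹) ^ B * t R))) ∈ S →
      (y + b) ^ (A + (A' + B')) * (y + b⁻¹) ^ B *
        t ((x + a) ^ A' * (x + a⁻¹) ^ B' * s R) ∈ S := by
  have ha0 := ha.1
  have hb0 := hb.1
  have hx'' : x + a⁻¹ ≠ 0 := fun h => hx' (by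
    have : a * (x + a⁻¹) = 0 := by rw [h, mul_zero]
    rwa [mul_add, mul_inv_cancel₀ ha0] at this)
  have r1 := h1.1
  have r2 := h2.1
  have r3 := h3.1
  have r4 := h4.1
  set R1 := x * (y + b⁻¹) + a * (y + b) with hR1
  set R2 := x * (y + b⁻¹) + (a * b ^ 2)⁻¹ * (y + b) with hR2
  set R3 := x * (y + a ^ 2 * b) + a * (y + b) with hR3
  set R4 := x * (y + b⁻¹) + a * (y + (a ^ 2 * b)⁻¹) with hR4
  -- The bilinear forms `R1, …, R4` are, up to constants, the numerators of `t(x + a)`, `t(x +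
  -- a⁻¹)`, `s(y + b)` and `s(y + b⁻¹)`.
  have tp : t (x + a) = b * R1 / (y + b) := by
    rw [map_add, tx, ta, hR1]; field_simp
  have tq : t (x + a⁻¹) = b * R2 / (y + b) := by
    rw [map_add, map_inv₀, tx, ta, hR2]; field_simp
  have hxa : x + a ≠ 0 := fun h => by
    rw [h, map_zero] at tp
    exact div_ne_zero (mul_ne_zero hb0 r1) hy tp.symm
  have sp : s (y + b) = R3 / (a * (x + a⁻¹)) := by
    rw [map_add, sy, sb, hR3]; field_simp; ring
  have sq : s (y + b⁻¹) = R4 / (a * (x + a⁻¹)) := by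
    rw [map_add, map_inv₀, sy, sb, hR4]; field_simp; ring
  have tR3 : t R3 = b * R3 * (y + b⁻¹) / (y + b) := by
    simp only [hR3, map_add, map_mul, map_pow, tx, ty, ta, tb]
    field_simp
  have tR4 : t R4 = b * R4 := by
    simp only [hR4, map_add, map_mul, map_pow, map_inv₀, tx, ty, ta, tb]
    field_simp
  have tsp : t (s (y + b)) = (y + b⁻¹) * (R3 / (a * b * R2)) := by
    rw [sp, map_div₀, map_mul, tR3, tq, ta]
    field_simp
  have tsq : t (s (y + b⁻¹)) = (y + b) * (R4 / (a * b * R2)) := by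
    rw [sq, map_div₀, map_mul, tR4, tq, ta]
    field_simp
  refine ⟨⟨?_, ?_⟩, ?_⟩
  · have e : (a * x + 1) / (x + a) = a * (x + a⁻¹) / (x + a) := by field_simp
    have e2 : t ((a * x + 1) / (x + a)) = a * b * R2 / R1 := by
      rw [e, map_div₀, map_mul, tp, tq, ta]
      field_simp
    rw [e2]
    exact ((ha.mul hb).mul h2).div h1
  · have e : (b * y + 1) / (y + b) = b * (y + b⁻¹) / (y + b) := by field_simp
    have e2 : s ((b * y + 1) / (y + b)) = a * b * R4 / R3 := by
      rw [e, map_div₀, map_mul, sp, sq, sb]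
      field_simp
    rw [e2]
    exact ((ha.mul hb).mul h4).div h3
  · intro A B A' B' hS
    -- The word `sts = tst` preserves `y + b` and `y + b⁻¹` up to units: the first `t` of `tst`
    -- exchanges them, and `ts` exchanges them back.
    have e1 : s (t (s (y + b))) = (y + b) * (R4 / (a * b * R2)) := by
      rw [hbraid, ← tsq, map_add t y b, ty, tb]
    have e2 : s (t (s (y + b⁻¹))) = (y + b⁻¹) * (R3 / (a * b * R2)) := by
      rw [hbraid, ← tsp, map_add t y b⁻¹, map_inv₀, ty, tb, inv_inv]
    have hu : IsUnitIn S ((R4 / (a * b * R2)) ^ A * (R3 / (a * b * R2)) ^ B) :=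
      ((h4.div ((ha.mul hb).mul h2)).zpow A).mul ((h3.div ((ha.mul hb).mul h2)).zpow B)
    have hv : IsUnitIn S ((b * R1) ^ A' * (b * R2) ^ B') :=
      ((hb.mul h1).zpow A').mul ((hb.mul h2).zpow B')
    have e3 : s (t (s ((y + b) ^ A * (y + b⁻¹) ^ B * t R))) =
        ((R4 / (a * b * R2)) ^ A * (R3 / (a * b * R2)) ^ B) *
          ((y + b) ^ A * (y + b⁻¹) ^ B * t (s R)) := by
      simp only [map_mul, map_zpow₀, e1, e2, hbraid (t R), htt, mul_zpow]
      ring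
    -- The extra exponent `A' + B'` clears the denominators `y + b` of `t(x + a)` and `t(x + a⁻¹)`.
    -- What remains differs from `e3` by a unit only, as `sts(t R) = tst(t R) = t(s R)`.
    have e4 : (y + b) ^ (A + (A' + B')) * (y + b⁻¹) ^ B *
        t ((x + a) ^ A' * (x + a⁻¹) ^ B' * s R) = ((b * R1) ^ A' * (b * R2) ^ B') *
          ((y + b) ^ A * (y + b⁻¹) ^ B * t (s R)) := by
      rw [map_mul, map_mul, map_zpow₀, map_zpow₀, tp, tq, div_zpow, div_zpow,
        zpow_add₀ hy, zpow_add₀ hy]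
      have := zpow_ne_zero A' hy
      have := zpow_ne_zero B' hy
      field_simp
    rw [e4]
    refine mul_mem hv.2.1 ?_
    rw [e3] at hS
    have h5 := mul_mem hu.2.2 hS
    rwa [inv_mul_cancel_left₀ hu.1] at h5

end BraidUnits

/-! ### Poles of rational functions along `f_m = -β` and along `f_j = ∞`. -/

section Regularity

variable {ι K : Type*} (L : Type*) [DecidableEq ι] [Field K] [Field L]
  [Algebra (MvPolynomial ι K) L] [IsFractionRing (MvPolynomial ι K) L]

open MvPolynomial

/-- Specialization of the `m`-th variable to `-β`. -/
def specialize (m : ι) (β : K) : MvPolynomial ι K →ₐ[K] MvPolynomial ι K :=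
  aeval (Function.update X m (C (-β)))

omit [DecidableEq ι] in
theorem algebraMap_ne_zero {P : MvPolynomial ι K} (h : P ≠ 0) :
    algebraMap (MvPolynomial ι K) L P ≠ 0 :=
  fun h0 => h (IsFractionRing.injective (MvPolynomial ι K) L (by rw [h0, map_zero]))

theorem specialize_X_add_C (m : ι) (β : K) : specialize m β (X m + C β) = 0 := by
  simp [specialize, MvPolynomial.algHom_C]

theorem dvd_sub_specialize (m : ι) (β : K) (P : MvPolynomial ι K) :
    (X m + C β) ∣ P - specialize m β P := by
  induction P using MvPolynomial.induction_on with
  | C a => simp [specialize, MvPolynomial.algHom_C]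
  | add p q hp hq =>
    rw [map_add, add_sub_add_comm]
    exact dvd_add hp hq
  | mul_X p i hp =>
    have h : (X m + C β : MvPolynomial ι K) ∣ X i - specialize m β (X i) := by
      by_cases hi : i = m
      · subst hi; simp [specialize]
      · simp [specialize, Function.update_of_ne hi]
    rw [map_mul]
    have e : p * X i - specialize m β p * specialize m β (X i) =
      (p - specialize m β p) * X i + specialize m β p * (X i - specialize m β (X i)) := by ring
    rw [e]
    exact dvd_add (hp.mul_right _) (h.mul_left _)

/-- The ring of the rational functions without pole along `f_m = -β`. -/
def regularAt (m : ι) (β : K) : Subring L where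
  carrier := {r | ∃ P Q : MvPolynomial ι K, specialize m β Q ≠ 0 ∧
    r * algebraMap _ L Q = algebraMap _ L P}
  mul_mem' := by
    rintro r r' ⟨P, Q, hQ, h⟩ ⟨P', Q', hQ', h'⟩
    refine ⟨P * P', Q * Q', by rw [map_mul]; exact mul_ne_zero hQ hQ', ?_⟩
    rw [map_mul, map_mul, ← h, ← h']
    ring
  one_mem' := ⟨1, 1, by rw [map_one]; exact one_ne_zero, by simp⟩
  add_mem' := by
    rintro r r' ⟨P, Q, hQ, h⟩ ⟨P', Q', hQ', h'⟩
    refine ⟨P * Q' + P' * Q, Q * Q', by rw [map_mul]; exact mul_ne_zero hQ hQ', ?_⟩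
    rw [map_mul, map_add, map_mul, map_mul, ← h, ← h']
    ring
  zero_mem' := ⟨0, 1, by rw [map_one]; exact one_ne_zero, by simp⟩
  neg_mem' := by
    rintro r ⟨P, Q, hQ, h⟩
    exact ⟨-P, Q, hQ, by rw [map_neg, ← h, neg_mul]⟩

variable {L}

omit [IsFractionRing (MvPolynomial ι K) L] in
theorem algebraMap_mem_regularAt (m : ι) (β : K) (P : MvPolynomial ι K) :
    algebraMap _ L P ∈ regularAt L m β :=
  ⟨P, 1, by rw [map_one]; exact one_ne_zero, by simp⟩

theorem isUnitIn_regularAt {m : ι} {β : K} {P : MvPolynomial ι K} (h : specialize m β P ≠ 0) :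
    IsUnitIn (regularAt L m β) (algebraMap _ L P) := by
  have hP : algebraMap _ L P ≠ 0 := algebraMap_ne_zero L (by rintro rfl; simp at h)
  exact ⟨hP, algebraMap_mem_regularAt m β P, 1, P, h, by simp [hP]⟩

/-- A rational function that is regular along `f_m = -β` and whose only poles are there is a
polynomial. -/
theorem mem_range_of_mul_pow_mem {m : ι} {β : K} {r : L} (hr : r ∈ regularAt L m β) (M : ℕ)
    (h : r * algebraMap (MvPolynomial ι K) L (X m + C β) ^ M ∈
      (algebraMap (MvPolynomial ι K) L).range) : r ∈ (algebraMap (MvPolynomial ι K) L).range := by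
  have hπ : algebraMap (MvPolynomial ι K) L (X m + C β) ≠ 0 := by
    apply algebraMap_ne_zero
    intro h0
    have := congrArg (MvPolynomial.eval (fun _ => 1 - β)) h0
    simp at this
  induction M with
  | zero => simpa using h
  | succ M ih =>
    apply ih
    obtain ⟨T, hT⟩ := h
    obtain ⟨P, Q, hQ, hPQ⟩ := hr
    have h1 : T * Q = P * (X m + C β) ^ (M + 1) := by
      apply IsFractionRing.injective (MvPolynomial ι K) L
      rw [map_mul, map_mul, map_pow, hT, ← hPQ]
      ring
    -- Specializing `T Q = P (f_m + β)^(M + 1)` kills the right side but not `Q`, so `T` vanishes at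
    -- `f_m = -β` and is divisible by `f_m + β`; one power can be cancelled.
    have h2 := congrArg (specialize m β) h1
    rw [map_mul, map_mul, map_pow, specialize_X_add_C, pow_succ, mul_zero, mul_zero] at h2
    have h3 := (mul_eq_zero.mp h2).resolve_right hQ
    have h4 := dvd_sub_specialize m β T
    rw [h3, sub_zero] at h4
    obtain ⟨T', rfl⟩ := h4
    refine ⟨T', ?_⟩
    rw [map_mul, pow_succ] at hT
    apply mul_left_cancel₀ hπ
    rw [hT]
    ring

variable (L)

/-- The ring of the rational functions whose poles are along `W = 0`. -/
def polesAlong (W : MvPolynomial ι K) : Subring L where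
  carrier := {r | ∃ M : ℕ, r * algebraMap _ L W ^ M ∈ (algebraMap (MvPolynomial ι K) L).range}
  mul_mem' := by
    rintro r r' ⟨M, h⟩ ⟨M', h'⟩
    refine ⟨M + M', ?_⟩
    have := mul_mem h h'
    rwa [mul_mul_mul_comm, ← pow_add] at this
  one_mem' := ⟨0, by simp⟩
  add_mem' := by
    rintro r r' ⟨M, h⟩ ⟨M', h'⟩
    have hW : ∀ n, algebraMap _ L W ^ n ∈ (algebraMap (MvPolynomial ι K) L).range :=
      fun n => ⟨W ^ n, map_pow _ _ _⟩
    refine ⟨M + M', ?_⟩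
    have := add_mem (mul_mem h (hW M')) (mul_mem h' (hW M))
    convert this using 1
    ring
  zero_mem' := ⟨0, by simp⟩
  neg_mem' := by
    rintro r ⟨M, h⟩
    refine ⟨M, ?_⟩
    have := neg_mem h
    rwa [← neg_mul] at this

variable {L}

omit [DecidableEq ι] [IsFractionRing (MvPolynomial ι K) L] in
theorem algebraMap_mem_polesAlong (W P : MvPolynomial ι K) :
    algebraMap _ L P ∈ polesAlong L W := ⟨0, by simp⟩

omit [DecidableEq ι] in
theorem isUnitIn_polesAlong {W P Q : MvPolynomial ι K} (hW : W ≠ 0) (h : W = P * Q) :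
    IsUnitIn (polesAlong L W) (algebraMap _ L P) := by
  have hP : algebraMap _ L P ≠ 0 := algebraMap_ne_zero L (by rintro rfl; simp at h; exact hW h)
  refine ⟨hP, algebraMap_mem_polesAlong W P, 1, Q, ?_⟩
  rw [h, map_mul, pow_one, inv_mul_cancel_left₀ hP]

/-- The two factors of the denominator are removed one after the other; multiplication by a power of
one of them keeps regularity along the other. -/
theorem mem_range_of_regular {m : ι} {β β' : K} {r : L} (h : r ∈ regularAt L m β)
    (h' : r ∈ regularAt L m β') (hr : r ∈ polesAlong L ((X m + C β) * (X m + C β'))) :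
    r ∈ (algebraMap (MvPolynomial ι K) L).range := by
  obtain ⟨M, hM⟩ := hr
  apply mem_range_of_mul_pow_mem h' M
  apply mem_range_of_mul_pow_mem (m := m) (β := β) (M := M)
  · exact mul_mem h (pow_mem (algebraMap_mem_regularAt _ _ _) _)
  · rw [map_mul, mul_pow] at hM
    convert hM using 1
    ring

omit [DecidableEq ι] [IsFractionRing (MvPolynomial ι K) L] in
theorem ringHom_algebraMap_mem (S : Subring L) (s : L →+* L)
    (hC : ∀ x : K, s (algebraMap _ L (C x : MvPolynomial ι K)) ∈ S)
    (hX : ∀ i : ι, s (algebraMap _ L (X i : MvPolynomial ι K)) ∈ S) (P : MvPolynomial ι K) :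
    s (algebraMap _ L P) ∈ S := by
  induction P using MvPolynomial.induction_on with
  | C a => exact hC a
  | add p q hp hq => rw [map_add, map_add]; exact add_mem hp hq
  | mul_X p i hp => rw [map_mul, map_mul]; exact mul_mem hp (hX i)

variable (L)

/-- The ring of the rational functions without pole along `f_j = ∞`. -/
def boundedAt (K : Type*) [Field K] [Algebra (MvPolynomial ι K) L] (j : ι) : Subring L where
  carrier := {r | ∃ P Q : MvPolynomial ι K, Q ≠ 0 ∧ r * algebraMap _ L Q = algebraMap _ L P ∧
    P.degreeOf j ≤ Q.degreeOf j}
  mul_mem' := by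
    rintro r r' ⟨P, Q, hQ, h, hd⟩ ⟨P', Q', hQ', h', hd'⟩
    refine ⟨P * P', Q * Q', mul_ne_zero hQ hQ', ?_, ?_⟩
    · rw [map_mul, map_mul, ← h, ← h']
      ring
    · rw [degreeOf_mul_eq hQ hQ']
      exact (degreeOf_mul_le _ _ _).trans (add_le_add hd hd')
  one_mem' := ⟨1, 1, one_ne_zero, by simp, le_rfl⟩
  add_mem' := by
    rintro r r' ⟨P, Q, hQ, h, hd⟩ ⟨P', Q', hQ', h', hd'⟩
    refine ⟨P * Q' + P' * Q, Q * Q', mul_ne_zero hQ hQ', ?_, ?_⟩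
    · rw [map_mul, map_add, map_mul, map_mul, ← h, ← h']
      ring
    · rw [degreeOf_mul_eq hQ hQ']
      refine (degreeOf_add_le _ _ _).trans (max_le ?_ ?_)
      · exact (degreeOf_mul_le _ _ _).trans (by omega)
      · exact (degreeOf_mul_le _ _ _).trans (by omega)
  zero_mem' := ⟨0, 1, one_ne_zero, by simp, by simp⟩
  neg_mem' := by
    rintro r ⟨P, Q, hQ, h, hd⟩
    exact ⟨-P, Q, hQ, by rw [map_neg, ← h, neg_mul], by rwa [degreeOf_neg]⟩

variable {L}

omit [DecidableEq ι] in
theorem div_mem_boundedAt {j : ι} {P Q : MvPolynomial ι K} (hQ : Q ≠ 0)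
    (h : P.degreeOf j ≤ Q.degreeOf j) :
    algebraMap _ L P / algebraMap _ L Q ∈ boundedAt L K j :=
  ⟨P, Q, hQ, div_mul_cancel₀ _ (algebraMap_ne_zero L hQ), h⟩

omit [DecidableEq ι] in
theorem isUnitIn_boundedAt {j : ι} {P Q : MvPolynomial ι K} (hP : P ≠ 0) (hQ : Q ≠ 0)
    (h : P.degreeOf j = Q.degreeOf j) :
    IsUnitIn (boundedAt L K j) (algebraMap _ L P / algebraMap _ L Q) :=
  ⟨div_ne_zero (algebraMap_ne_zero L hP) (algebraMap_ne_zero L hQ), div_mem_boundedAt hQ h.le,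
    by rw [inv_div]; exact div_mem_boundedAt hP h.ge⟩

omit [DecidableEq ι] in
theorem degreeOf_le_of_mem_boundedAt {j : ι} {P : MvPolynomial ι K} (hP : P ≠ 0) {d : ℤ}
    (h : algebraMap _ L P * algebraMap _ L (X j : MvPolynomial ι K) ^ (-d) ∈ boundedAt L K j) :
    (P.degreeOf j : ℤ) ≤ d := by
  obtain ⟨A, B, hB, hAB, hd⟩ := h
  have hX : algebraMap _ L (X j : MvPolynomial ι K) ≠ 0 := algebraMap_ne_zero L (X_ne_zero j)
  -- The bound `d` is a coordinate of a class and might be negative; in that case the power of `f_j`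
  -- is moved to the other side.
  rcases Int.eq_nat_or_neg d with ⟨D, rfl | rfl⟩
  · have h1 : P * B = A * X j ^ D := by
      apply IsFractionRing.injective (MvPolynomial ι K) L
      rw [map_mul, map_mul, map_pow, ← hAB, zpow_neg, zpow_natCast]
      field_simp
    have hA : A ≠ 0 := by
      rintro rfl
      rw [zero_mul] at h1
      exact mul_ne_zero hP hB h1
    have h2 := congrArg (degreeOf j) h1
    rw [degreeOf_mul_eq hP hB, degreeOf_mul_eq hA (pow_ne_zero _ (X_ne_zero j)),
      degreeOf_X_self_pow] at h2
    omega
  · have h1 : P * B * X j ^ D = A := by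
      apply IsFractionRing.injective (MvPolynomial ι K) L
      rw [map_mul, map_mul, map_pow, ← hAB, neg_neg, zpow_natCast]
      ring
    have h2 := congrArg (degreeOf j) h1
    rw [degreeOf_mul_eq (mul_ne_zero hP hB) (pow_ne_zero _ (X_ne_zero j)), degreeOf_mul_eq hP hB,
      degreeOf_X_self_pow] at h2
    omega

omit [DecidableEq ι] in
-- Each monomial is multiplied by a product of bounded functions and its own degree in `f_j` is at
-- most that of `P`, so the order of the pole along `f_j = ∞` does not grow.
theorem ringHom_mul_zpow_mem_boundedAt (j : ι) (s : L →+* L) (τ : K → K) (u : ι → L)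
    (hC : ∀ x : K, s (algebraMap _ L (C x : MvPolynomial ι K)) =
      algebraMap _ L (C (τ x) : MvPolynomial ι K))
    (hX : ∀ i : ι, s (algebraMap _ L (X i : MvPolynomial ι K)) =
      algebraMap _ L (X i : MvPolynomial ι K) * u i)
    (hu : ∀ i, u i ∈ boundedAt L K j) (P : MvPolynomial ι K) :
    s (algebraMap _ L P) / algebraMap _ L (X j ^ P.degreeOf j : MvPolynomial ι K) ∈
      boundedAt L K j := by
  have hD : (X j ^ P.degreeOf j : MvPolynomial ι K) ≠ 0 := pow_ne_zero _ (X_ne_zero j)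
  set D := P.degreeOf j with hDdef
  have hsum : s (algebraMap _ L P) =
      ∑ e ∈ P.support, s (algebraMap _ L (monomial e (coeff e P))) := by
    conv_lhs => rw [P.as_sum, map_sum, map_sum]
  rw [hsum, Finset.sum_div]
  refine sum_mem fun e he => ?_
  have h1 : s (algebraMap _ L (monomial e (coeff e P))) =
      algebraMap _ L (monomial e (τ (coeff e P))) * e.prod fun i k => u i ^ k := by
    rw [monomial_eq, monomial_eq, map_mul, map_mul, map_mul, hC, Finsupp.prod, map_prod, map_prod,
      mul_assoc, Finsupp.prod, ← Finset.prod_mul_distrib]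
    congr 1
    refine Finset.prod_congr rfl fun i _ => ?_
    rw [map_pow, map_pow, hX, mul_pow]
  rw [h1, mul_div_right_comm]
  refine mul_mem (div_mem_boundedAt hD ?_) (prod_mem fun i _ => pow_mem (hu i) _)
  rw [degreeOf_X_self_pow]
  -- Here `τ` is an arbitrary function, so a nonzero coefficient may be sent to zero.
  by_cases h0 : τ (coeff e P) = 0
  · rw [h0, monomial_zero, degreeOf_zero]; exact Nat.zero_le _
  · rw [degreeOf_monomial_eq _ _ h0]
    exact monomial_le_degreeOf j he

end Regularity

/-! ### Effect of a single birational reflection on poles. -/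

section Degree

open MvPolynomial

variable {N : ℕ} {k ℓ : ZMod N → ℕ+} (p : ℕ)

/-- The subring of polynomials in the coordinates. -/
def polys (k ℓ : ZMod N → ℕ+) : Subring (FunField k ℓ) :=
  (algebraMap (MvPolynomial (ZMod N) (CoefField k ℓ)) (FunField k ℓ)).range

theorem fVar_eq (n : ZMod N) :
    fVar k ℓ n = algebraMap (MvPolynomial (ZMod N) (CoefField k ℓ)) (FunField k ℓ) (X n) := rfl

theorem fVar_ne_zero (n : ZMod N) : fVar k ℓ n ≠ 0 := algebraMap_ne_zero _ (X_ne_zero n)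

theorem fVar_add_coef (n : ZMod N) (γ : CoefField k ℓ) :
    fVar k ℓ n + algebraMap _ _ γ =
      algebraMap (MvPolynomial (ZMod N) (CoefField k ℓ)) (FunField k ℓ) (X n + C γ) := by
  rw [map_add]; rfl

theorem X_add_C_ne_zero (n : ZMod N) (γ : CoefField k ℓ) :
    (X n + C γ : MvPolynomial (ZMod N) (CoefField k ℓ)) ≠ 0 := by
  intro h0
  have := congrArg (MvPolynomial.eval (fun _ => 1 - γ)) h0
  simp at this

theorem isUnitIn_regularAt_fVar_add (m n : ZMod N) (h : n ≠ m) (β γ : CoefField k ℓ) :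
    IsUnitIn (regularAt (FunField k ℓ) m β) (fVar k ℓ n + algebraMap _ _ γ) := by
  rw [fVar_add_coef]
  apply isUnitIn_regularAt
  have : specialize m β (X n + C γ) = X n + C γ := by
    simp [specialize, MvPolynomial.algHom_C, Function.update_of_ne h]
  rw [this]
  exact X_add_C_ne_zero n γ

/-- On `f_m = -β` the form becomes `(γ - β) f_n + c (γ' - β)`, whose two coefficients cannot both
vanish because `γ ≠ γ'`. -/
theorem isUnitIn_regularAt_bilinear (m n : ZMod N) (h : n ≠ m) (β : CoefField k ℓ)
    {c γ γ' : CoefField k ℓ} (hc : c ≠ 0) (hγ : γ ≠ γ') :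
    IsUnitIn (regularAt (FunField k ℓ) m β)
      (fVar k ℓ n * (fVar k ℓ m + algebraMap _ _ γ) +
        algebraMap _ _ c * (fVar k ℓ m + algebraMap _ _ γ')) := by
  have e : fVar k ℓ n * (fVar k ℓ m + algebraMap _ _ γ) +
        algebraMap _ _ c * (fVar k ℓ m + algebraMap _ _ γ') =
      algebraMap (MvPolynomial (ZMod N) (CoefField k ℓ)) (FunField k ℓ)
        (X n * (X m + C γ) + C c * (X m + C γ')) := by
    rw [fVar_add_coef, fVar_add_coef, fVar_eq, algebraMap_coef, ← map_mul, ← map_mul, ← map_add]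
  rw [e]
  apply isUnitIn_regularAt
  have e2 : specialize m β (X n * (X m + C γ) + C c * (X m + C γ')) =
      X n * (C (-β) + C γ) + C c * (C (-β) + C γ') := by
    simp [specialize, MvPolynomial.algHom_C, Function.update_of_ne h]
  rw [e2]
  intro h0
  have h1 := congrArg (MvPolynomial.eval (fun _ => 0)) h0
  have h2 := congrArg (MvPolynomial.eval (fun _ => 1)) h0
  simp only [map_add, map_mul, eval_X, eval_C, map_zero, zero_mul, zero_add, one_mul] at h1 h2
  rw [h1, add_zero] at h2
  have h3 := (mul_eq_zero.mp h1).resolve_left hc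
  apply hγ
  linear_combination h2 - h3

/-- The coordinate shifted by `u_n`. -/
def pShift (k ℓ : ZMod N → ℕ+) (p : ℕ) (n : ZMod N) : FunField k ℓ := fVar k ℓ n + bVar k ℓ p n

/-- The coordinate shifted by `1 / v_n`. -/
def qShift (k ℓ : ZMod N → ℕ+) (p : ℕ) (n : ZMod N) : FunField k ℓ :=
  fVar k ℓ n + (bVar k ℓ p n)⁻¹

theorem bVar_inv_eq (n : ZMod N) :
    (bVar k ℓ p n)⁻¹ = algebraMap (CoefField k ℓ) (FunField k ℓ) (bCoef k ℓ p n)⁻¹ := by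
  rw [map_inv₀, ← bVar_eq]

theorem pShift_eq (n : ZMod N) : pShift k ℓ p n =
    algebraMap (MvPolynomial (ZMod N) (CoefField k ℓ)) (FunField k ℓ)
      (X n + C (bCoef k ℓ p n)) := by
  rw [pShift, bVar_eq, fVar_add_coef]

theorem qShift_eq (n : ZMod N) : qShift k ℓ p n =
    algebraMap (MvPolynomial (ZMod N) (CoefField k ℓ)) (FunField k ℓ)
      (X n + C (bCoef k ℓ p n)⁻¹) := by
  rw [qShift, bVar_inv_eq, fVar_add_coef]

theorem pShift_ne_zero (n : ZMod N) : pShift k ℓ p n ≠ 0 := by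
  rw [pShift_eq]; exact algebraMap_ne_zero _ (X_add_C_ne_zero n _)

theorem qShift_ne_zero (n : ZMod N) : qShift k ℓ p n ≠ 0 := by
  rw [qShift_eq]; exact algebraMap_ne_zero _ (X_add_C_ne_zero n _)

theorem mobFactor_eq (n : ZMod N) :
    mobFactor k ℓ p n = bVar k ℓ p n * (qShift k ℓ p n / pShift k ℓ p n) := by
  have h := bVar_ne_zero (k := k) (ℓ := ℓ) p n
  rw [mobFactor, qShift, pShift]
  field_simp

theorem mobFactor_inv_eq (n : ZMod N) : (mobFactor k ℓ p n)⁻¹ =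
    ((bVar k ℓ p n)⁻¹ * fVar k ℓ n + 1) / (fVar k ℓ n + (bVar k ℓ p n)⁻¹) := by
  have h := bVar_ne_zero (k := k) (ℓ := ℓ) p n
  have h2 := pShift_ne_zero (k := k) (ℓ := ℓ) p n
  have h3 := qShift_ne_zero (k := k) (ℓ := ℓ) p n
  rw [mobFactor_eq]
  rw [qShift] at h3 ⊢
  rw [pShift] at h2 ⊢
  field_simp

theorem isUnitIn_coef (S : Subring (FunField k ℓ))
    (hS : ∀ x : CoefField k ℓ, algebraMap (CoefField k ℓ) (FunField k ℓ) x ∈ S)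
    {x : CoefField k ℓ} (hx : x ≠ 0) : IsUnitIn S (algebraMap (CoefField k ℓ) (FunField k ℓ) x) :=
  ⟨(map_ne_zero _).mpr hx, hS x, by rw [← map_inv₀]; exact hS _⟩

theorem isUnitIn_bVar (S : Subring (FunField k ℓ))
    (hS : ∀ x : CoefField k ℓ, algebraMap (CoefField k ℓ) (FunField k ℓ) x ∈ S) (n : ZMod N) :
    IsUnitIn S (bVar k ℓ p n) := by
  rw [bVar_eq]
  exact isUnitIn_coef S hS (bCoef_ne_zero p n)

/-- The divisor of the poles of the reflection attached to `(n, 0)`. -/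
def poleDivisor (k ℓ : ZMod N → ℕ+) (p : ℕ) (n : ZMod N) : MvPolynomial (ZMod N) (CoefField k ℓ) :=
  (X n + C (bCoef k ℓ p n)) * (X n + C (bCoef k ℓ p n)⁻¹)

theorem poleDivisor_ne_zero (n : ZMod N) : poleDivisor k ℓ p n ≠ 0 :=
  mul_ne_zero (X_add_C_ne_zero n _) (X_add_C_ne_zero n _)

theorem isUnitIn_polesAlong_pShift (n : ZMod N) :
    IsUnitIn (polesAlong (FunField k ℓ) (poleDivisor k ℓ p n)) (pShift k ℓ p n) := by
  rw [pShift_eq]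
  exact isUnitIn_polesAlong (poleDivisor_ne_zero p n) rfl

theorem isUnitIn_polesAlong_qShift (n : ZMod N) :
    IsUnitIn (polesAlong (FunField k ℓ) (poleDivisor k ℓ p n)) (qShift k ℓ p n) := by
  rw [qShift_eq]
  exact isUnitIn_polesAlong (poleDivisor_ne_zero p n) (mul_comm _ _)

theorem degreeOf_X_add_C (n j : ZMod N) (γ : CoefField k ℓ) :
    degreeOf j (X n + C γ) = if j = n then 1 else 0 := by
  split_ifs with h
  · subst h
    rw [degreeOf_add_eq_of_degreeOf_lt, degreeOf_X_self]
    rw [degreeOf_C, degreeOf_X_self]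
    exact one_pos
  · refine Nat.le_zero.mp ((degreeOf_add_le _ _ _).trans ?_)
    rw [degreeOf_X_of_ne h, degreeOf_C, max_self]

variable [Fact (3 ≤ N)]

theorem birRefl_pShift_self (n : ZMod N) :
    birRefl k ℓ p n (pShift k ℓ p n) = qShift k ℓ p n := by
  rw [pShift, map_add, birRefl_fVar_self, birRefl_bVar_self, qShift]

theorem birRefl_qShift_self (n : ZMod N) :
    birRefl k ℓ p n (qShift k ℓ p n) = pShift k ℓ p n := by
  rw [← birRefl_pShift_self, birRefl_birRefl]

omit [Fact (3 ≤ N)] in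
/-- Membership of the images of polynomials in a subring containing the constants. -/
theorem algEquiv_algebraMap_mem (S : Subring (FunField k ℓ))
    (hS : ∀ x : CoefField k ℓ, algebraMap (CoefField k ℓ) (FunField k ℓ) x ∈ S)
    (σ : FunField k ℓ ≃ₐ[ℂ] FunField k ℓ)
    (hσ : ∀ x : CoefField k ℓ, σ (algebraMap (CoefField k ℓ) (FunField k ℓ) x) ∈
      (algebraMap (CoefField k ℓ) (FunField k ℓ)).range)
    (hX : ∀ j, σ (fVar k ℓ j) ∈ S) {R : FunField k ℓ} (hR : R ∈ polys k ℓ) : σ R ∈ S := by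
  obtain ⟨P, rfl⟩ := hR
  exact ringHom_algebraMap_mem S σ.toAlgHom.toRingHom
    (fun x => by
      obtain ⟨y, hy⟩ := hσ x
      change σ (algebraMap (CoefField k ℓ) (FunField k ℓ) x) ∈ S
      rw [← hy]
      exact hS y) hX P

theorem birRefl_coef_mem (n : ZMod N) {z : FunField k ℓ}
    (hz : z ∈ (algebraMap (CoefField k ℓ) (FunField k ℓ)).range) :
    birRefl k ℓ p n z ∈ (algebraMap (CoefField k ℓ) (FunField k ℓ)).range := by
  obtain ⟨x, rfl⟩ := hz
  obtain ⟨τ, hτ⟩ := birRefl_coef (k := k) (ℓ := ℓ) p n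
  exact ⟨τ x, (hτ x).symm⟩

theorem birRefl_mem_polesAlong (n : ZMod N) {R : FunField k ℓ} (hR : R ∈ polys k ℓ) :
    birRefl k ℓ p n R ∈ polesAlong (FunField k ℓ) (poleDivisor k ℓ p n) := by
  have hS : ∀ x : CoefField k ℓ, algebraMap (CoefField k ℓ) (FunField k ℓ) x ∈
      polesAlong (FunField k ℓ) (poleDivisor k ℓ p n) := fun x => algebraMap_mem_polesAlong _ (C x)
  refine algEquiv_algebraMap_mem _ hS _ (fun x => birRefl_coef_mem p n ⟨x, rfl⟩) (fun j => ?_) hR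
  rw [birRefl_fVar]
  refine mul_mem (algebraMap_mem_polesAlong _ _) (IsUnitIn.zpow ?_ _).2.1
  rw [mobFactor_eq]
  exact (isUnitIn_bVar p _ hS n).mul
    ((isUnitIn_polesAlong_qShift p n).div (isUnitIn_polesAlong_pShift p n))

omit [Fact (3 ≤ N)] in
theorem coef_mem_regularAt (m : ZMod N) (β x : CoefField k ℓ) :
    algebraMap (CoefField k ℓ) (FunField k ℓ) x ∈ regularAt (FunField k ℓ) m β :=
  algebraMap_mem_regularAt m β (C x)

/-- The reflections away from `m` preserve regularity along `f_m = -β`. -/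
theorem birRefl_mem_regularAt (n m : ZMod N) (h : n ≠ m) (β : CoefField k ℓ) {R : FunField k ℓ}
    (hR : R ∈ polys k ℓ) : birRefl k ℓ p n R ∈ regularAt (FunField k ℓ) m β := by
  refine algEquiv_algebraMap_mem _ (coef_mem_regularAt m β) _
    (fun x => birRefl_coef_mem p n ⟨x, rfl⟩) (fun j => ?_) hR
  rw [birRefl_fVar]
  refine mul_mem (algebraMap_mem_regularAt m β _) (IsUnitIn.zpow ?_ _).2.1
  rw [mobFactor_eq, pShift, qShift, bVar_inv_eq]
  exact (isUnitIn_bVar p _ (coef_mem_regularAt m β) n).mul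
    ((isUnitIn_regularAt_fVar_add m n h β _).div (by
      rw [bVar_eq]; exact isUnitIn_regularAt_fVar_add m n h β _))

/-- After cancellation by the cocycle identity, the triple word multiplies each `f_j` by powers of
`s_n(F_m)` and `s_m(F_n)`. These are units along `f_m = -β`, unlike `F_m` itself for special `β`. -/
theorem birRefl_triple_mem_regularAt (n m : ZMod N) (β : CoefField k ℓ)
    (hF : mobFactor k ℓ p n * birRefl k ℓ p n (birRefl k ℓ p m (mobFactor k ℓ p n)) =
      birRefl k ℓ p m (mobFactor k ℓ p n))
    (h1 : IsUnitIn (regularAt (FunField k ℓ) m β) (birRefl k ℓ p m (mobFactor k ℓ p n)))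
    (h2 : IsUnitIn (regularAt (FunField k ℓ) m β) (birRefl k ℓ p n (mobFactor k ℓ p m)))
    {R : FunField k ℓ} (hR : R ∈ polys k ℓ) :
    birRefl k ℓ p n (birRefl k ℓ p m (birRefl k ℓ p n R)) ∈ regularAt (FunField k ℓ) m β := by
  refine algEquiv_algebraMap_mem _ (coef_mem_regularAt m β)
    (birRefl k ℓ p n * (birRefl k ℓ p m * birRefl k ℓ p n))
    (fun x => birRefl_coef_mem p n (birRefl_coef_mem p m (birRefl_coef_mem p n ⟨x, rfl⟩)))
    (fun j => ?_) hR
  have e : (birRefl k ℓ p n * (birRefl k ℓ p m * birRefl k ℓ p n)) (fVar k ℓ j) =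
      fVar k ℓ j * (birRefl k ℓ p n (mobFactor k ℓ p m) ^ mobExp m j *
        birRefl k ℓ p m (mobFactor k ℓ p n) ^ mobExp n j) := by
    have hF' := congrArg (· ^ mobExp n j) hF
    simp only [mul_zpow] at hF'
    simp only [AlgEquiv.mul_apply, birRefl_fVar, map_mul, map_zpow₀]
    rw [← hF']
    ring
  rw [e]
  exact mul_mem (algebraMap_mem_regularAt m β _) ((h2.zpow _).mul (h1.zpow _)).2.1

theorem birRefl_comm (n m : ZMod N) (h : n ≠ m) (h1 : m ≠ n + 1) (h2 : n ≠ m + 1)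
    (R : FunField k ℓ) :
    birRefl k ℓ p n (birRefl k ℓ p m R) = birRefl k ℓ p m (birRefl k ℓ p n R) := by
  have hM : cycleMatrix N n m = 2 := by
    rw [cycleMatrix_apply, if_neg h, if_neg (not_or.mpr ⟨h1, h2⟩)]
  have e := congrArg ((cycleMatrix N).toCoxeterSystem.lift
    ⟨_, isLiftable_birRefl (k := k) (ℓ := ℓ) p⟩)
    ((cycleMatrix N).toCoxeterSystem.simple_comm_of_eq_two hM)
  simp only [map_mul, CoxeterSystem.lift_apply_simple] at e
  exact DFunLike.congr_fun e R

theorem birRefl_braid (n m : ZMod N) (h : n ≠ m) (h1 : m = n + 1 ∨ n = m + 1)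
    (R : FunField k ℓ) :
    birRefl k ℓ p n (birRefl k ℓ p m (birRefl k ℓ p n R)) =
      birRefl k ℓ p m (birRefl k ℓ p n (birRefl k ℓ p m R)) := by
  have hM : cycleMatrix N n m = 3 := by
    rw [cycleMatrix_apply, if_neg h, if_pos h1]
  have e := congrArg ((cycleMatrix N).toCoxeterSystem.lift
    ⟨_, isLiftable_birRefl (k := k) (ℓ := ℓ) p⟩)
    ((cycleMatrix N).toCoxeterSystem.simple_braid_of_eq_three hM)
  simp only [map_mul, CoxeterSystem.lift_apply_simple] at e
  exact DFunLike.congr_fun e R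

end Degree

/-! ### Admissible polynomials and the degree bound. -/

section DegreeStep

open MvPolynomial

variable {N : ℕ} [Fact (3 ≤ N)] {k ℓ : ZMod N → ℕ+} {p : ℕ}

/-- The word `s_n s_{n+1} s_n` maps the polynomial of the hypothesis to a function regular along
`f_{n+1} = -β`. By the braid relation, that function is the required one up to a unit. -/
theorem birRefl_add_one_multiplier (hp : 0 < p) (h2p : 2 ∣ p) (n : ZMod N) (β : CoefField k ℓ)
    (R : FunField k ℓ) (A B A' B' : ℤ)
    (hR : pShift k ℓ p (n + 1) ^ A * qShift k ℓ p (n + 1) ^ B * birRefl k ℓ p (n + 1) R ∈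
      polys k ℓ) :
    pShift k ℓ p (n + 1) ^ (A + (A' + B')) * qShift k ℓ p (n + 1) ^ B *
      birRefl k ℓ p (n + 1) (pShift k ℓ p n ^ A' * qShift k ℓ p n ^ B' * birRefl k ℓ p n R) ∈
        regularAt (FunField k ℓ) (n + 1) β := by
  have hne : n ≠ n + 1 := (zmod_add_one_ne n).symm
  have e1 := birRefl_bVar_sub_one (k := k) (ℓ := ℓ) p (n + 1)
  have e2 := birRefl_fVar_sub_one (k := k) (ℓ := ℓ) p (n + 1)
  rw [add_sub_cancel_right] at e1 e2
  have ha0 := bCoef_ne_zero (k := k) (ℓ := ℓ) p n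
  have hb0 := bCoef_ne_zero (k := k) (ℓ := ℓ) p (n + 1)
  have ha1 := bCoef_sq_ne_one (k := k) (ℓ := ℓ) hp h2p n
  have hb1 := bCoef_sq_ne_one (k := k) (ℓ := ℓ) hp h2p (n + 1)
  set a := bCoef k ℓ p n with ha
  set b := bCoef k ℓ p (n + 1) with hb
  have hbb : b⁻¹ ≠ b := fun h => hb1 (by
    rw [pow_two]; nth_rw 1 [← h]; exact inv_mul_cancel₀ hb0)
  have h3 : a ^ 2 * b ≠ b := fun h => ha1 (mul_right_cancel₀ hb0 (h.trans (one_mul b).symm))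
  have h4 : b⁻¹ ≠ (a ^ 2 * b)⁻¹ := fun h => h3 (inv_injective h).symm
  obtain ⟨⟨u1, u2⟩, key⟩ := braid_multiplier (R := R) (regularAt (FunField k ℓ) (n + 1) β)
    (birRefl k ℓ p n).toAlgHom.toRingHom (birRefl k ℓ p (n + 1)).toAlgHom.toRingHom
    (x := fVar k ℓ n) (y := fVar k ℓ (n + 1)) (a := bVar k ℓ p n) (b := bVar k ℓ p (n + 1))
    (isUnitIn_bVar p _ (coef_mem_regularAt _ β) n)
    (isUnitIn_bVar p _ (coef_mem_regularAt _ β) (n + 1))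
    (bVar_mul_fVar_add_one_ne_zero p n) (fVar_add_bVar_ne_zero p (n + 1))
    (birRefl_bVar_add_one p n) (birRefl_fVar_add_one p n)
    (birRefl_fVar_self p (n + 1)) (birRefl_bVar_self p (n + 1)) (e1.trans (mul_comm _ _)) e2
    (birRefl_braid p n (n + 1) hne (Or.inl rfl)) (birRefl_birRefl p (n + 1))
    (by
      have := isUnitIn_regularAt_bilinear (n + 1) n hne β ha0 hbb
      rwa [map_inv₀, hb, ← bVar_eq, ha, ← bVar_eq] at this)
    (by
      have := isUnitIn_regularAt_bilinear (n + 1) n hne β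
        (inv_ne_zero (mul_ne_zero ha0 (pow_ne_zero 2 hb0))) hbb
      rwa [map_inv₀, map_inv₀, map_mul, map_pow, hb, ← bVar_eq, ha, ← bVar_eq] at this)
    (by
      have := isUnitIn_regularAt_bilinear (n + 1) n hne β ha0 h3
      rwa [map_mul, map_pow, ha, hb, ← bVar_eq, ← bVar_eq] at this)
    (by
      have := isUnitIn_regularAt_bilinear (n + 1) n hne β ha0 h4
      rwa [map_inv₀, map_inv₀, map_mul, map_pow, hb, ← bVar_eq, ha, ← bVar_eq] at this)
  exact key A B A' B' (birRefl_triple_mem_regularAt p n (n + 1) β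
    (birRefl_mobFactor_braid p n).1 u1 u2 hR)

/-- Replacing `b_n` and `b_{n-1}` by their inverses inverts the factors `F` and exchanges the two
shifts. The formulas for the neighbour `n - 1` then take the form of those for `n + 1`, and
`braid_multiplier` applies again. -/
theorem birRefl_sub_one_multiplier (hp : 0 < p) (h2p : 2 ∣ p) (n : ZMod N) (β : CoefField k ℓ)
    (R : FunField k ℓ) (A B A' B' : ℤ)
    (hR : pShift k ℓ p (n - 1) ^ A * qShift k ℓ p (n - 1) ^ B * birRefl k ℓ p (n - 1) R ∈
      polys k ℓ) :
    pShift k ℓ p (n - 1) ^ A * qShift k ℓ p (n - 1) ^ (B + (A' + B')) *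
      birRefl k ℓ p (n - 1) (pShift k ℓ p n ^ A' * qShift k ℓ p n ^ B' * birRefl k ℓ p n R) ∈
        regularAt (FunField k ℓ) (n - 1) β := by
  have hne : n ≠ n - 1 := (zmod_sub_one_ne n).symm
  have e1 := birRefl_bVar_add_one (k := k) (ℓ := ℓ) p (n - 1)
  have e2 := birRefl_fVar_add_one (k := k) (ℓ := ℓ) p (n - 1)
  have e3 := birRefl_fVar_sub_one (k := k) (ℓ := ℓ) p n
  rw [sub_add_cancel] at e1 e2
  rw [mobFactor_inv_eq] at e2
  rw [← inv_inv (mobFactor k ℓ p n), mobFactor_inv_eq] at e3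
  have ha0 := inv_ne_zero (bCoef_ne_zero (k := k) (ℓ := ℓ) p n)
  have hb0 := inv_ne_zero (bCoef_ne_zero (k := k) (ℓ := ℓ) p (n - 1))
  have ha1 := bCoef_sq_ne_one (k := k) (ℓ := ℓ) hp h2p n
  have hb1 := bCoef_sq_ne_one (k := k) (ℓ := ℓ) hp h2p (n - 1)
  rw [← inv_ne_one, ← inv_pow] at ha1 hb1
  set a := (bCoef k ℓ p n)⁻¹ with ha
  set b := (bCoef k ℓ p (n - 1))⁻¹ with hb
  have hbb : b⁻¹ ≠ b := fun h => hb1 (by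
    rw [pow_two]; nth_rw 1 [← h]; exact inv_mul_cancel₀ hb0)
  have h3 : a ^ 2 * b ≠ b := fun h => ha1 (mul_right_cancel₀ hb0 (h.trans (one_mul b).symm))
  have h4 : b⁻¹ ≠ (a ^ 2 * b)⁻¹ := fun h => h3 (inv_injective h).symm
  have hqn := qShift_ne_zero (k := k) (ℓ := ℓ) p (n - 1)
  have hpn := pShift_ne_zero (k := k) (ℓ := ℓ) p n
  have hb0' := bVar_ne_zero (k := k) (ℓ := ℓ) p n
  obtain ⟨⟨u1, u2⟩, key⟩ := braid_multiplier (R := R) (regularAt (FunField k ℓ) (n - 1) β)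
    (birRefl k ℓ p n).toAlgHom.toRingHom (birRefl k ℓ p (n - 1)).toAlgHom.toRingHom
    (x := fVar k ℓ n) (y := fVar k ℓ (n - 1)) (a := (bVar k ℓ p n)⁻¹)
    (b := (bVar k ℓ p (n - 1))⁻¹)
    (isUnitIn_bVar p _ (coef_mem_regularAt _ β) n).inv
    (isUnitIn_bVar p _ (coef_mem_regularAt _ β) (n - 1)).inv
    (by
      intro h
      apply hpn
      have : bVar k ℓ p n * ((bVar k ℓ p n)⁻¹ * fVar k ℓ n + 1) = 0 := by rw [h, mul_zero]
      rwa [mul_add, mul_inv_cancel_left₀ hb0', mul_one] at this)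
    hqn
    (by
      change birRefl k ℓ p n _ = _
      rw [map_inv₀, birRefl_bVar_sub_one, mul_inv])
    e3 (birRefl_fVar_self p (n - 1))
    (by
      change birRefl k ℓ p (n - 1) _ = _
      rw [map_inv₀, birRefl_bVar_self])
    (by
      change birRefl k ℓ p (n - 1) _ = _
      rw [map_inv₀, e1, mul_inv, mul_comm])
    e2
    (birRefl_braid p n (n - 1) hne (Or.inr (sub_add_cancel n 1).symm)) (birRefl_birRefl p (n - 1))
    (by
      have := isUnitIn_regularAt_bilinear (n - 1) n hne β ha0 hbb
      rwa [map_inv₀, hb, ← bVar_inv_eq, ha, ← bVar_inv_eq] at this)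
    (by
      have := isUnitIn_regularAt_bilinear (n - 1) n hne β
        (inv_ne_zero (mul_ne_zero ha0 (pow_ne_zero 2 hb0))) hbb
      rwa [map_inv₀ _ b, map_inv₀ _ (a * b ^ 2), map_mul, map_pow, hb, ← bVar_inv_eq, ha,
        ← bVar_inv_eq] at this)
    (by
      have := isUnitIn_regularAt_bilinear (n - 1) n hne β ha0 h3
      rwa [map_mul, map_pow, ha, hb, ← bVar_inv_eq, ← bVar_inv_eq] at this)
    (by
      have := isUnitIn_regularAt_bilinear (n - 1) n hne β ha0 h4
      rwa [map_inv₀ _ b, map_inv₀ _ (a ^ 2 * b), map_mul, map_pow, hb, ← bVar_inv_eq, ha,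
        ← bVar_inv_eq] at this)
  have u1' : IsUnitIn (regularAt (FunField k ℓ) (n - 1) β)
      (birRefl k ℓ p (n - 1) (mobFactor k ℓ p n)) := by
    rw [← mobFactor_inv_eq] at u1
    have := u1.inv
    rwa [← map_inv₀, inv_inv] at this
  have u2' : IsUnitIn (regularAt (FunField k ℓ) (n - 1) β)
      (birRefl k ℓ p n (mobFactor k ℓ p (n - 1))) := by
    rw [← mobFactor_inv_eq] at u2
    have := u2.inv
    rwa [← map_inv₀, inv_inv] at this
  have hF := (birRefl_mobFactor_braid (k := k) (ℓ := ℓ) p (n - 1)).2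
  rw [sub_add_cancel] at hF
  have hS := birRefl_triple_mem_regularAt p n (n - 1) β hF u1' u2' hR
  -- The exponents are passed in exchanged order, since inverting the parameters turns `pShift` into
  -- `qShift`.
  have h5 := key B A B' A' (by
    rw [inv_inv, mul_comm ((fVar k ℓ (n - 1) + (bVar k ℓ p (n - 1))⁻¹) ^ B)]
    exact hS)
  rw [inv_inv, inv_inv, mul_comm ((fVar k ℓ (n - 1) + (bVar k ℓ p (n - 1))⁻¹) ^ _),
    mul_comm ((fVar k ℓ n + (bVar k ℓ p n)⁻¹) ^ _), add_comm B' A'] at h5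
  exact h5

/-- The exponent of `f_n + u_n` in the multiplier of `s_n^0`. -/
def expP (Λ : Coh k ℓ) (n : ZMod N) : ℤ := Λ (Sum.inl (n - 1)) + Λ (Sum.inr (excNeg k ℓ n))

/-- The exponent of `f_n + 1 / v_n` in the multiplier of `s_n^0`. -/
def expQ (Λ : Coh k ℓ) (n : ZMod N) : ℤ := Λ (Sum.inl (n + 1)) + Λ (Sum.inr (excPos k ℓ n))

theorem simpleReflection_inl (n j : ZMod N) (Λ : Coh k ℓ) :
    (simpleReflection k ℓ (centre k ℓ n)).1 Λ (Sum.inl j) =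
      Λ (Sum.inl j) + if j = n then expP Λ n + expQ Λ n else 0 := by
  rw [simpleReflection_fst, pairing_simpleCoroot_centre, simpleRoot_centre, expP, expQ]
  simp only [Pi.add_apply, Pi.smul_apply, Pi.sub_apply, hyp, exc, smul_eq_mul]
  split_ifs <;> ring

theorem expP_simpleReflection (n m : ZMod N) (Λ : Coh k ℓ) :
    expP ((simpleReflection k ℓ (centre k ℓ n)).1 Λ) m = expP Λ m +
      (if m - 1 = n then expP Λ n + expQ Λ n else 0) -
        if m = n then expP Λ n + expQ Λ n else 0 := by
  have h : (simpleReflection k ℓ (centre k ℓ n)).1 Λ (Sum.inr (excNeg k ℓ m)) =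
      Λ (Sum.inr (excNeg k ℓ m)) - if m = n then expP Λ n + expQ Λ n else 0 := by
    rw [simpleReflection_fst, pairing_simpleCoroot_centre, simpleRoot_centre, expP, expQ]
    by_cases h : m = n
    · subst h
      simp [hyp, exc, excNeg]
      ring
    · simp [hyp, exc, excNeg, h]
  rw [expP, simpleReflection_inl, h, expP, expP]
  ring

theorem expQ_simpleReflection (n m : ZMod N) (Λ : Coh k ℓ) :
    expQ ((simpleReflection k ℓ (centre k ℓ n)).1 Λ) m = expQ Λ m +
      (if m + 1 = n then expP Λ n + expQ Λ n else 0) -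
        if m = n then expP Λ n + expQ Λ n else 0 := by
  have h : (simpleReflection k ℓ (centre k ℓ n)).1 Λ (Sum.inr (excPos k ℓ m)) =
      Λ (Sum.inr (excPos k ℓ m)) - if m = n then expP Λ n + expQ Λ n else 0 := by
    rw [simpleReflection_fst, pairing_simpleCoroot_centre, simpleRoot_centre, expP, expQ]
    by_cases h : m = n
    · subst h
      simp [hyp, exc, excPos]
      ring
    · simp [hyp, exc, excPos, h]
  rw [expQ, simpleReflection_inl, h, expQ, expQ]
  ring

/-- The reflection attached to `(n, 0)`, twisted by the multiplier belonging to the class `Λ`. -/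
def twistedRefl (p : ℕ) (n : ZMod N) (Λ : Coh k ℓ) (R : FunField k ℓ) : FunField k ℓ :=
  pShift k ℓ p n ^ expP Λ n * qShift k ℓ p n ^ expQ Λ n * birRefl k ℓ p n R

/-- The nonzero polynomials of degree `≤ Λ(h_j)` in `f_j` which satisfy the vanishing conditions
of the class `Λ`; these say that all the twisted reflections are polynomials. -/
def Admissible (p : ℕ) (Λ : Coh k ℓ) (R : FunField k ℓ) : Prop :=
  (∃ P : MvPolynomial (ZMod N) (CoefField k ℓ), R = algebraMap _ _ P ∧ P ≠ 0 ∧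
    ∀ j, (degreeOf j P : ℤ) ≤ Λ (Sum.inl j)) ∧ ∀ n, twistedRefl p n Λ R ∈ polys k ℓ

/-- The reflection exchanges the shifts at `n`, while `s_n Λ` has exponents `-expQ Λ n` and `-expP Λ
n`; hence the two multipliers cancel. -/
theorem twistedRefl_twistedRefl (n : ZMod N) (Λ : Coh k ℓ) (R : FunField k ℓ) :
    twistedRefl p n ((simpleReflection k ℓ (centre k ℓ n)).1 Λ) (twistedRefl p n Λ R) = R := by
  have hp := pShift_ne_zero (k := k) (ℓ := ℓ) p n
  have hq := qShift_ne_zero (k := k) (ℓ := ℓ) p n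
  rw [twistedRefl, expP_simpleReflection, expQ_simpleReflection, if_pos rfl,
    if_neg (zmod_sub_one_ne n), if_neg (zmod_add_one_ne n), twistedRefl, map_mul, map_mul,
    map_zpow₀, map_zpow₀, birRefl_pShift_self, birRefl_qShift_self, birRefl_birRefl]
  have e1 : expP Λ n + 0 - (expP Λ n + expQ Λ n) = -expQ Λ n := by ring
  have e2 : expQ Λ n + 0 - (expP Λ n + expQ Λ n) = -expP Λ n := by ring
  rw [e1, e2, zpow_neg, zpow_neg]
  have := zpow_ne_zero (expQ Λ n) hp
  have := zpow_ne_zero (expP Λ n) hq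
  field_simp

theorem twistedRefl_mem_polesAlong (n : ZMod N) (Λ : Coh k ℓ) {R : FunField k ℓ}
    (hR : R ∈ polys k ℓ) :
    twistedRefl p n Λ R ∈ polesAlong (FunField k ℓ) (poleDivisor k ℓ p n) :=
  mul_mem (mul_mem ((isUnitIn_polesAlong_pShift p n).zpow _).2.1
    ((isUnitIn_polesAlong_qShift p n).zpow _).2.1) (birRefl_mem_polesAlong p n hR)

/-- A twisted reflection preserves the vanishing conditions. -/
theorem twistedRefl_twistedRefl_mem (hp : 0 < p) (h2p : 2 ∣ p) (n m : ZMod N) (Λ : Coh k ℓ)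
    {R : FunField k ℓ} (hR : R ∈ polys k ℓ) (h : ∀ n, twistedRefl p n Λ R ∈ polys k ℓ) :
    twistedRefl p m ((simpleReflection k ℓ (centre k ℓ n)).1 Λ) (twistedRefl p n Λ R) ∈
      polys k ℓ := by
  by_cases hmn : m = n
  · subst hmn
    rw [twistedRefl_twistedRefl]
    exact hR
  -- Since `s_m` is applied to a polynomial, poles can only occur along `f_m = -b_m` and `f_m =
  -- -1/b_m`. Regularity along those two divisors is enough.
  suffices hreg : ∀ β, twistedRefl p m ((simpleReflection k ℓ (centre k ℓ n)).1 Λ)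
      (twistedRefl p n Λ R) ∈ regularAt (FunField k ℓ) m β from
    mem_range_of_regular (hreg _) (hreg _) (twistedRefl_mem_polesAlong m _ (h n))
  intro β
  rw [twistedRefl, expP_simpleReflection, expQ_simpleReflection, if_neg hmn, sub_zero,
    sub_zero]
  by_cases h1 : m - 1 = n
  · obtain rfl : m = n + 1 := by rw [← h1]; ring
    have h2 : n + 1 + 1 ≠ n := fun h => zmod_sub_one_ne_add_one n (by linear_combination -h)
    rw [if_pos h1, if_neg h2, add_zero]
    exact birRefl_add_one_multiplier hp h2p n β R _ _ _ _ (h (n + 1))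
  by_cases h2 : m + 1 = n
  · obtain rfl : m = n - 1 := by rw [← h2]; ring
    rw [if_neg h1, if_pos h2, add_zero]
    exact birRefl_sub_one_multiplier hp h2p n β R _ _ _ _ (h (n - 1))
  have h1' : m ≠ n + 1 := fun h => h1 (by rw [h]; ring)
  have h2' : m ≠ n - 1 := fun h => h2 (by rw [h]; ring)
  have h3 : n ≠ m + 1 := fun h => h2 h.symm
  have h4 : n ≠ m - 1 := fun h => h1 h.symm
  rw [if_neg h1, if_neg h2, add_zero, add_zero]
  -- For nodes that are not adjacent the two twisted reflections commute, and `s_n` as well as its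
  -- multiplier creates no pole along `f_m = -β`.
  have e : pShift k ℓ p m ^ expP Λ m * qShift k ℓ p m ^ expQ Λ m *
      birRefl k ℓ p m (twistedRefl p n Λ R) = (pShift k ℓ p n ^ expP Λ n *
        qShift k ℓ p n ^ expQ Λ n) * birRefl k ℓ p n (twistedRefl p m Λ R) := by
    simp only [twistedRefl, map_mul, map_zpow₀, pShift, qShift, map_add, map_inv₀,
      birRefl_fVar_of_ne p m n h3 h4, birRefl_fVar_of_ne p n m h1' h2',
      birRefl_bVar_of_ne p m n (Ne.symm hmn) h3 h4, birRefl_bVar_of_ne p n m hmn h1' h2',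
      birRefl_comm p m n hmn h3 h1']
    ring
  rw [e]
  refine mul_mem (mul_mem (IsUnitIn.zpow ?_ _).2.1 (IsUnitIn.zpow ?_ _).2.1)
    (birRefl_mem_regularAt p n m (Ne.symm hmn) β (h m))
  · rw [pShift, bVar_eq]; exact isUnitIn_regularAt_fVar_add m n (Ne.symm hmn) β _
  · rw [qShift, bVar_inv_eq]; exact isUnitIn_regularAt_fVar_add m n (Ne.symm hmn) β _

omit [Fact (3 ≤ N)] in
theorem coef_mem_boundedAt (j : ZMod N) (x : CoefField k ℓ) :
    algebraMap (CoefField k ℓ) (FunField k ℓ) x ∈ boundedAt (FunField k ℓ) (CoefField k ℓ) j := by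
  have := div_mem_boundedAt (L := FunField k ℓ) (j := j) (P := C x) (Q := 1) one_ne_zero (by simp)
  rwa [map_one, div_one] at this

omit [Fact (3 ≤ N)] in
theorem isUnitIn_boundedAt_mobFactor (n j : ZMod N) :
    IsUnitIn (boundedAt (FunField k ℓ) (CoefField k ℓ) j) (mobFactor k ℓ p n) := by
  rw [mobFactor_eq, pShift_eq, qShift_eq]
  exact (isUnitIn_bVar p _ (coef_mem_boundedAt j) n).mul
    (isUnitIn_boundedAt (X_add_C_ne_zero n _) (X_add_C_ne_zero n _)
      (by rw [degreeOf_X_add_C, degreeOf_X_add_C]))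

omit [Fact (3 ≤ N)] in
theorem isUnitIn_boundedAt_shift_of_ne (n j : ZMod N) (h : j ≠ n) (γ : CoefField k ℓ) :
    IsUnitIn (boundedAt (FunField k ℓ) (CoefField k ℓ) j)
      (algebraMap (MvPolynomial (ZMod N) (CoefField k ℓ)) (FunField k ℓ) (X n + C γ)) := by
  have := isUnitIn_boundedAt (L := FunField k ℓ) (j := j) (X_add_C_ne_zero n γ) one_ne_zero
    (by rw [degreeOf_X_add_C, if_neg h, degreeOf_one])
  rwa [map_one, div_one] at this

omit [Fact (3 ≤ N)] in
theorem isUnitIn_boundedAt_shift_div (n : ZMod N) (γ : CoefField k ℓ) :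
    IsUnitIn (boundedAt (FunField k ℓ) (CoefField k ℓ) n)
      (algebraMap (MvPolynomial (ZMod N) (CoefField k ℓ)) (FunField k ℓ) (X n + C γ) /
        fVar k ℓ n) :=
  isUnitIn_boundedAt (X_add_C_ne_zero n γ) (X_ne_zero n)
    (by rw [degreeOf_X_add_C, if_pos rfl, degreeOf_X_self])

theorem birRefl_mem_boundedAt (n j : ZMod N) (P : MvPolynomial (ZMod N) (CoefField k ℓ)) {d : ℤ}
    (hd : (degreeOf j P : ℤ) ≤ d) :
    birRefl k ℓ p n (algebraMap _ _ P) * fVar k ℓ j ^ (-d) ∈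
      boundedAt (FunField k ℓ) (CoefField k ℓ) j := by
  obtain ⟨τ, hτ⟩ := birRefl_coef (k := k) (ℓ := ℓ) p n
  have h1 := ringHom_mul_zpow_mem_boundedAt (L := FunField k ℓ) j
    (birRefl k ℓ p n).toAlgHom.toRingHom τ (fun i => mobFactor k ℓ p n ^ mobExp n i)
    (fun x => hτ x) (birRefl_fVar p n)
    (fun i => ((isUnitIn_boundedAt_mobFactor n j).zpow _).2.1) P
  obtain ⟨e, he⟩ := Int.le.dest hd
  have hf := fVar_ne_zero (k := k) (ℓ := ℓ) j
  have h2 : (fVar k ℓ j)⁻¹ ∈ boundedAt (FunField k ℓ) (CoefField k ℓ) j := by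
    have := div_mem_boundedAt (L := FunField k ℓ) (j := j) (P := (1 : MvPolynomial (ZMod N)
      (CoefField k ℓ))) (Q := X j) (X_ne_zero j) (by simp)
    rwa [map_one, one_div] at this
  have h3 := mul_mem h1 (pow_mem h2 e)
  have e3 : birRefl k ℓ p n (algebraMap _ _ P) * fVar k ℓ j ^ (-d) =
      birRefl k ℓ p n (algebraMap _ _ P) /
        algebraMap _ _ (X j ^ degreeOf j P : MvPolynomial (ZMod N) (CoefField k ℓ)) *
          (fVar k ℓ j)⁻¹ ^ e := by
    rw [← he, neg_add, zpow_add₀ hf, zpow_neg, zpow_neg, zpow_natCast, zpow_natCast, map_pow,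
      inv_pow, div_eq_mul_inv, mul_assoc, fVar]
  rw [e3]
  exact h3

/-- The factor `F_n` is a unit along `f_j = ∞`, so the reflection alone keeps the bound. The
multiplier changes it only for `j = n`, by `expP Λ n + expQ Λ n = ⟨Λ, α̌_n⟩`, which is the change of
the `H_n`-coordinate under `s_n`. -/
theorem degreeOf_twistedRefl_le (n j : ZMod N) (Λ : Coh k ℓ)
    (P P' : MvPolynomial (ZMod N) (CoefField k ℓ)) (hP' : P' ≠ 0)
    (hd : (degreeOf j P : ℤ) ≤ Λ (Sum.inl j))
    (h : twistedRefl p n Λ (algebraMap _ _ P) = algebraMap _ _ P') :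
    (degreeOf j P' : ℤ) ≤ (simpleReflection k ℓ (centre k ℓ n)).1 Λ (Sum.inl j) := by
  apply degreeOf_le_of_mem_boundedAt (L := FunField k ℓ) hP'
  have h1 := birRefl_mem_boundedAt (p := p) n j P hd
  have hf := fVar_ne_zero (k := k) (ℓ := ℓ) j
  rw [simpleReflection_inl, ← h, ← fVar_eq, twistedRefl]
  by_cases hj : j = n
  · subst hj
    rw [if_pos rfl]
    have e : pShift k ℓ p j ^ expP Λ j * qShift k ℓ p j ^ expQ Λ j *
        birRefl k ℓ p j (algebraMap _ _ P) *
          fVar k ℓ j ^ (-(Λ (Sum.inl j) + (expP Λ j + expQ Λ j))) =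
        ((pShift k ℓ p j / fVar k ℓ j) ^ expP Λ j * (qShift k ℓ p j / fVar k ℓ j) ^ expQ Λ j) *
          (birRefl k ℓ p j (algebraMap _ _ P) * fVar k ℓ j ^ (-Λ (Sum.inl j))) := by
      rw [neg_add, neg_add, zpow_add₀ hf, zpow_add₀ hf, div_zpow, div_zpow, zpow_neg _ (expP Λ j),
        zpow_neg _ (expQ Λ j)]
      ring
    rw [e]
    refine mul_mem (mul_mem (IsUnitIn.zpow ?_ _).2.1 (IsUnitIn.zpow ?_ _).2.1) h1
    · rw [pShift_eq]; exact isUnitIn_boundedAt_shift_div j _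
    · rw [qShift_eq]; exact isUnitIn_boundedAt_shift_div j _
  · rw [if_neg hj, add_zero, mul_assoc]
    refine mul_mem (mul_mem (IsUnitIn.zpow ?_ _).2.1 (IsUnitIn.zpow ?_ _).2.1) h1
    · rw [pShift_eq]; exact isUnitIn_boundedAt_shift_of_ne n j hj _
    · rw [qShift_eq]; exact isUnitIn_boundedAt_shift_of_ne n j hj _

theorem Admissible.twistedRefl (hp : 0 < p) (h2p : 2 ∣ p) {Λ : Coh k ℓ} {R : FunField k ℓ}
    (h : Admissible p Λ R) (n : ZMod N) :
    Admissible p ((simpleReflection k ℓ (centre k ℓ n)).1 Λ) (twistedRefl p n Λ R) := by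
  obtain ⟨⟨P, rfl, hP, hd⟩, hpoly⟩ := h
  obtain ⟨P', hP'⟩ := hpoly n
  have hne : P' ≠ 0 := by
    rintro rfl
    rw [map_zero, TropicalWeyl.twistedRefl] at hP'
    refine mul_ne_zero (mul_ne_zero (zpow_ne_zero _ (pShift_ne_zero p n))
      (zpow_ne_zero _ (qShift_ne_zero p n))) ?_ hP'.symm
    rw [Ne, EmbeddingLike.map_eq_zero_iff]
    exact algebraMap_ne_zero _ hP
  exact ⟨⟨P', hP'.symm, hne, fun j => degreeOf_twistedRefl_le n j Λ P P' hne (hd j) hP'.symm⟩,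
    fun m => twistedRefl_twistedRefl_mem hp h2p n m Λ ⟨P, rfl⟩ hpoly⟩

omit [Fact (3 ≤ N)] in
theorem expP_hyp (i n : ZMod N) : expP (hyp k ℓ i) n = if n - 1 = i then 1 else 0 := by
  simp [expP, hyp]

omit [Fact (3 ≤ N)] in
theorem expQ_hyp (i n : ZMod N) : expQ (hyp k ℓ i) n = if n + 1 = i then 1 else 0 := by
  simp [expQ, hyp]

theorem admissible_hyp_one (i : ZMod N) : Admissible p (hyp k ℓ i) 1 := by
  refine ⟨⟨1, (map_one _).symm, one_ne_zero, fun j => ?_⟩, fun n => ?_⟩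
  · rw [degreeOf_one, hyp]
    split_ifs <;> simp
  · have h1 : pShift k ℓ p n ∈ polys k ℓ := by rw [pShift_eq]; exact ⟨_, rfl⟩
    have h2 : qShift k ℓ p n ∈ polys k ℓ := by rw [qShift_eq]; exact ⟨_, rfl⟩
    rw [twistedRefl, map_one, mul_one, expP_hyp, expQ_hyp]
    refine mul_mem ?_ ?_
    · split_ifs <;> simp [h1, one_mem]
    · split_ifs <;> simp [h2, one_mem]

/-- For `H_i` the multiplier is `f_n + u_n` if `i = n - 1` and `f_n + 1/v_n` if `i = n + 1`:
precisely the denominators of `s_n(f_i)`. -/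
theorem admissible_hyp_fVar (i : ZMod N) : Admissible p (hyp k ℓ i) (fVar k ℓ i) := by
  refine ⟨⟨X i, rfl, X_ne_zero i, fun j => ?_⟩, fun n => ?_⟩
  · rw [degreeOf_X, hyp]
    split_ifs <;> simp_all
  · have h1 : pShift k ℓ p n ∈ polys k ℓ := by rw [pShift_eq]; exact ⟨_, rfl⟩
    have h2 : qShift k ℓ p n ∈ polys k ℓ := by rw [qShift_eq]; exact ⟨_, rfl⟩
    have h3 : fVar k ℓ i ∈ polys k ℓ := ⟨_, rfl⟩
    have hp := pShift_ne_zero (k := k) (ℓ := ℓ) p n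
    have hq := qShift_ne_zero (k := k) (ℓ := ℓ) p n
    have hb := bVar_ne_zero (k := k) (ℓ := ℓ) p n
    have hC : ∀ x : CoefField k ℓ, algebraMap _ _ x ∈ polys k ℓ := fun x => ⟨C x, rfl⟩
    rw [twistedRefl, expP_hyp, expQ_hyp]
    by_cases e1 : n - 1 = i
    · subst e1
      rw [if_pos rfl, if_neg (zmod_sub_one_ne_add_one n).symm, birRefl_fVar_sub_one, mobFactor_eq]
      have e : pShift k ℓ p n ^ (1 : ℤ) * qShift k ℓ p n ^ (0 : ℤ) * (fVar k ℓ (n - 1) *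
          (bVar k ℓ p n * (qShift k ℓ p n / pShift k ℓ p n))) =
          fVar k ℓ (n - 1) * (bVar k ℓ p n * qShift k ℓ p n) := by
        rw [zpow_one, zpow_zero]
        field_simp
      rw [e, bVar_eq]
      exact mul_mem h3 (mul_mem (hC _) h2)
    by_cases e2 : n + 1 = i
    · subst e2
      rw [if_pos rfl, if_neg (zmod_sub_one_ne_add_one n), birRefl_fVar_add_one, mobFactor_eq]
      have e : pShift k ℓ p n ^ (0 : ℤ) * qShift k ℓ p n ^ (1 : ℤ) * (fVar k ℓ (n + 1) *
          (bVar k ℓ p n * (qShift k ℓ p n / pShift k ℓ p n))⁻¹) =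
          fVar k ℓ (n + 1) * ((bVar k ℓ p n)⁻¹ * pShift k ℓ p n) := by
        rw [zpow_one, zpow_zero]
        field_simp
      rw [e, bVar_inv_eq]
      exact mul_mem h3 (mul_mem (hC _) h1)
    · rw [if_neg e1, if_neg e2, birRefl_fVar_of_ne p n i (Ne.symm e2) (Ne.symm e1)]
      simpa using h3

/-- The elements of the Weyl group transport admissible polynomials, up to a common factor. -/
theorem exists_admissible_birRep (hp : 0 < p) (h2p : 2 ∣ p) (h1 : ∀ n, k n = 1 ∧ ℓ n = 1)
    (w : weylGroup k ℓ) (Λ : Coh k ℓ) : ∃ G : FunField k ℓ, ∀ R, Admissible p Λ R →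
      Admissible p (actCoh k ℓ w Λ) (G * birRep p h1 w R) := by
  induction w using weylGroup_induction h1 with
  | one =>
    refine ⟨1, fun R hR => ?_⟩
    rw [one_mul, map_one]
    exact hR
  | mul n w ih =>
    obtain ⟨G, hG⟩ := ih
    refine ⟨pShift k ℓ p n ^ expP (actCoh k ℓ w Λ) n * qShift k ℓ p n ^ expQ (actCoh k ℓ w Λ) n *
      birRefl k ℓ p n G, fun R hR => ?_⟩
    have h := (hG R hR).twistedRefl hp h2p n
    rw [twistedRefl, map_mul, ← mul_assoc] at h
    rw [map_mul, birRep_simpleRefl]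
    exact h

/-- The degree bound. -/
theorem degIn_birRep_le (hp : 0 < p) (h2p : 2 ∣ p) (h1 : ∀ n, k n = 1 ∧ ℓ n = 1)
    (w : weylGroup k ℓ) (i j : ZMod N) :
    (degIn k ℓ j (birRep p h1 w (fVar k ℓ i)) : ℤ) ≤
      pairing k ℓ (actCoh k ℓ w (hyp k ℓ i)) (hyp k ℓ j) := by
  -- The common factor `G` does not depend on the polynomial, so it cancels from the quotient `P /
  -- Q` of the images of `f_i` and `1`.
  obtain ⟨G, hG⟩ := exists_admissible_birRep (p := p) hp h2p h1 w (hyp k ℓ i)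
  obtain ⟨⟨P, hP, hP0, hPd⟩, _⟩ := hG _ (admissible_hyp_fVar i)
  obtain ⟨⟨Q, hQ, hQ0, hQd⟩, _⟩ := hG _ (admissible_hyp_one i)
  rw [map_one, mul_one] at hQ
  rw [pairing_hyp]
  set r := birRep p h1 w (fVar k ℓ i) with hr
  set num := IsFractionRing.num (MvPolynomial (ZMod N) (CoefField k ℓ)) r with hnum
  set den : MvPolynomial (ZMod N) (CoefField k ℓ) :=
    (IsFractionRing.den (MvPolynomial (ZMod N) (CoefField k ℓ)) r).1 with hden
  have hden0 : den ≠ 0 := nonZeroDivisors.coe_ne_zero _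
  have hrel : IsRelPrime num den := IsFractionRing.num_den_reduced _ r
  have hfrac : algebraMap _ (FunField k ℓ) num / algebraMap _ _ den = r :=
    IsFractionRing.mk'_num_den' _ r
  have hmul : P * den = num * Q := by
    apply IsFractionRing.injective (MvPolynomial (ZMod N) (CoefField k ℓ)) (FunField k ℓ)
    have hd := algebraMap_ne_zero (FunField k ℓ) hden0
    rw [map_mul, map_mul, ← hP, ← hQ, ← hfrac]
    field_simp
  -- Lowest terms divide any other representation as a fraction, so passing to them does not raise
  -- the degrees.
  have hdvd1 : num ∣ P := hrel.dvd_of_dvd_mul_right (hmul ▸ dvd_mul_right _ _)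
  have hdvd2 : den ∣ Q := hrel.symm.dvd_of_dvd_mul_left (hmul ▸ dvd_mul_left _ _)
  have hle : ∀ {A B : MvPolynomial (ZMod N) (CoefField k ℓ)}, B ≠ 0 → A ∣ B →
      degreeOf j A ≤ degreeOf j B := by
    rintro A _ hB ⟨T, rfl⟩
    rw [degreeOf_mul_eq (left_ne_zero_of_mul hB) (right_ne_zero_of_mul hB)]
    exact Nat.le_add_right _ _
  have l1 := hle hP0 hdvd1
  have l2 := hle hQ0 hdvd2
  have l3 := hPd j
  have l4 := hQd j
  have e : degIn k ℓ j r = max (degreeOf j num) (degreeOf j den) := rfl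
  rw [e]
  push_cast
  exact max_le (by omega) (by omega)

end DegreeStep

/-! ### Quadratic growth from Kac's formula. -/

section Growth

variable {N : ℕ} [Fact (3 ≤ N)] {k ℓ : ZMod N → ℕ+}

theorem kacCoh_nsmul (h1 : ∀ n, k n = 1 ∧ ℓ n = 1) (c : Node k ℓ → ℤ) (n : ℕ) (Λ : Coh k ℓ) :
    kacCoh k ℓ (n • c) Λ =
      Λ - ((n : ℤ) * pairing k ℓ Λ (deltaCheck k ℓ)) • root k ℓ c
        + ((n : ℤ) * pairing k ℓ Λ (coroot k ℓ c)
            - (n : ℤ) ^ 2 * halfNorm k ℓ c * pairing k ℓ Λ (deltaCheck k ℓ)) • delta k ℓ := by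
  rw [← natCast_zsmul, kacCoh, root_zsmul, coroot_zsmul, halfNorm_zsmul h1, map_smul, smul_eq_mul]
  module

/-- A quadratic polynomial in `n` is at most of order `n²`. -/
theorem abs_quadratic_le (x y z : ℤ) {n : ℕ} (hn : 1 ≤ n) :
    |x + n * y + (n : ℤ) ^ 2 * z| ≤ (|x| + |y| + |z|) * (n : ℤ) ^ 2 := by
  have hn' : (1 : ℤ) ≤ n := by exact_mod_cast hn
  have hx : |x| ≤ |x| * (n : ℤ) ^ 2 := le_mul_of_one_le_right (abs_nonneg x) (by nlinarith)
  have hy : |(n : ℤ) * y| ≤ |y| * (n : ℤ) ^ 2 := by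
    rw [abs_mul, mul_comm, abs_of_nonneg (by omega : (0 : ℤ) ≤ n)]
    exact mul_le_mul_of_nonneg_left (by nlinarith) (abs_nonneg y)
  have hz : |(n : ℤ) ^ 2 * z| = |z| * (n : ℤ) ^ 2 := by
    rw [abs_mul, mul_comm, abs_of_nonneg (by positivity : (0 : ℤ) ≤ (n : ℤ) ^ 2)]
  have := abs_add_three x (n * y) ((n : ℤ) ^ 2 * z)
  linarith

theorem exists_abs_pairing_kacCoh_nsmul_le (h1 : ∀ n, k n = 1 ∧ ℓ n = 1) (c : Node k ℓ → ℤ) :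
    ∃ C : ℕ, ∀ n : ℕ, 1 ≤ n → ∀ i j,
      |pairing k ℓ (kacCoh k ℓ (n • c) (hyp k ℓ i)) (hyp k ℓ j)| ≤ (C : ℤ) * (n : ℤ) ^ 2 := by
  set x : ZMod N → ZMod N → ℤ := fun i j => pairing k ℓ (hyp k ℓ i) (hyp k ℓ j)
  set y : ZMod N → ZMod N → ℤ := fun i j =>
    pairing k ℓ (hyp k ℓ i) (coroot k ℓ c) * pairing k ℓ (delta k ℓ) (hyp k ℓ j) -
      pairing k ℓ (hyp k ℓ i) (deltaCheck k ℓ) * pairing k ℓ (root k ℓ c) (hyp k ℓ j)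
  set z : ZMod N → ZMod N → ℤ := fun i j =>
    -(halfNorm k ℓ c * pairing k ℓ (hyp k ℓ i) (deltaCheck k ℓ) *
      pairing k ℓ (delta k ℓ) (hyp k ℓ j))
  obtain ⟨C, hC⟩ := (Set.finite_range fun a : ZMod N × ZMod N =>
    |x a.1 a.2| + |y a.1 a.2| + |z a.1 a.2|).bddAbove
  refine ⟨C.toNat, fun n hn i j => ?_⟩
  have e : pairing k ℓ (kacCoh k ℓ (n • c) (hyp k ℓ i)) (hyp k ℓ j) =
      x i j + n * y i j + (n : ℤ) ^ 2 * z i j := by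
    rw [kacCoh_nsmul h1]
    simp only [map_add, map_sub, map_smul, LinearMap.add_apply, LinearMap.sub_apply,
      LinearMap.smul_apply, smul_eq_mul, x, y, z]
    ring
  rw [e]
  refine (abs_quadratic_le _ _ _ hn).trans (mul_le_mul_of_nonneg_right ?_ (by positivity))
  exact (hC ⟨(i, j), rfl⟩).trans (Int.self_le_toNat C)

end Growth

end

end TropicalWeyl

/-! ### The theorem. -/

open TropicalWeyl in
theorem mainTheorem4 (N : ℕ) [Fact (3 ≤ N)] (k ℓ : ZMod N → ℕ+)
    (haff : IsAffineType (cartanMatrix k ℓ))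
    (p : ℕ) (hp : 0 < p) (hdvd : ∀ n, (k n + ℓ n : ℕ) ∣ p) :
    -- `W` leaves the pairing, `δ` and `δ̌` invariant
    (∀ w : weylGroup k ℓ,
      (∀ Λ l, pairing k ℓ (actCoh k ℓ w Λ) (actHom k ℓ w l) = pairing k ℓ Λ l) ∧
      actCoh k ℓ w (delta k ℓ) = delta k ℓ ∧
      actHom k ℓ w (deltaCheck k ℓ) = deltaCheck k ℓ) ∧
    (∀ c, 2 ∣ pairing k ℓ (root k ℓ c) (coroot k ℓ c)) ∧
    -- the marks `d` of the null root `δ`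
    ∃ d : Node k ℓ → ℤ, (∀ ν, 0 < d ν) ∧
      root k ℓ d = delta k ℓ ∧ coroot k ℓ d = deltaCheck k ℓ ∧
    -- the translations `t_α`, `α = ∑ c_ν α_ν ∈ Q`, as elements of `W`
    ∃ t : (Node k ℓ → ℤ) → weylGroup k ℓ,
      (∀ c Λ, actCoh k ℓ (t c) Λ = kacCoh k ℓ c Λ) ∧
      (∀ c l, actHom k ℓ (t c) l = kacHom k ℓ c l) ∧
      (∀ c c', t c * t c' = t (c + c') ∧ t c * t c' = t c' * t c) ∧
      -- they make up the lattice part of `W`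
      (∃ T : Subgroup (weylGroup k ℓ), (T : Set (weylGroup k ℓ)) = Set.range t ∧ T.Normal ∧
        ∃ ν₀ : Node k ℓ, Subgroup.IsComplement' T
          (Subgroup.closure (simpleRefl k ℓ '' {ν | ν ≠ ν₀}))) ∧
    -- the birational representation of `W` over `𝕂(f)`
    ∃ ρ : weylGroup k ℓ →* (FunField k ℓ ≃ₐ[ℂ] FunField k ℓ),
      (∀ ν, IsBirationalReflection k ℓ p ν (ρ (simpleRefl k ℓ ν))) ∧
      -- commuting time evolutions of `q`-difference type
      (∀ c c' R, ρ (t c) (ρ (t c') R) = ρ (t (c + c')) R ∧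
        ρ (t c) (ρ (t c') R) = ρ (t c') (ρ (t c) R)) ∧
      (∀ c ν, ρ (t c) (aVar k ℓ p ν) = aVar k ℓ p ν *
        (∏ μ, aVar k ℓ p μ ^ d μ) ^ pairing k ℓ (simpleRoot k ℓ ν) (coroot k ℓ c)) ∧
      (∀ c, ρ (t c) (∏ μ, aVar k ℓ p μ ^ d μ) = ∏ μ, aVar k ℓ p μ ^ d μ) ∧
      -- quadratic degree growth
      (∀ c (n : ℕ), t c ^ n = t (n • c) ∧ ∀ i,
        actCoh k ℓ (t c ^ n) (hyp k ℓ i) =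
          hyp k ℓ i - ((n : ℤ) * pairing k ℓ (hyp k ℓ i) (deltaCheck k ℓ)) • root k ℓ c
          + ((n : ℤ) * pairing k ℓ (hyp k ℓ i) (coroot k ℓ c)
              - (n : ℤ) ^ 2 * halfNorm k ℓ c
                * pairing k ℓ (hyp k ℓ i) (deltaCheck k ℓ)) • delta k ℓ) ∧
      (∀ c (n : ℕ) i j,
        (degIn k ℓ j ((ρ (t c) ^ n) (fVar k ℓ i)) : ℤ) ≤
          pairing k ℓ (actCoh k ℓ (t c ^ n) (hyp k ℓ i)) (hyp k ℓ j)) ∧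
      (∀ c, ∃ C : ℕ, ∀ n : ℕ, 1 ≤ n → ∀ i j,
        |pairing k ℓ (actCoh k ℓ (t c ^ n) (hyp k ℓ i)) (hyp k ℓ j)| ≤ (C : ℤ) * (n : ℤ) ^ 2 ∧
        degIn k ℓ j ((ρ (t c) ^ n) (fVar k ℓ i)) ≤ C * n ^ 2) := by
  have h1 := eq_one_of_isAffineType k ℓ haff
  -- As `k_0 + ℓ_0 = 2` divides `p`, the square roots `b_n` of the `a_n^0` exist in `𝕂`.
  have h2p : 2 ∣ p := by
    have h := hdvd 0
    rwa [(h1 0).1, (h1 0).2] at h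
  have hadd := weylTranslation_mul h1
  have hcomm : ∀ c c', weylTranslation h1 c * weylTranslation h1 c' =
      weylTranslation h1 c' * weylTranslation h1 c := fun c c' => by
    rw [hadd, hadd, add_comm]
  have hdeg : ∀ c (n : ℕ) i j,
      (degIn k ℓ j ((birRep p h1 (weylTranslation h1 c) ^ n) (fVar k ℓ i)) : ℤ) ≤
        pairing k ℓ (actCoh k ℓ (weylTranslation h1 c ^ n) (hyp k ℓ i)) (hyp k ℓ j) := fun c n i j => by
    rw [← map_pow]
    exact degIn_birRep_le hp h2p h1 _ i j
  -- All marks are `1`, so `q` is the product of all root variables. By the symmetry of the cycle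
  -- any node may be omitted for the complement; `(0, 0)` is taken.
  refine ⟨fun w => ⟨pairing_weylGroup k ℓ w.2, weylGroup_delta h1 w.2⟩,
    two_dvd_pairing_root_coroot h1, fun _ => 1, fun _ => one_pos, root_one h1, coroot_one h1,
    weylTranslation h1, fun _ _ => rfl, fun _ _ => rfl, fun c c' => ⟨hadd c c', hcomm c c'⟩,
    ⟨latticePart h1, rfl, latticePart_normal h1, centre k ℓ 0, latticePart_isComplement' h1 0⟩,
    birRep p h1, fun ν => ?_, fun c c' R => ?_, fun c ν => ?_, fun c => ?_,
    fun c n => ⟨weylTranslation_pow h1 c n, fun i => ?_⟩, hdeg, fun c => ?_⟩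
  · rw [← node_eq_centre h1 ν, birRep_simpleRefl]
    exact isBirationalReflection_birRefl p h1 ν.1
  · rw [← hadd, map_mul, ← AlgEquiv.mul_apply, ← AlgEquiv.mul_apply, ← map_mul, ← map_mul,
      hcomm c' c]
    exact ⟨rfl, rfl⟩
  · simp only [zpow_one]
    exact birRep_weylTranslation_aVar p h1 c ν
  · simp only [zpow_one]
    exact birRep_weylTranslation_prod_aVar p h1 c
  · rw [weylTranslation_pow]
    exact kacCoh_nsmul h1 c n _
  · obtain ⟨C, hC⟩ := exists_abs_pairing_kacCoh_nsmul_le h1 c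
    refine ⟨C, fun n hn i j => ?_⟩
    have h3 : |pairing k ℓ (actCoh k ℓ (weylTranslation h1 c ^ n) (hyp k ℓ i)) (hyp k ℓ j)| ≤
        (C : ℤ) * (n : ℤ) ^ 2 := by
      rw [weylTranslation_pow]
      exact hC n hn i j
    refine ⟨h3, ?_⟩
    have h4 := (hdeg c n i j).trans ((le_abs_self _).trans h3)
    exact_mod_cast h4
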